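/- Let $\mathcal{A}$ be a non-trivial interval of $\mathbb{R}$. For $\rho>0$ put $S(\rho,\mathcal{A})=\{|\zeta|<\rho\}\cup\{r e^{i\theta} : r>0,\ \theta\in\mathcal{A}\}$. For a formal series $\tilde\phi(z)=\sum_{n\ge0}a_nz^{-n}\in\mathbb{C}[[z^{-1}]]$ let $c=a_0$ be its constant term and $\hat\varphi(\zeta)=\sum_{n\ge0}a_{n+1}\zeta^n/n!$. When $\hat\varphi$ is a convergent germ that extends analytically to $S(\rho,\mathcal{A})$, put, for $\tau\in\mathbb{R}$, $$\|\tilde\phi\|_{\rho,\tau}=|c|+\sup_{\zeta\in S(\rho,\mathcal{A})}e^{-\tau|\zeta|}\,|\hat\varphi(\zeta)|\in[0,\infty],$$ and put $\|\tilde\phi\|_{\rho,\tau}=\infty$ otherwise. The series $\tilde\phi$ is called $1$-summable in the directions of $\mathcal{A}$ if $\|\tilde\phi\|_{\rho,\tau}<\infty$ for some $\rho>0$, $\tau\in\mathbb{R}$; then its Borel sum $\operatorname{Sum}^{\mathcal{A}}\tilde\phi$ is the function on $\Sigma^{\mathcal{A}}_\tau=\bigcup_{\theta\in\mathcal{A}}\{z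 : \operatorname{Re}(ze^{i\theta})>\tau\}$ given by $$(\operatorname{Sum}^{\mathcal{A}}\tilde\phi)(z)=c+\int_0^{e^{i\theta}\infty}\hat\varphi(\zeta)\,e^{-z\zeta}\,d\zeta$$ with any $\theta\in\mathcal{A}$ such that $\operatorname{Re}(ze^{i\theta})>\tau$ (the value does not depend on $\theta$). Here $\Sigma^{\mathcal{A}}_\tau$ is viewed as a subset of the Riemann surface of the logarithm if $\tau\ge0$ and $\mathcal{A}$ has length $\ge\pi$, and as a subset of $\mathbb{C}$ otherwise. Let $\tilde{\mathscr G}=z+\mathbb{C}[[z^{-1}]]$ be the group, for composition, of formal tangent-to-identity diffeomorphisms, let $\tilde{\mathscr G}^{\mathcal{A}}$ be the set of all $z+\tilde\phi(z)$ with $\tilde\phi$ $1$-summable in the directions of $\mathcal{A}$, and, for $\tilde f=z+\tilde\phi$, write $\|\tilde f\|_{\rho,\tau}=\|\tilde\phi\|_{\rho,\tau}$ and $\operatorname{Sum}^{\mathcal{A}}\tilde f=\mathrm{Id}+\operatorname{Sum}^{\mathcal{A}}\tilde\phi$. **Theorem.** The set $\tilde{\mathscr G}^{\mathcal{A}}$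 is a subgroup of $\tilde{\mathscr G}$ and contains $z+\mathbb{C}\{z^{-1}\}$. Let $\rho>0$, $\tau\in\mathbb{R}$ and $\tilde f,\tilde g\in\tilde{\mathscr G}^{\mathcal{A}}$ with $\|\tilde f\|_{\rho,\tau},\|\tilde g\|_{\rho,\tau}<\infty$, and let $\tau'=\tau+1+\|\tilde f\|_{\rho,\tau}$. Then $$\|\tilde g\circ\tilde f\|_{\rho,\tau'}\le\|\tilde f\|_{\rho,\tau}+\|\tilde g\|_{\rho,\tau},\qquad \|\tilde f^{\circ(-1)}\|_{\rho,\tau'}\le\|\tilde f\|_{\rho,\tau}.$$ Moreover $\operatorname{Sum}^{\mathcal{A}}\tilde f$ maps $\Sigma^{\mathcal{A}}_{\tau'}$ into $\Sigma^{\mathcal{A}}_{\tau}$, so that $(\operatorname{Sum}^{\mathcal{A}}\tilde g)\circ(\operatorname{Sum}^{\mathcal{A}}\tilde f)$ is well-defined on $\Sigma^{\mathcal{A}}_{\tau'}$, and it coincides there with $\operatorname{Sum}^{\mathcal{A}}(\tilde g\circ\tilde f)$. Finally, for all $\tau''$ large enough, $\operatorname{Sum}^{\mathcal{A}}\tilde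 f$ is injective on $\Sigma^{\mathcal{A}}_{\tau''}$, and $(\operatorname{Sum}^{\mathcal{A}}(\tilde f^{\circ(-1)}))\circ(\operatorname{Sum}^{\mathcal{A}}\tilde f)$ is well-defined and coincides with $\mathrm{Id}$ on $\Sigma^{\mathcal{A}}_{\tau''}$. -/

import Mathlib

noncomputable section

open Complex MeasureTheory Set
open scoped ENNReal

/-! ### The group of formal tangent-to-identity diffeomorphisms

A formal series `∑ aₙ z⁻ⁿ` is represented by the power series `∑ aₙ Xⁿ`, with `X = z⁻¹`. -/

/-- An element `f(z) = z + φ(z)` of `z + ℂ[[z⁻¹]]`, given by its part `φ = tail`. -/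
@[ext] structure TangentDiffeo where
  tail : PowerSeries ℂ

namespace TangentDiffeo

open PowerSeries

/-- The expansion of `1 / f(z)` in powers of `X = z⁻¹`: since `f(z) = X⁻¹ (1 + X φ)`,
it is `X (1 + X φ)⁻¹`. -/
def recip (f : TangentDiffeo) : PowerSeries ℂ := X * (1 + X * f.tail)⁻¹

/-- The composition `f ∘ g = g + φ ∘ g` (for `f = z + φ`), where `φ ∘ g` is obtained from `φ` by
substituting `1 / g(z)` for `z⁻¹`. -/
def comp (f g : TangentDiffeo) : TangentDiffeo := ⟨g.tail + f.tail.subst g.recip⟩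

theorem one_add_ne (φ : PowerSeries ℂ) : constantCoeff (1 + X * φ) ≠ 0 := by simp

theorem recip_mul (f : TangentDiffeo) : f.recip * (1 + X * f.tail) = X := by
  rw [recip, mul_assoc, PowerSeries.inv_mul_cancel _ (one_add_ne _), mul_one]

theorem constantCoeff_recip (f : TangentDiffeo) : constantCoeff f.recip = 0 := by simp [recip]

theorem hasSubst_recip (f : TangentDiffeo) : HasSubst f.recip :=
  HasSubst.of_constantCoeff_zero' f.constantCoeff_recip

theorem eq_recip {f : TangentDiffeo} {u : PowerSeries ℂ} (h : u * (1 + X * f.tail) = X) :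
    u = f.recip := by
  rw [recip, PowerSeries.eq_mul_inv_iff_mul_eq (one_add_ne _), h]

theorem recip_injective : Function.Injective recip := by
  intro f g h
  have hf := f.recip_mul
  have hg := g.recip_mul
  have h0 : g.recip ≠ 0 := by
    intro h0
    rw [h0, zero_mul] at hg
    exact X_ne_zero hg.symm
  have h1 := mul_left_cancel₀ h0 ((h ▸ hf).trans hg.symm)
  exact TangentDiffeo.ext (mul_left_cancel₀ X_ne_zero (add_left_cancel h1))

theorem recip_comp (f g : TangentDiffeo) : (comp f g).recip = f.recip.subst g.recip := by
  symm
  apply eq_recip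
  have h := congrArg (fun p => PowerSeries.subst g.recip p) f.recip_mul
  have hs := g.hasSubst_recip
  have h1 : PowerSeries.subst g.recip (1 : PowerSeries ℂ) = (1 : PowerSeries ℂ) := by
    rw [← coe_substAlgHom hs, map_one]
  simp only [subst_mul hs, subst_add hs, subst_X hs, h1] at h
  have hg := g.recip_mul
  have hg0 : (1 + X * g.tail) ≠ 0 := fun h0 => one_add_ne g.tail (by rw [h0, map_zero])
  simp only [comp]
  generalize PowerSeries.subst g.recip f.recip = a at h ⊢
  generalize PowerSeries.subst g.recip f.tail = b at h ⊢
  linear_combination (1 + X * g.tail) * h + (1 - a * b) * hg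

theorem coeff_one_recip (f : TangentDiffeo) : PowerSeries.coeff 1 f.recip = 1 := by
  rw [recip, show (1 : ℕ) = 0 + 1 from rfl, coeff_succ_X_mul, coeff_zero_eq_constantCoeff_apply,
    constantCoeff_inv]
  simp

theorem exists_left_inv (f : TangentDiffeo) : ∃ h : TangentDiffeo, comp h f = ⟨0⟩ := by
  have hc1 := f.coeff_one_recip
  have hu : IsUnit (PowerSeries.coeff 1 f.recip) := by rw [hc1]; exact isUnit_one
  obtain ⟨Q, hQ0, hQ1, hQ⟩ : ∃ Q : PowerSeries ℂ, constantCoeff Q = 0 ∧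
      PowerSeries.coeff 1 Q = 1 ∧ Q.subst f.recip = (X : PowerSeries ℂ) := by
    refine ⟨PowerSeries.substInvOfIsUnit f.recip hu,
      PowerSeries.constantCoeff_substInvOfIsUnit _ _, ?_,
      PowerSeries.subst_substInvOfIsUnit_left _ f.constantCoeff_recip hu⟩
    rw [PowerSeries.coeff_one_substInvOfIsUnit]
    have : hu.unit = 1 := Units.ext hc1
    simp [this]
  obtain ⟨q, rfl⟩ := X_dvd_iff.2 hQ0
  have hq : constantCoeff q = 1 := by
    rwa [show (1 : ℕ) = 0 + 1 from rfl, coeff_succ_X_mul,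
      coeff_zero_eq_constantCoeff_apply] at hQ1
  obtain ⟨t, ht⟩ : X ∣ q⁻¹ - 1 := X_dvd_iff.2 (by simp [hq])
  refine ⟨⟨t⟩, recip_injective ?_⟩
  have h1 : X * q = recip ⟨t⟩ := eq_recip (by
    rw [← ht, add_sub_cancel, mul_assoc, PowerSeries.mul_inv_cancel _ (by simp [hq]), mul_one])
  rw [recip_comp, ← h1, hQ]
  exact eq_recip (by simp)

instance : Mul TangentDiffeo := ⟨comp⟩

instance : One TangentDiffeo := ⟨⟨0⟩⟩

instance : Inv TangentDiffeo := ⟨fun f => (exists_left_inv f).choose⟩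

/-- The group law is composition: `f * g = f ∘ g`, the unit is the identity `z`, and `f⁻¹` is the
compositional inverse. -/
instance : Group TangentDiffeo :=
  Group.ofLeftAxioms
    (fun f g h => recip_injective <| by
      change (comp (comp f g) h).recip = (comp f (comp g h)).recip
      rw [recip_comp, recip_comp, recip_comp, recip_comp,
        subst_comp_subst_apply g.hasSubst_recip h.hasSubst_recip])
    (fun f => recip_injective <| by
      change (comp ⟨0⟩ f).recip = f.recip
      have h0 : recip ⟨0⟩ = X := (eq_recip (by simp)).symm
      rw [recip_comp, h0, subst_X f.hasSubst_recip])
    (fun f => (exists_left_inv f).choose_spec)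

end TangentDiffeo

/-! ### `1`-summable series -/

/-- `∑ aₙ z⁻ⁿ` is convergent, i.e. belongs to `ℂ{z⁻¹}`. -/
def IsConvergent (φ : PowerSeries ℂ) : Prop :=
  0 < (FormalMultilinearSeries.ofScalars ℂ (fun n => PowerSeries.coeff n φ)).radius

/-- `S(ρ, 𝒜)`: the disc of radius `ρ` together with the rays of directions `θ ∈ 𝒜`. -/
def sectorDisc (A : Set ℝ) (ρ : ℝ) : Set ℂ :=
  Metric.ball 0 ρ ∪ {ζ | ∃ r θ : ℝ, 0 < r ∧ θ ∈ A ∧ ζ = r * exp (θ * I)}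

/-- `h` is an analytic extension to `S(ρ, 𝒜)` of the formal Borel transform
`∑ aₙ₊₁ ζⁿ / n!` of `∑ aₙ z⁻ⁿ` (the constant term `a₀` being left aside), which is in particular
required to be convergent. -/
def IsBorelExtension (A : Set ℝ) (ρ : ℝ) (φ : PowerSeries ℂ) (h : ℂ → ℂ) : Prop :=
  HasFPowerSeriesAt h
    (FormalMultilinearSeries.ofScalars ℂ
      (fun n => PowerSeries.coeff (n + 1) φ / (n.factorial : ℂ))) 0 ∧
  AnalyticOnNhd ℂ h (sectorDisc A ρ)

/-- `φ` is `1`-summable in the directions of `𝒜`. -/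
def OneSummable (A : Set ℝ) (φ : PowerSeries ℂ) : Prop :=
  ∃ ρ > 0, ∃ h : ℂ → ℂ, IsBorelExtension A ρ φ h ∧
    ∃ τ C : ℝ, 0 < C ∧ ∀ ζ ∈ sectorDisc A ρ, ‖h ζ‖ ≤ C * Real.exp (τ * ‖ζ‖)

/-- The norm `‖φ‖_{ρ,τ} = |c| + sup_{S(ρ, 𝒜)} e^{-τ|ζ|} |φ̂(ζ)|`. The infimum is over the analytic
extensions of the Borel transform, which all agree on `S(ρ, 𝒜)`; if there is none, it is `∞`. -/
def borelNorm (A : Set ℝ) (ρ τ : ℝ) (φ : PowerSeries ℂ) : ℝ≥0∞ :=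
  ENNReal.ofReal ‖PowerSeries.constantCoeff φ‖ +
    ⨅ (h : ℂ → ℂ) (_ : IsBorelExtension A ρ φ h),
      ⨆ ζ ∈ sectorDisc A ρ, ENNReal.ofReal (Real.exp (-τ * ‖ζ‖) * ‖h ζ‖)

open Classical in
/-- The Borel transform, extended analytically along the rays of directions in `𝒜`. -/
def borelTransform (A : Set ℝ) (φ : PowerSeries ℂ) : ℂ → ℂ :=
  if H : ∃ h : ℂ → ℂ, ∃ ρ > 0, IsBorelExtension A ρ φ h then H.choose else 0

/-- `c + ∫₀^{e^{iθ}∞} φ̂(ζ) e^{-zζ} dζ`. -/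
def laplaceSum (A : Set ℝ) (φ : PowerSeries ℂ) (z : ℂ) (θ : ℝ) : ℂ :=
  PowerSeries.constantCoeff φ +
    ∫ r in Ioi (0 : ℝ), borelTransform A φ (r * exp (θ * I)) * exp (-z * (r * exp (θ * I))) *
      exp (θ * I)

/-! ### The domain `Σ^𝒜_τ` and Borel sums -/

/-- A point `z` of the half-plane `Re (z e^{iθ}) > τ`, together with the direction `θ ∈ 𝒜`. -/
structure HalfPlanePoint (A : Set ℝ) (τ : ℝ) where
  z : ℂ
  θ : ℝ
  mem : θ ∈ A
  lt : τ < (z * exp (θ * I)).re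

namespace HalfPlanePoint

/-- For `τ ≥ 0`, the point of the Riemann surface of the logarithm (as seen in the coordinate
`log z = log |z| + i arg z`) above `z`, with `|arg z + θ| < π / 2`. -/
def logCoord {A : Set ℝ} {τ : ℝ} (p : HalfPlanePoint A τ) : ℂ :=
  log (p.z * exp (p.θ * I)) - p.θ * I

/-- Two pairs `(z, θ)` represent the same point of `Σ^𝒜_τ` if the underlying complex numbers are
the same and, in the case `τ ≥ 0`, if they are also the same on the Riemann surface of the
logarithm (this is automatic if `𝒜` has length less than `π`). -/
def setoid (A : Set ℝ) (τ : ℝ) : Setoid (HalfPlanePoint A τ) where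
  r p q := p.z = q.z ∧ (0 ≤ τ → p.logCoord = q.logCoord)
  iseqv :=
    ⟨fun _ => ⟨rfl, fun _ => rfl⟩, fun h => ⟨h.1.symm, fun t => (h.2 t).symm⟩,
      fun h k => ⟨h.1.trans k.1, fun t => (h.2 t).trans (k.2 t)⟩⟩

end HalfPlanePoint

/-- `Σ^𝒜_τ`, the union of the half-planes `Re (z e^{iθ}) > τ` for `θ ∈ 𝒜`, viewed as a subset of
the Riemann surface of the logarithm if `τ ≥ 0`, and of `ℂ` if `τ < 0`. -/
def SumDomain (A : Set ℝ) (τ : ℝ) : Type := Quotient (HalfPlanePoint.setoid A τ)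

namespace SumDomain

variable {A : Set ℝ} {τ : ℝ}

/-- The point of `Σ^𝒜_τ` which `(z, θ)` represents. -/
def mk (p : HalfPlanePoint A τ) : SumDomain A τ := Quotient.mk (HalfPlanePoint.setoid A τ) p

/-- A pair `(z, θ)` which represents a given point. -/
def rep (P : SumDomain A τ) : HalfPlanePoint A τ := Quotient.out P

/-- The projection `Σ^𝒜_τ → ℂ`. -/
def proj (P : SumDomain A τ) : ℂ :=
  Quotient.lift (s := HalfPlanePoint.setoid A τ) HalfPlanePoint.z (fun _ _ => And.left) P

end SumDomain

/-- The Borel sum `Sum^𝒜 φ`, computed at a point of `Σ^𝒜_τ` with any `θ ∈ 𝒜` such that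
`Re (z e^{iθ}) > τ`. -/
def borelSum (A : Set ℝ) {τ : ℝ} (φ : PowerSeries ℂ) (P : SumDomain A τ) : ℂ :=
  laplaceSum A φ P.rep.z P.rep.θ

/-- `Sum^𝒜 f = Id + Sum^𝒜 φ` for `f = z + φ`. -/
def sumDiffeo (A : Set ℝ) {τ : ℝ} (f : TangentDiffeo) (P : SumDomain A τ) : ℂ :=
  P.proj + borelSum A f.tail P

/-- `F` is `Sum^𝒜 f` viewed as a map from `Σ^𝒜_{τ₁}` to `Σ^𝒜_{τ₂}`: a point `z` in the half-plane of
direction `θ` is mapped to the point `(Sum^𝒜 f)(z)`, which lies in the half-plane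
`Re (w e^{iθ}) > τ₂` of the same direction. -/
def IsSumMap (A : Set ℝ) (f : TangentDiffeo) {τ₁ τ₂ : ℝ}
    (F : SumDomain A τ₁ → SumDomain A τ₂) : Prop :=
  ∀ p : HalfPlanePoint A τ₁, ∃ q : HalfPlanePoint A τ₂,
    q.θ = p.θ ∧ q.z = sumDiffeo A f (SumDomain.mk p) ∧ F (SumDomain.mk p) = SumDomain.mk q

end

/-!
The Borel transform turns products of series into convolutions, and the set `S(ρ, 𝒜)` is
star-shaped with respect to `0`, so that convolution along segments (`conv`) acts on the analytic
functions on `S(ρ, 𝒜)`. If these are bounded by `F e^{τ|ζ|}`, then their `n`-th convolution powers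
are bounded by `Fⁿ |ζ|ⁿ⁻¹ / (n - 1)! e^{τ|ζ|}` (`norm_convPow_le`).

*Norm estimates.* Write `f = z + c + φ` and let `φ`, `ψ` also denote the Borel transforms of the
series in `f` and `g`. Taylor's formula for `g ∘ f` and Lagrange's formula for `f⁻¹` become, after
a Borel transformation, the explicit series of analytic functions `compBorel` and `invBorel`. Their
`k`-th terms are bounded by multiples of `(√F |ζ|)²ᵏ / (2k)!` and `(2√F |ζ|)²ᵏ / (2k)!`, so that the
sums are bounded by hyperbolic cosines, and replacing `τ` by `τ + |c| + 2√F ≤ τ + 1 + |c| + F`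
suffices (`norm_compBorel_le`, `norm_invBorel_le`).

*Identification.* On each ray the Laplace transform (`lap`) turns these two series into the
composition and into the inverse of functions (`lap_compBorel`, `lap_tsum_invTerm`). By Watson's
lemma (`hasAsympExp_lap`) Laplace transforms have the original series as asymptotic expansions, and
asymptotic expansions are compatible with composition and unique (`HasAsympExp.subst`,
`HasAsympExp.unique`). Hence the explicit series are the Borel transforms of the formal composition
and of the formal inverse (`isBorelExtension_mul`, `isBorelExtension_inv`), and no computation with
formal Borel transforms is needed. The same two formulas for the Laplace transforms give the
identities between Borel sums.

*Independence of the direction* (`lap_eq_lap`). Two directions at an angle less than `π` are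
compared by a rotation of the contour in a region where both integrals converge well, followed by
analytic continuation. Two pairs `(z, θ)` represent the same point of `Σ^𝒜_τ` if and only if the
numbers `z` agree and, when `τ ≥ 0`, the angle is less than `π` (`SumDomain.mk_eq_mk_iff`). For
`τ < 0` larger angles occur, but then the transforms in opposite directions glue to a bounded entire
function that tends to `0`, and both vanish by Liouville's theorem (`lap_eq_zero`).

Injectivity is a consequence of the left inverse `Sum f⁻¹`, as the direction `θ` is preserved.
-/

noncomputable section

open Complex MeasureTheory Set
open scoped ENNReal
open Filter Asymptotics Topology

/-! ### Convolution on star-shaped sets -/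

/-- Differentiation under the integral sign, for an integrand that is jointly continuous together
with its derivative. -/
theorem hasDerivAt_integral_of_continuousOn {U : Set ℂ} (hU : IsOpen U) {G G' : ℂ → ℝ → ℂ}
    (hG : ContinuousOn (fun p : ℂ × ℝ => G p.1 p.2) (U ×ˢ Icc 0 1))
    (hG' : ContinuousOn (fun p : ℂ × ℝ => G' p.1 p.2) (U ×ˢ Icc 0 1))
    (hd : ∀ ζ ∈ U, ∀ t ∈ Icc (0 : ℝ) 1, HasDerivAt (fun w => G w t) (G' ζ t) ζ)
    {ζ : ℂ} (hζ : ζ ∈ U) :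
    HasDerivAt (fun w => ∫ t in (0 : ℝ)..1, G w t) (∫ t in (0 : ℝ)..1, G' ζ t) ζ := by
  obtain ⟨ε, hε, hεU⟩ := Metric.nhds_basis_closedBall.mem_iff.1 (hU.mem_nhds hζ)
  have hK : IsCompact (Metric.closedBall ζ ε ×ˢ Icc (0 : ℝ) 1) :=
    (isCompact_closedBall ζ ε).prod isCompact_Icc
  obtain ⟨C, hC⟩ := hK.exists_bound_of_continuousOn
    (hG'.mono (prod_mono hεU Subset.rfl))
  have hslice : ∀ {H : ℂ → ℝ → ℂ}, ContinuousOn (fun p : ℂ × ℝ => H p.1 p.2) (U ×ˢ Icc 0 1) →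
      ∀ w ∈ U, ContinuousOn (H w) (Icc 0 1) := fun hH w hw =>
    hH.comp (f := fun t : ℝ => (w, t)) (by fun_prop) fun t ht => ⟨hw, ht⟩
  have hsub : uIoc (0 : ℝ) 1 ⊆ Icc 0 1 := by
    rw [uIoc_of_le zero_le_one]; exact Ioc_subset_Icc_self
  refine (intervalIntegral.hasDerivAt_integral_of_dominated_loc_of_deriv_le
    (μ := volume) (F := G) (F' := G') (bound := fun _ => C) (a := 0) (b := 1)
    (Metric.closedBall_mem_nhds ζ hε) ?_ ?_ ?_ ?_ ?_ ?_).2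
  · filter_upwards [hU.mem_nhds hζ] with w hw
    exact ((hslice hG w hw).mono hsub).aestronglyMeasurable measurableSet_uIoc
  · exact ContinuousOn.intervalIntegrable (by
      rw [uIcc_of_le zero_le_one]; exact hslice hG ζ hζ)
  · exact ((hslice hG' ζ hζ).mono hsub).aestronglyMeasurable measurableSet_uIoc
  · exact .of_forall fun t ht w hw => hC (w, t) ⟨hw, hsub ht⟩
  · exact intervalIntegrable_const
  · exact .of_forall fun t ht w hw => hd w (hεU hw) t (hsub ht)

/-- The convolution `∫₀^ζ f(η) g(ζ - η) dη` along the segment from `0` to `ζ`, with the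
parametrization `η = tζ`. -/
def conv (f g : ℂ → ℂ) (ζ : ℂ) : ℂ :=
  ζ * ∫ t in (0 : ℝ)..1, f (t * ζ) * g (((1 - t : ℝ) : ℂ) * ζ)

/-- `convPow f n` is the convolution power with `n + 1` factors `f`. -/
def convPow (f : ℂ → ℂ) : ℕ → ℂ → ℂ
  | 0 => f
  | n + 1 => conv f (convPow f n)

theorem StarConvex.ofReal_mul_mem {S : Set ℂ} (hS : StarConvex ℝ 0 S) {ζ : ℂ} (hζ : ζ ∈ S)
    {t : ℝ} (ht : t ∈ Icc (0 : ℝ) 1) : (t : ℂ) * ζ ∈ S := by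
  rw [← real_smul]; exact hS.smul_mem hζ ht.1 ht.2

theorem one_sub_mem_Icc {t : ℝ} (ht : t ∈ Icc (0 : ℝ) 1) : 1 - t ∈ Icc (0 : ℝ) 1 :=
  ⟨by linarith [ht.2], by linarith [ht.1]⟩

/-- Every neighbourhood of a star-shaped set contains an open star-shaped neighbourhood. -/
theorem exists_open_starConvex {S V : Set ℂ} (hS : StarConvex ℝ 0 S) (hV : IsOpen V)
    (hSV : S ⊆ V) : ∃ U : Set ℂ, IsOpen U ∧ StarConvex ℝ 0 U ∧ S ⊆ U ∧ U ⊆ V := by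
  -- the union of the segments from `0` that are contained in `V`
  refine ⟨{ζ | ∀ t ∈ Icc (0 : ℝ) 1, (t : ℂ) * ζ ∈ V}, ?_, ?_, ?_, ?_⟩
  · rw [isOpen_iff_eventually]
    intro ζ hζ
    refine isCompact_Icc.eventually_forall_of_forall_eventually
      (P := fun (w : ℂ) (t : ℝ) => (t : ℂ) * w ∈ V) fun t ht => ?_
    have hc : Continuous fun p : ℂ × ℝ => (p.2 : ℂ) * p.1 := by fun_prop
    exact hc.continuousAt.eventually (hV.mem_nhds (hζ t ht))
  · rw [starConvex_zero_iff]
    intro ζ hζ a ha ha' t ht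
    rw [real_smul, ← mul_assoc, ← ofReal_mul]
    exact hζ _ ⟨mul_nonneg ht.1 ha, mul_le_one₀ ht.2 ha ha'⟩
  · exact fun ζ hζ t ht => hSV (hS.ofReal_mul_mem hζ ht)
  · intro ζ hζ
    simpa using hζ 1 (by simp)

section Conv

variable {S : Set ℂ} {f g : ℂ → ℂ}

theorem continuousOn_comp_ofReal_mul (hS : StarConvex ℝ 0 S) (hf : ContinuousOn f S) :
    ContinuousOn (fun p : ℂ × ℝ => f (p.2 * p.1)) (S ×ˢ Icc 0 1) :=
  hf.comp (f := fun p : ℂ × ℝ => (p.2 : ℂ) * p.1) (by fun_prop)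
    fun p hp => hS.ofReal_mul_mem hp.1 hp.2

theorem continuousOn_comp_one_sub_mul (hS : StarConvex ℝ 0 S) (hf : ContinuousOn f S) :
    ContinuousOn (fun p : ℂ × ℝ => f (((1 - p.2 : ℝ) : ℂ) * p.1)) (S ×ˢ Icc 0 1) :=
  hf.comp (f := fun p : ℂ × ℝ => ((1 - p.2 : ℝ) : ℂ) * p.1) (by fun_prop)
    fun p hp => hS.ofReal_mul_mem hp.1 (one_sub_mem_Icc hp.2)

theorem continuousOn_conv_integrand (hS : StarConvex ℝ 0 S) (hf : ContinuousOn f S)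
    (hg : ContinuousOn g S) {ζ : ℂ} (hζ : ζ ∈ S) :
    ContinuousOn (fun t : ℝ => f (t * ζ) * g (((1 - t : ℝ) : ℂ) * ζ)) (Icc 0 1) :=
  ((continuousOn_comp_ofReal_mul hS hf).mul (continuousOn_comp_one_sub_mul hS hg)).comp
    (f := fun t : ℝ => (ζ, t)) (by fun_prop) fun _ ht => ⟨hζ, ht⟩

theorem differentiableOn_conv_of_isOpen {U : Set ℂ} (hU : IsOpen U) (hS : StarConvex ℝ 0 U)
    (hf : DifferentiableOn ℂ f U) (hg : DifferentiableOn ℂ g U) :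
    DifferentiableOn ℂ (conv f g) U := by
  intro ζ hζ
  have hf' := (hf.deriv hU).continuousOn
  have hg' := (hg.deriv hU).continuousOn
  have c1 := continuousOn_comp_ofReal_mul hS hf.continuousOn
  have c2 := continuousOn_comp_one_sub_mul hS hg.continuousOn
  have c3 := continuousOn_comp_ofReal_mul hS hf'
  have c4 := continuousOn_comp_one_sub_mul hS hg'
  have key := hasDerivAt_integral_of_continuousOn hU
    (G := fun w t => f (t * w) * g (((1 - t : ℝ) : ℂ) * w))
    (G' := fun w t => deriv f (t * w) * t * g (((1 - t : ℝ) : ℂ) * w) +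
      f (t * w) * (deriv g (((1 - t : ℝ) : ℂ) * w) * ((1 - t : ℝ) : ℂ)))
    (c1.mul c2)
    (((c3.mul (by fun_prop)).mul c2).add (c1.mul (c4.mul (by fun_prop)))) ?_ hζ
  · exact (differentiableAt_id.mul key.differentiableAt).differentiableWithinAt
  · intro w hw t ht
    have h1 := (hf.differentiableAt (hU.mem_nhds (hS.ofReal_mul_mem hw ht))).hasDerivAt
    have h2 := (hg.differentiableAt
      (hU.mem_nhds (hS.ofReal_mul_mem hw (one_sub_mem_Icc ht)))).hasDerivAt
    have h3 : HasDerivAt (fun w : ℂ => (t : ℂ) * w) t w := by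
      simpa using (hasDerivAt_id w).const_mul (t : ℂ)
    have h4 : HasDerivAt (fun w : ℂ => ((1 - t : ℝ) : ℂ) * w) ((1 - t : ℝ) : ℂ) w := by
      simpa using (hasDerivAt_id w).const_mul ((1 - t : ℝ) : ℂ)
    exact (h1.comp w h3).mul (h2.comp w h4)

theorem AnalyticOnNhd.exists_open_starConvex (hS : StarConvex ℝ 0 S) (hf : AnalyticOnNhd ℂ f S)
    (hg : AnalyticOnNhd ℂ g S) : ∃ U : Set ℂ, IsOpen U ∧ StarConvex ℝ 0 U ∧ S ⊆ U ∧
      DifferentiableOn ℂ f U ∧ DifferentiableOn ℂ g U := by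
  obtain ⟨U, h1, h2, h3, h4⟩ := _root_.exists_open_starConvex hS
    ((isOpen_analyticAt ℂ f).inter (isOpen_analyticAt ℂ g)) fun ζ hζ => ⟨hf ζ hζ, hg ζ hζ⟩
  exact ⟨U, h1, h2, h3, fun ζ hζ => (h4 hζ).1.differentiableAt.differentiableWithinAt,
    fun ζ hζ => (h4 hζ).2.differentiableAt.differentiableWithinAt⟩

theorem AnalyticOnNhd.conv (hS : StarConvex ℝ 0 S) (hf : AnalyticOnNhd ℂ f S)
    (hg : AnalyticOnNhd ℂ g S) : AnalyticOnNhd ℂ (conv f g) S := by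
  obtain ⟨U, hU, hUs, hSU, hfU, hgU⟩ := hf.exists_open_starConvex hS hg
  exact ((differentiableOn_conv_of_isOpen hU hUs hfU hgU).analyticOnNhd hU).mono hSU

theorem AnalyticOnNhd.convPow (hS : StarConvex ℝ 0 S) (hf : AnalyticOnNhd ℂ f S) (n : ℕ) :
    AnalyticOnNhd ℂ (convPow f n) S := by
  induction n with
  | zero => exact hf
  | succ n ih => exact hf.conv hS ih

/-- The beta integral with integral parameters, which is responsible for the factorials in
`norm_conv_le`. -/
theorem integral_pow_mul_one_sub_pow (a b : ℕ) :
    ∫ t in (0 : ℝ)..1, t ^ a * (1 - t) ^ b =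
      (a.factorial * b.factorial : ℝ) / (a + b + 1).factorial := by
  have h := Gamma_mul_Gamma_eq_betaIntegral (s := a + 1) (t := b + 1)
    (by norm_cast; positivity) (by norm_cast; positivity)
  rw [show (a + 1 + (b + 1) : ℂ) = ((a + b + 1 : ℕ) : ℂ) + 1 by push_cast; ring,
    Gamma_nat_eq_factorial, Gamma_nat_eq_factorial, Gamma_nat_eq_factorial, betaIntegral] at h
  have h1 : (∫ x in (0 : ℝ)..1, (x : ℂ) ^ ((a : ℂ) + 1 - 1) * (1 - (x : ℂ)) ^ ((b : ℂ) + 1 - 1)) =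
      ((∫ t in (0 : ℝ)..1, t ^ a * (1 - t) ^ b : ℝ) : ℂ) := by
    rw [← intervalIntegral.integral_ofReal]
    simp
  rw [h1] at h
  have h0 : ((a + b + 1).factorial : ℝ) ≠ 0 := by positivity
  rw [eq_div_iff h0]
  rw [mul_comm]
  exact_mod_cast h.symm

theorem norm_conv_le (hS : StarConvex ℝ 0 S) {A B τ : ℝ} {a b : ℕ} (hA : 0 ≤ A)
    (hf : ∀ ζ ∈ S, ‖f ζ‖ ≤ A * (‖ζ‖ ^ a / a.factorial) * Real.exp (τ * ‖ζ‖))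
    (hg : ∀ ζ ∈ S, ‖g ζ‖ ≤ B * (‖ζ‖ ^ b / b.factorial) * Real.exp (τ * ‖ζ‖)) :
    ∀ ζ ∈ S, ‖conv f g ζ‖ ≤
      A * B * (‖ζ‖ ^ (a + b + 1) / (a + b + 1).factorial) * Real.exp (τ * ‖ζ‖) := by
  intro ζ hζ
  have hb : ∀ t ∈ Ioc (0 : ℝ) 1, ‖f (t * ζ) * g (((1 - t : ℝ) : ℂ) * ζ)‖ ≤
      (A * B * ‖ζ‖ ^ (a + b) / (a.factorial * b.factorial) * Real.exp (τ * ‖ζ‖)) *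
        (t ^ a * (1 - t) ^ b) := by
    intro t ht
    have ht' : t ∈ Icc (0 : ℝ) 1 := Ioc_subset_Icc_self ht
    have h1 := hf _ (hS.ofReal_mul_mem hζ ht')
    have h2 := hg _ (hS.ofReal_mul_mem hζ (one_sub_mem_Icc ht'))
    rw [norm_mul, norm_real, Real.norm_of_nonneg ht'.1] at h1
    rw [norm_mul _ ζ, norm_real, Real.norm_of_nonneg (one_sub_mem_Icc ht').1] at h2
    rw [norm_mul]
    refine (mul_le_mul h1 h2 (norm_nonneg _) (by have := ht'.1; positivity)).trans_eq ?_
    rw [show τ * ‖ζ‖ = τ * (t * ‖ζ‖) + τ * ((1 - t) * ‖ζ‖) by ring, Real.exp_add,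
      mul_pow, mul_pow]
    field_simp
    ring
  rw [conv, norm_mul]
  have h3 := intervalIntegral.norm_integral_le_of_norm_le (μ := volume) zero_le_one
    (.of_forall hb) (Continuous.intervalIntegrable (by fun_prop) _ _)
  rw [intervalIntegral.integral_const_mul, integral_pow_mul_one_sub_pow] at h3
  refine (mul_le_mul_of_nonneg_left h3 (norm_nonneg _)).trans_eq ?_
  field_simp
  ring

theorem norm_convPow_le (hS : StarConvex ℝ 0 S) {F τ : ℝ} (hF : 0 ≤ F)
    (hf : ∀ ζ ∈ S, ‖f ζ‖ ≤ F * Real.exp (τ * ‖ζ‖)) (n : ℕ) :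
    ∀ ζ ∈ S, ‖convPow f n ζ‖ ≤
      F ^ (n + 1) * (‖ζ‖ ^ n / n.factorial) * Real.exp (τ * ‖ζ‖) := by
  induction n with
  | zero => simpa [convPow] using hf
  | succ n ih =>
    intro ζ hζ
    have := norm_conv_le hS (a := 0) (b := n) hF (by simpa using hf) ih ζ hζ
    rw [zero_add] at this
    rwa [pow_succ' F (n + 1)]

/-- A series of analytic functions on a star-shaped set `S` has an analytic sum if, on every
star-shaped set where `f` and `g` are bounded by exponentials, its terms are bounded by those
of `cosh`. -/
theorem analyticOnNhd_tsum_of_starConvex (hS : StarConvex ℝ 0 S) (hf : AnalyticOnNhd ℂ f S)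
    (hg : AnalyticOnNhd ℂ g S) {T : ℕ → ℂ → ℂ}
    (hT : ∀ U : Set ℂ, StarConvex ℝ 0 U → AnalyticOnNhd ℂ f U → AnalyticOnNhd ℂ g U →
      ∀ k, AnalyticOnNhd ℂ (T k) U)
    (hb : ∀ K : Set ℂ, StarConvex ℝ 0 K → ∀ M : ℝ, 0 ≤ M → (∀ ζ ∈ K, ‖f ζ‖ ≤ M) →
      (∀ ζ ∈ K, ‖g ζ‖ ≤ M) → ∃ C a b : ℝ, ∀ ζ ∈ K, ∀ k,
        ‖T k ζ‖ ≤ C * ((b * ‖ζ‖) ^ (2 * k) / (2 * k).factorial) * Real.exp (a * ‖ζ‖)) :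
    AnalyticOnNhd ℂ (fun ζ => ∑' k, T k ζ) S := by
  obtain ⟨U, hU, hUs, hSU, hfU, hgU⟩ := hf.exists_open_starConvex hS hg
  intro ζ hζ
  obtain ⟨ε, hε, hεU⟩ := Metric.nhds_basis_closedBall.mem_iff.1 (hU.mem_nhds (hSU hζ))
  -- the segments from `0` to the points of a disc around `ζ`: a compact star-shaped set
  set K : Set ℂ := (fun p : ℂ × ℝ => (p.2 : ℂ) * p.1) '' (Metric.closedBall ζ ε ×ˢ Icc 0 1)
  have hK : IsCompact K :=
    ((isCompact_closedBall ζ ε).prod isCompact_Icc).image (by fun_prop)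
  have hKs : StarConvex ℝ 0 K := by
    rw [starConvex_zero_iff]
    rintro _ ⟨⟨w, t⟩, ⟨hw, ht⟩, rfl⟩ a ha ha'
    refine ⟨(w, a * t), ⟨hw, mul_nonneg ha ht.1, mul_le_one₀ ha' ht.1 ht.2⟩, ?_⟩
    simp only [real_smul]
    push_cast
    ring
  have hKU : K ⊆ U := by
    rintro _ ⟨⟨w, t⟩, ⟨hw, ht⟩, rfl⟩
    exact hUs.ofReal_mul_mem (hεU hw) ht
  have hBK : Metric.ball ζ ε ⊆ K := fun w hw =>
    ⟨(w, 1), ⟨Metric.ball_subset_closedBall hw, by simp⟩, by simp⟩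
  obtain ⟨M1, hM1⟩ := hK.exists_bound_of_continuousOn (hfU.continuousOn.mono hKU)
  obtain ⟨M2, hM2⟩ := hK.exists_bound_of_continuousOn (hgU.continuousOn.mono hKU)
  obtain ⟨R, hR⟩ := hK.isBounded.exists_norm_le
  obtain ⟨C, a, b, hC⟩ := hb K hKs (max 0 (max M1 M2)) (le_max_left _ _)
    (fun w hw => (hM1 w hw).trans (by simp)) (fun w hw => (hM2 w hw).trans (by simp))
  have hsum : Summable fun k : ℕ =>
      |C| * ((|b| * R) ^ (2 * k) / (2 * k).factorial) * Real.exp (|a| * R) :=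
    ((Real.hasSum_cosh (|b| * R)).summable.mul_left _).mul_right _
  have hd : DifferentiableOn ℂ (fun w => ∑' k, T k w) (Metric.ball ζ ε) := by
    refine differentiableOn_tsum_of_summable_norm hsum (fun k => ?_) Metric.isOpen_ball ?_
    · exact ((hT U hUs (hfU.analyticOnNhd hU) (hgU.analyticOnNhd hU) k).differentiableOn).mono
        (hBK.trans hKU)
    · intro k w hw
      have hw' := hBK hw
      refine (hC w hw' k).trans ?_
      have hwR := hR w hw'
      have h1 : (b * ‖w‖) ^ (2 * k) ≤ (|b| * R) ^ (2 * k) := by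
        rw [pow_mul, pow_mul]
        refine pow_le_pow_left₀ (sq_nonneg _) ?_ k
        rw [mul_pow, mul_pow, sq_abs]
        gcongr
      have h2 : a * ‖w‖ ≤ |a| * R :=
        mul_le_mul (le_abs_self a) hwR (norm_nonneg _) (abs_nonneg _)
      have h3 : 0 ≤ (b * ‖w‖) ^ (2 * k) := by rw [pow_mul]; positivity
      have h4 := h3.trans h1
      have := le_abs_self C
      gcongr
  exact hd.analyticAt (Metric.ball_mem_nhds ζ hε)

end Conv

/-! ### The Laplace transform along a ray -/

/-- The Laplace transform `∫₀^{e∞} h(ζ) e^{-zζ} dζ` along the ray of direction `e`. -/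
def lap (e : ℂ) (h : ℂ → ℂ) (z : ℂ) : ℂ :=
  ∫ r in Ioi (0 : ℝ), h (r * e) * exp (-z * (r * e)) * e

theorem integral_pow_mul_exp_neg (n : ℕ) {x : ℝ} (hx : 0 < x) :
    ∫ r in Ioi (0 : ℝ), r ^ n * Real.exp (-(x * r)) = n.factorial / x ^ (n + 1) := by
  have h := Real.integral_rpow_mul_exp_neg_mul_Ioi (a := n + 1) (r := x) (by positivity) hx
  simp only [add_sub_cancel_right, Real.rpow_natCast, Real.Gamma_nat_eq_factorial] at h
  rw [h, ← Nat.cast_add_one, Real.rpow_natCast, one_div, inv_pow]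
  field_simp

theorem integrableOn_pow_mul_exp_neg (n : ℕ) {x : ℝ} (hx : 0 < x) :
    IntegrableOn (fun r : ℝ => r ^ n * Real.exp (-(x * r))) (Ioi 0) := by
  by_contra h
  have h1 := integral_pow_mul_exp_neg n hx
  rw [integral_undef h] at h1
  have : (0 : ℝ) < n.factorial / x ^ (n + 1) := by positivity
  exact this.ne h1

section Lap

variable {e z : ℂ} {h : ℂ → ℂ}

theorem norm_lap_integrand_le (he : ‖e‖ = 1) {C τ r : ℝ} {n : ℕ}
    (hb : ‖h (r * e)‖ ≤ C * (r ^ n / n.factorial) * Real.exp (τ * r)) :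
    ‖h (r * e) * exp (-z * (r * e)) * e‖ ≤
      C / n.factorial * (r ^ n * Real.exp (-(((z * e).re - τ) * r))) := by
  rw [norm_mul, norm_mul, he, mul_one, norm_exp]
  have h1 : (-z * (r * e)).re = -((z * e).re * r) := by
    rw [show -z * (r * e) = ((-r : ℝ) : ℂ) * (z * e) by push_cast; ring, re_ofReal_mul]; ring
  rw [h1]
  refine (mul_le_mul_of_nonneg_right hb (Real.exp_nonneg _)).trans_eq ?_
  rw [show -(((z * e).re - τ) * r) = τ * r + -((z * e).re * r) by ring, Real.exp_add]
  ring

theorem lap_integrableOn (he : ‖e‖ = 1)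
    (hc : ContinuousOn (fun r : ℝ => h (r * e)) (Ioi 0)) {C τ : ℝ} {n : ℕ}
    (hb : ∀ r : ℝ, 0 < r → ‖h (r * e)‖ ≤ C * (r ^ n / n.factorial) * Real.exp (τ * r))
    (hz : τ < (z * e).re) :
    IntegrableOn (fun r : ℝ => h (r * e) * exp (-z * (r * e)) * e) (Ioi 0) := by
  refine Integrable.mono' ((integrableOn_pow_mul_exp_neg n (sub_pos.2 hz)).const_mul
    (C / n.factorial)) ?_ ?_
  · exact ((hc.mul (by fun_prop)).mul (by fun_prop)).aestronglyMeasurable measurableSet_Ioi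
  · exact (ae_restrict_iff' measurableSet_Ioi).2
      (.of_forall fun r hr => norm_lap_integrand_le he (hb r hr))

theorem integral_norm_lap_le (he : ‖e‖ = 1) {C τ : ℝ} {n : ℕ}
    (hb : ∀ r : ℝ, 0 < r → ‖h (r * e)‖ ≤ C * (r ^ n / n.factorial) * Real.exp (τ * r))
    (hz : τ < (z * e).re) :
    ∫ r in Ioi (0 : ℝ), ‖h (r * e) * exp (-z * (r * e)) * e‖ ≤
      C / ((z * e).re - τ) ^ (n + 1) := by
  have h1 := integral_mono_of_nonneg (μ := volume.restrict (Ioi (0 : ℝ)))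
    (.of_forall fun r => norm_nonneg (h (r * e) * exp (-z * (r * e)) * e))
    ((integrableOn_pow_mul_exp_neg n (sub_pos.2 hz)).const_mul (C / n.factorial))
    ((ae_restrict_iff' measurableSet_Ioi).2
      (.of_forall fun r hr => norm_lap_integrand_le he (hb r hr)))
  refine h1.trans_eq ?_
  rw [integral_const_mul, integral_pow_mul_exp_neg n (sub_pos.2 hz)]
  field_simp

theorem norm_lap_le (he : ‖e‖ = 1) {C τ : ℝ} {n : ℕ}
    (hb : ∀ r : ℝ, 0 < r → ‖h (r * e)‖ ≤ C * (r ^ n / n.factorial) * Real.exp (τ * r))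
    (hz : τ < (z * e).re) : ‖lap e h z‖ ≤ C / ((z * e).re - τ) ^ (n + 1) :=
  (norm_integral_le_integral_norm _).trans (integral_norm_lap_le he hb hz)

theorem hasSum_lap {ι : Type*} [Countable ι] (he : ‖e‖ = 1) {T : ι → ℂ → ℂ}
    (hc : ∀ k, ContinuousOn (fun r : ℝ => T k (r * e)) (Ioi 0)) {C : ι → ℝ} {τ : ℝ} {n : ι → ℕ}
    (hb : ∀ k, ∀ r : ℝ, 0 < r →
      ‖T k (r * e)‖ ≤ C k * (r ^ n k / (n k).factorial) * Real.exp (τ * r))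
    (hz : τ < (z * e).re) (hs : Summable fun k => C k / ((z * e).re - τ) ^ (n k + 1)) :
    HasSum (fun k => lap e (T k) z) (lap e (fun ζ => ∑' k, T k ζ) z) := by
  have h1 := hasSum_integral_of_summable_integral_norm
    (F := fun k (r : ℝ) => T k (r * e) * exp (-z * (r * e)) * e)
    (fun k => lap_integrableOn he (hc k) (hb k) hz)
    (.of_nonneg_of_le (fun k => integral_nonneg fun _ => norm_nonneg _)
      (fun k => integral_norm_lap_le he (hb k) hz) hs)
  simp only [tsum_mul_right] at h1
  exact h1

theorem lap_const_mul (a : ℂ) : lap e (fun ζ => a * h ζ) z = a * lap e h z := by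
  simp only [lap, mul_assoc a, integral_const_mul]

/-- Multiplication by `e^{aζ}` corresponds to the translation by `-a`. -/
theorem lap_exp_mul (a : ℂ) : lap e (fun ζ => exp (a * ζ) * h ζ) z = lap e h (z - a) := by
  simp only [lap]
  congr 1
  ext r
  rw [show -(z - a) * (r * e) = a * (r * e) + -z * (r * e) by ring, exp_add]
  ring

/-- The Laplace transform turns convolutions into products. -/
theorem lap_conv {f g : ℂ → ℂ}
    (hf : IntegrableOn (fun r : ℝ => f (r * e) * exp (-z * (r * e)) * e) (Ioi 0))
    (hg : IntegrableOn (fun r : ℝ => g (r * e) * exp (-z * (r * e)) * e) (Ioi 0)) :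
    lap e (conv f g) z = lap e f z * lap e g z := by
  have h1 := integral_posConvolution hf hg (ContinuousLinearMap.mul ℝ ℂ)
  rw [ContinuousLinearMap.mul_apply'] at h1
  rw [lap, lap, lap, ← h1]
  refine setIntegral_congr_fun measurableSet_Ioi fun x _ => ?_
  simp only [ContinuousLinearMap.mul_apply']
  have h2 := intervalIntegral.smul_integral_comp_mul_right (a := 0) (b := 1)
    (f := fun t : ℝ => f (t * e) * exp (-z * (t * e)) * e *
      (g (((x - t : ℝ) : ℂ) * e) * exp (-z * (((x - t : ℝ) : ℂ) * e)) * e)) (c := x)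
  rw [zero_mul, one_mul] at h2
  rw [← h2, conv, real_smul]
  have h3 : ∀ t : ℝ, f (((t * x : ℝ) : ℂ) * e) * exp (-z * (((t * x : ℝ) : ℂ) * e)) * e *
      (g (((x - t * x : ℝ) : ℂ) * e) * exp (-z * (((x - t * x : ℝ) : ℂ) * e)) * e) =
      f (t * (x * e)) * g (((1 - t : ℝ) : ℂ) * (x * e)) * (exp (-z * (x * e)) * e * e) := by
    intro t
    rw [show -z * (x * e) = -z * (((t * x : ℝ) : ℂ) * e) + -z * (((x - t * x : ℝ) : ℂ) * e) by
      push_cast; ring, exp_add,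
      show ((t * x : ℝ) : ℂ) * e = t * (x * e) by push_cast; ring,
      show ((x - t * x : ℝ) : ℂ) * e = ((1 - t : ℝ) : ℂ) * (x * e) by push_cast; ring]
    ring
  simp only [h3, intervalIntegral.integral_mul_const]
  ring

end Lap

/-! ### Asymptotic expansions -/

/-- `F` has the asymptotic expansion `P` along the filter `l` (which tends to `0`): up to any order
`N`, `F` is approximated by a polynomial that agrees with `P` up to order `N`. -/
def HasAsympExp (l : Filter ℂ) (F : ℂ → ℂ) (P : PowerSeries ℂ) : Prop :=
  ∀ N : ℕ, ∃ p : Polynomial ℂ, (fun x => F x - p.eval x) =O[l] (fun x => x ^ N) ∧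
    (PowerSeries.X : PowerSeries ℂ) ^ N ∣ P - p

namespace HasAsympExp

variable {l l' : Filter ℂ} {F G u : ℂ → ℂ} {P Q U : PowerSeries ℂ}

theorem of_polynomial (p : Polynomial ℂ) : HasAsympExp l (fun x => p.eval x) p := fun N =>
  ⟨p, by simpa using isBigO_zero _ _, by simp⟩

theorem isBigO_eval (hl : l ≤ 𝓝 0) (p : Polynomial ℂ) :
    (fun x => p.eval x) =O[l] (fun _ => (1 : ℂ)) :=
  (p.continuous.tendsto 0).mono_left hl |>.isBigO_one ℂ

theorem isBigO_eval_of_dvd (hl : l ≤ 𝓝 0) {p : Polynomial ℂ} {N : ℕ}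
    (h : (PowerSeries.X : PowerSeries ℂ) ^ N ∣ p) :
    (fun x => p.eval x) =O[l] (fun x => x ^ N) := by
  have h1 : Polynomial.X ^ N ∣ p := by
    rw [Polynomial.X_pow_dvd_iff]
    intro d hd
    simpa using PowerSeries.X_pow_dvd_iff.1 h d hd
  obtain ⟨q, rfl⟩ := h1
  simpa using (isBigO_refl (fun x : ℂ => x ^ N) l).mul (isBigO_eval hl q)

theorem isBigO_one (hl : l ≤ 𝓝 0) (hF : HasAsympExp l F P) : F =O[l] (fun _ => (1 : ℂ)) := by
  obtain ⟨p, hp, -⟩ := hF 0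
  exact ((hp.congr_right fun x => pow_zero x).add (isBigO_eval hl p)).congr_left fun x => by simp

theorem add (hF : HasAsympExp l F P) (hG : HasAsympExp l G Q) :
    HasAsympExp l (fun x => F x + G x) (P + Q) := by
  intro N
  obtain ⟨p, hp, hp'⟩ := hF N
  obtain ⟨q, hq, hq'⟩ := hG N
  refine ⟨p + q, (hp.add hq).congr_left fun x => ?_, ?_⟩
  · simp; ring
  · convert dvd_add hp' hq' using 1
    simp; ring

theorem mul (hl : l ≤ 𝓝 0) (hF : HasAsympExp l F P) (hG : HasAsympExp l G Q) :
    HasAsympExp l (fun x => F x * G x) (P * Q) := by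
  intro N
  obtain ⟨p, hp, hp'⟩ := hF N
  obtain ⟨q, hq, hq'⟩ := hG N
  refine ⟨p * q, ?_, ?_⟩
  · have h1 := (hp.mul (hG.isBigO_one hl)).add ((hq.mul (isBigO_eval hl p)))
    refine (h1.congr_left fun x => ?_).congr_right fun x => ?_
    · simp; ring
    · simp
  · convert dvd_add (hp'.mul_right Q) (hq'.mul_left p) using 1
    simp; ring

/-- The inverse has the expansion `P⁻¹`: if the polynomials `p`, `q` agree with `P`, `P⁻¹` up to
order `N`, then `1 - p q` is divisible by `Xᴺ` and `1 / F - q = (1 - p q - (F - p) q) / F`. -/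
theorem inv (hl : l ≤ 𝓝 0) (hF : HasAsympExp l F P) (hP : PowerSeries.constantCoeff P ≠ 0) :
    HasAsympExp l (fun x => (F x)⁻¹) P⁻¹ := by
  have hF0 : Tendsto F l (𝓝 (PowerSeries.constantCoeff P)) := by
    obtain ⟨p, hp, hp'⟩ := hF 1
    have h1 : p.eval 0 = PowerSeries.constantCoeff P := by
      rw [pow_one, PowerSeries.X_dvd_iff, map_sub, sub_eq_zero] at hp'
      rw [hp', ← Polynomial.coeff_zero_eq_eval_zero]
      simp
    have h2 : Tendsto (fun x => F x - p.eval x) l (𝓝 0) :=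
      hp.trans_tendsto ((tendsto_id'.2 hl).congr fun x => (pow_one x).symm)
    have h3 := h2.add ((p.continuous.tendsto 0).mono_left hl)
    simpa [h1] using h3
  have hinv : (fun x => (F x)⁻¹) =O[l] (fun _ => (1 : ℂ)) := (hF0.inv₀ hP).isBigO_one ℂ
  have hne : ∀ᶠ x in l, F x ≠ 0 := hF0.eventually_ne hP
  intro N
  obtain ⟨p, hp, hp'⟩ := hF N
  refine ⟨P⁻¹.trunc N, ?_, ?_⟩
  · set q := P⁻¹.trunc N
    have hq : (PowerSeries.X : PowerSeries ℂ) ^ N ∣ P⁻¹ - (q : PowerSeries ℂ) := by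
      rw [PowerSeries.X_pow_dvd_iff]
      intro m hm
      simp [q, PowerSeries.coeff_trunc, hm]
    have hpq : (PowerSeries.X : PowerSeries ℂ) ^ N ∣
        ((1 - p * q : Polynomial ℂ) : PowerSeries ℂ) := by
      have h1 := PowerSeries.mul_inv_cancel P hP
      convert dvd_add (hp'.mul_right P⁻¹) (hq.mul_left (p : PowerSeries ℂ)) using 1
      push_cast
      linear_combination -h1
    have h1 := ((isBigO_eval_of_dvd hl hpq).sub ((hp.mul (isBigO_eval hl q)).congr_right
      fun x => mul_one _)).mul hinv
    refine (h1.congr' ?_ (by simp))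
    filter_upwards [hne] with x hx
    simp only [Polynomial.eval_sub, Polynomial.eval_mul, Polynomial.eval_one]
    field_simp
    ring
  · rw [PowerSeries.X_pow_dvd_iff]
    intro m hm
    simp [PowerSeries.coeff_trunc, hm]

theorem polynomial_comp (hl : l ≤ 𝓝 0) (hu : HasAsympExp l u U) (p : Polynomial ℂ) :
    HasAsympExp l (fun x => p.eval (u x)) (p.aeval U) := by
  induction p using Polynomial.induction_on' with
  | add p q hp hq => simpa using hp.add hq
  | monomial n a =>
    have hpow : HasAsympExp l (fun x => u x ^ n) (U ^ n) := by
      induction n with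
      | zero => simpa using of_polynomial (l := l) 1
      | succ n ih => simpa [pow_succ] using ih.mul hl hu
    have := (of_polynomial (l := l) (Polynomial.C a)).mul hl hpow
    simpa [Polynomial.aeval_monomial] using this

/-- Expansions can be substituted into each other. The expansion of the outer function is needed
along a filter `l'` to which the inner function tends. -/
theorem subst (hl : l ≤ 𝓝 0) (hF : HasAsympExp l' F P) (hu : HasAsympExp l u U)
    (hU : PowerSeries.constantCoeff U = 0) (ht : Tendsto u l l') :
    HasAsympExp l (fun x => F (u x)) (P.subst U) := by
  have hs : PowerSeries.HasSubst U := PowerSeries.HasSubst.of_constantCoeff_zero' hU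
  have hu1 : u =O[l] (fun x => x) := by
    obtain ⟨p, hp, hp'⟩ := hu 1
    rw [pow_one, PowerSeries.X_dvd_iff, map_sub, hU, zero_sub, neg_eq_zero] at hp'
    have h1 := isBigO_eval_of_dvd (l := l) hl (p := p) (N := 1) (by
      rw [pow_one, PowerSeries.X_dvd_iff, hp'])
    simpa using hp.add h1
  intro N
  obtain ⟨p, hp, R, hR⟩ := hF N
  obtain ⟨q, hq, hq'⟩ := (polynomial_comp hl hu p) N
  refine ⟨q, ?_, ?_⟩
  · have h1 := (hp.comp_tendsto ht).trans (hu1.pow N)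
    simpa using h1.add hq
  · have h2 : P.subst U - p.aeval U = U ^ N * R.subst U := by
      have h3 := congrArg (PowerSeries.substAlgHom hs) hR
      rw [map_sub, map_mul, map_pow, PowerSeries.substAlgHom_X] at h3
      rw [PowerSeries.coe_substAlgHom, PowerSeries.subst_coe hs] at h3
      exact h3
    have h4 : (PowerSeries.X : PowerSeries ℂ) ^ N ∣ U ^ N * R.subst U :=
      (pow_dvd_pow_of_dvd (PowerSeries.X_dvd_iff.2 hU) N).mul_right _
    rw [← h2] at h4
    convert dvd_add h4 hq' using 1
    ring

/-- Asymptotic expansions are unique: a polynomial which is `O(xᴺ)` is divisible by `Xᴺ`. -/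
theorem unique [l.NeBot] (hl : l ≤ 𝓝[≠] 0) (hP : HasAsympExp l F P) (hQ : HasAsympExp l F Q) :
    P = Q := by
  have key : ∀ (d : Polynomial ℂ) (N : ℕ), (fun x => d.eval x) =O[l] (fun x => x ^ N) →
      Polynomial.X ^ N ∣ d := by
    intro d N hd
    by_cases h0 : d = 0
    · simp [h0]
    obtain ⟨s, hs, hs'⟩ := Polynomial.exists_eq_pow_rootMultiplicity_mul_and_not_dvd d h0 0
    rw [Polynomial.C_0, sub_zero] at hs hs'
    set m := d.rootMultiplicity 0
    rcases le_or_gt N m with h | h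
    · rw [hs]; exact (pow_dvd_pow _ h).mul_right _
    exfalso
    have hl0 : l ≤ 𝓝 0 := hl.trans nhdsWithin_le_nhds
    have hne : ∀ᶠ x in l, x ≠ 0 := hl self_mem_nhdsWithin
    have h1 : (fun x => s.eval x) =O[l] (fun x => x ^ (N - m)) := by
      have h2 := hd.mul (isBigO_refl (fun x : ℂ => (x ^ m)⁻¹) l)
      refine h2.congr' ?_ ?_
      · filter_upwards [hne] with x hx
        rw [hs]
        simp only [Polynomial.eval_mul, Polynomial.eval_pow, Polynomial.eval_X]
        field_simp
      · filter_upwards [hne] with x hx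
        rw [pow_sub₀ x hx h.le]
    have h2 : Tendsto (fun x : ℂ => x ^ (N - m)) l (𝓝 0) := by
      have := ((continuous_pow (M := ℂ) (N - m)).tendsto 0).mono_left hl0
      rwa [zero_pow (by omega)] at this
    have h3 := tendsto_nhds_unique (h1.trans_tendsto h2) ((s.continuous.tendsto 0).mono_left hl0)
    exact hs' (Polynomial.X_dvd_iff.2 (by rw [Polynomial.coeff_zero_eq_eval_zero]; exact h3.symm))
  ext n
  obtain ⟨p, hp, hp'⟩ := hP (n + 1)
  obtain ⟨q, hq, hq'⟩ := hQ (n + 1)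
  have h1 : (fun x => (p - q).eval x) =O[l] (fun x => x ^ (n + 1)) :=
    (hq.sub hp).congr_left fun x => by simp
  have h2 := Polynomial.X_pow_dvd_iff.1 (key _ _ h1) n (Nat.lt_succ_self n)
  have h3 := PowerSeries.X_pow_dvd_iff.1 hp' n (Nat.lt_succ_self n)
  have h4 := PowerSeries.X_pow_dvd_iff.1 hq' n (Nat.lt_succ_self n)
  simp only [map_sub, Polynomial.coeff_coe, Polynomial.coeff_sub] at h2 h3 h4
  linear_combination h3 - h4 + h2

end HasAsympExp

/-! ### Asymptotic expansion of Laplace transforms -/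

/-- The punctured neighbourhoods of `0` in the sector of the `x = 1 / z` such that `z e` makes an
angle at most `π / 3` with the positive real axis. -/
def sectorFilter (e : ℂ) : Filter ℂ := 𝓝[≠] 0 ⊓ 𝓟 {x | ‖x‖⁻¹ / 2 ≤ (x⁻¹ * e).re}

/-- The punctured neighbourhoods of `0` in the ray of the `x = 1 / z` such that `z e > 0`. -/
def rayFilter (e : ℂ) : Filter ℂ := map (fun t : ℝ => (t : ℂ) * e) (𝓝[>] 0)

theorem sectorFilter_le (e : ℂ) : sectorFilter e ≤ 𝓝[≠] 0 := inf_le_left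

theorem rayFilter_le {e : ℂ} (he : ‖e‖ = 1) : rayFilter e ≤ sectorFilter e := by
  have he0 : e ≠ 0 := by rintro rfl; simp at he
  refine le_inf (tendsto_nhdsWithin_iff.2 ⟨?_, ?_⟩) ?_
  · have hc : Continuous fun t : ℝ => (t : ℂ) * e := by fun_prop
    simpa using (hc.tendsto 0).mono_left (nhdsWithin_le_nhds (s := Ioi 0))
  · filter_upwards [self_mem_nhdsWithin] with t (ht : 0 < t)
    exact mul_ne_zero (ofReal_ne_zero.2 ht.ne') he0
  · rw [rayFilter, le_principal_iff, mem_map]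
    filter_upwards [self_mem_nhdsWithin] with t (ht : 0 < t)
    have : ((t : ℂ) * e)⁻¹ * e = ((t⁻¹ : ℝ) : ℂ) := by push_cast; field_simp
    simp only [mem_preimage, mem_ofPred_eq, this, ofReal_re, norm_mul, he, mul_one, norm_real,
      Real.norm_of_nonneg ht.le]
    have : 0 < t⁻¹ := inv_pos.2 ht
    linarith

instance (e : ℂ) : (rayFilter e).NeBot := map_neBot

theorem HasAsympExp.mono {l l' : Filter ℂ} {F : ℂ → ℂ} {P : PowerSeries ℂ}
    (h : HasAsympExp l F P) (hl : l' ≤ l) : HasAsympExp l' F P := fun N =>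
  let ⟨p, hp, hp'⟩ := h N
  ⟨p, hp.mono hl, hp'⟩

theorem HasAsympExp.congr' {l : Filter ℂ} {F G : ℂ → ℂ} {P : PowerSeries ℂ}
    (h : HasAsympExp l F P) (hl : F =ᶠ[l] G) : HasAsympExp l G P := fun N =>
  let ⟨p, hp, hp'⟩ := h N
  ⟨p, hp.congr' (hl.sub EventuallyEq.rfl) EventuallyEq.rfl, hp'⟩

theorem pow_le_factorial_mul_exp (n : ℕ) {r : ℝ} (hr : 0 ≤ r) :
    r ^ n ≤ n.factorial * Real.exp r := by
  have := Real.pow_div_factorial_le_exp r hr n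
  rwa [div_le_iff₀' (by positivity)] at this

section Watson

variable {e z : ℂ} {h : ℂ → ℂ}

theorem integrableOn_pow_mul_exp (he : ‖e‖ = 1) (hz : 0 < (z * e).re) (n : ℕ) :
    IntegrableOn (fun r : ℝ => (r * e) ^ n * exp (-z * (r * e)) * e) (Ioi 0) :=
  lap_integrableOn (h := fun ζ => ζ ^ n) (τ := 0) (C := n.factorial) (n := n) he
    (by fun_prop) (fun r hr => by
      rw [norm_pow, norm_mul, he, mul_one, norm_real, Real.norm_of_nonneg hr.le]
      simp; field_simp; rfl) hz

theorem conv_one_pow (n : ℕ) (ζ : ℂ) :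
    conv (fun _ => 1) (fun w => w ^ n) ζ = ((n : ℂ) + 1)⁻¹ * ζ ^ (n + 1) := by
  have h1 := integral_pow_mul_one_sub_pow 0 n
  have h2 : ∫ t in (0 : ℝ)..1, (1 : ℂ) * (((1 - t : ℝ) : ℂ) * ζ) ^ n =
      ((∫ t in (0 : ℝ)..1, t ^ 0 * (1 - t) ^ n : ℝ) : ℂ) * ζ ^ n := by
    rw [← intervalIntegral.integral_ofReal, ← intervalIntegral.integral_mul_const]
    congr 1
    ext t
    rw [mul_pow]
    push_cast
    ring
  rw [conv, h2, h1, zero_add, Nat.factorial_succ]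
  push_cast
  have : (n.factorial : ℂ) ≠ 0 := Nat.cast_ne_zero.2 n.factorial_ne_zero
  have : (n : ℂ) + 1 ≠ 0 := Nat.cast_add_one_ne_zero n
  simp
  field_simp
  ring

theorem lap_one (he : ‖e‖ = 1) (hz : 0 < (z * e).re) : lap e (fun _ => 1) z = 1 / z := by
  have he0 : e ≠ 0 := by rintro rfl; simp at he
  have hz0 : z ≠ 0 := by rintro rfl; simp at hz
  have h1 := integral_exp_mul_complex_Ioi (a := -(z * e)) (by simpa using hz) 0
  rw [lap, integral_mul_const]
  have h2 : ∀ r : ℝ, (1 : ℂ) * exp (-z * (r * e)) = exp (-(z * e) * r) := fun r => by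
    rw [one_mul]; congr 1; ring
  simp only [h2, h1]
  simp
  field_simp

theorem lap_pow (he : ‖e‖ = 1) (hz : 0 < (z * e).re) (n : ℕ) :
    lap e (fun ζ => ζ ^ n) z = n.factorial / z ^ (n + 1) := by
  induction n with
  | zero => simpa using lap_one he hz
  | succ n ih =>
    have h1 := lap_conv (f := fun _ => 1) (g := fun w => w ^ n)
      (by simpa using integrableOn_pow_mul_exp he hz 0) (integrableOn_pow_mul_exp he hz n)
    simp only [funext (conv_one_pow n), lap_const_mul] at h1
    rw [ih, lap_one he hz, inv_mul_eq_iff_eq_mul₀ (Nat.cast_add_one_ne_zero n)] at h1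
    rw [h1, Nat.factorial_succ]
    push_cast
    ring

/-- The remainder of the Taylor series of `h` of order `N`, along the ray of direction `e`. It is
`O(rᴺ)` near `0` by the Taylor expansion, and elsewhere since `h` and the partial sums grow at most
exponentially. -/
theorem exists_norm_sub_le (he : ‖e‖ = 1) {b : ℕ → ℂ}
    (hp : HasFPowerSeriesAt h (FormalMultilinearSeries.ofScalars ℂ b) 0)
    {C τ : ℝ} (hb : ∀ r : ℝ, 0 < r → ‖h (r * e)‖ ≤ C * Real.exp (τ * r)) (N : ℕ) :
    ∃ K : ℝ, ∀ r : ℝ, 0 < r → ‖h (r * e) - ∑ n ∈ Finset.range N, b n * (r * e) ^ n‖ ≤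
      K * (r ^ N / N.factorial) * Real.exp ((|τ| + 1) * r) := by
  have h1 := hp.isBigO_sub_partialSum_pow N
  obtain ⟨K₀, hK₀, hK⟩ := h1.exists_pos
  obtain ⟨δ, hδ, hδK⟩ := Metric.eventually_nhds_iff.1 hK.bound
  set C₁ := |C| + ∑ n ∈ Finset.range N, ‖b n‖ * n.factorial
  have hC₁ : 0 ≤ C₁ := by positivity
  refine ⟨N.factorial * (K₀ + C₁ / δ ^ N), fun r hr => ?_⟩
  have hnorm : ‖(r : ℂ) * e‖ = r := by
    rw [norm_mul, he, mul_one, norm_real, Real.norm_of_nonneg hr.le]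
  have hrw : (N.factorial : ℝ) * (K₀ + C₁ / δ ^ N) * (r ^ N / N.factorial) =
      (K₀ + C₁ / δ ^ N) * r ^ N := by field_simp
  rw [hrw]
  rcases lt_or_ge r δ with hlt | hge
  · have h2 := hδK (y := r * e) (by rwa [dist_zero_right, hnorm])
    simp only [zero_add, FormalMultilinearSeries.partialSum,
      FormalMultilinearSeries.ofScalars_apply_eq, smul_eq_mul, norm_pow, hnorm,
      Real.norm_of_nonneg hr.le] at h2
    refine h2.trans ?_
    have h3 : 1 ≤ Real.exp ((|τ| + 1) * r) := Real.one_le_exp (by positivity)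
    refine le_trans ?_ (le_mul_of_one_le_right (by positivity) h3)
    gcongr
    have : 0 ≤ C₁ / δ ^ N := by positivity
    linarith
  · have h3 : ‖h (r * e) - ∑ n ∈ Finset.range N, b n * (r * e) ^ n‖ ≤
        C₁ * Real.exp ((|τ| + 1) * r) := by
      refine (norm_sub_le _ _).trans ?_
      rw [add_mul, Finset.sum_mul]
      refine add_le_add ?_ ((norm_sum_le _ _).trans (Finset.sum_le_sum fun n _ => ?_))
      · refine (hb r hr).trans ?_
        have h4 : τ * r ≤ (|τ| + 1) * r := by
          have := le_abs_self τ
          gcongr; linarith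
        have := le_abs_self C
        gcongr
      · rw [norm_mul, norm_pow, hnorm, mul_assoc]
        refine mul_le_mul_of_nonneg_left ((pow_le_factorial_mul_exp n hr.le).trans ?_)
          (norm_nonneg _)
        have h4 : r ≤ (|τ| + 1) * r := by nlinarith [abs_nonneg τ]
        gcongr
    refine h3.trans (mul_le_mul_of_nonneg_right ?_ (Real.exp_nonneg _))
    have h5 : δ ^ N ≤ r ^ N := by gcongr
    rw [add_mul, div_mul_eq_mul_div]
    have h6 : C₁ ≤ C₁ * r ^ N / δ ^ N := by rw [le_div_iff₀ (by positivity)]; gcongr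
    have h7 : 0 ≤ K₀ * r ^ N := by positivity
    linarith

/-- Watson's lemma: as `z → ∞` in a sector around the ray `z e > 0`, the Laplace transform of `h`
has the expansion whose formal Borel transform is the Taylor series of `h`. The variable of the
expansion is `x = 1 / z`. -/
theorem hasAsympExp_lap (he : ‖e‖ = 1) {φ : PowerSeries ℂ}
    (hp : HasFPowerSeriesAt h (FormalMultilinearSeries.ofScalars ℂ
      (fun n => PowerSeries.coeff (n + 1) φ / (n.factorial : ℂ))) 0)
    (hc : ContinuousOn (fun r : ℝ => h (r * e)) (Ioi 0))
    {C τ : ℝ} (hb : ∀ r : ℝ, 0 < r → ‖h (r * e)‖ ≤ C * Real.exp (τ * r)) :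
    HasAsympExp (sectorFilter e) (fun x => PowerSeries.constantCoeff φ + lap e h x⁻¹) φ := by
  intro N
  refine ⟨φ.trunc (N + 1), ?_, ?_⟩
  swap
  · rw [PowerSeries.X_pow_dvd_iff]
    intro m hm
    simp [PowerSeries.coeff_trunc, Nat.lt_succ_of_lt hm]
  set b : ℕ → ℂ := fun n => PowerSeries.coeff (n + 1) φ / (n.factorial : ℂ)
  obtain ⟨K, hK⟩ := exists_norm_sub_le he hp hb N
  set σ := |τ| + 1
  have hσ : 0 < σ := by positivity
  have hev : ∀ᶠ x in sectorFilter e, x ≠ 0 ∧ ‖x‖⁻¹ / 2 ≤ (x⁻¹ * e).re ∧ ‖x‖ < (4 * σ)⁻¹ := by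
    refine Eventually.and (sectorFilter_le e self_mem_nhdsWithin)
      (Eventually.and (mem_inf_of_right (mem_principal_self _)) ?_)
    have h0 : Tendsto (fun x : ℂ => ‖x‖) (𝓝 0) (𝓝 0) := by
      simpa using (continuous_norm (E := ℂ)).tendsto 0
    exact ((sectorFilter_le e).trans nhdsWithin_le_nhds)
      (h0.eventually_lt_const (by positivity))
  have hO : (fun x => lap e (fun ζ => h ζ - ∑ n ∈ Finset.range N, b n * ζ ^ n) x⁻¹)
      =O[sectorFilter e] (fun x => x ^ (N + 1)) := by
    refine IsBigO.of_bound (|K| * 4 ^ (N + 1)) ?_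
    filter_upwards [hev] with x ⟨hx0, hx1, hx2⟩
    have hx3 : 0 < ‖x‖ := norm_pos_iff.2 hx0
    have hx4 : 4 * σ < ‖x‖⁻¹ := by
      rwa [lt_inv_comm₀ (by positivity) hx3]
    have h4 : ‖x‖⁻¹ / 4 ≤ (x⁻¹ * e).re - σ := by linarith
    refine (norm_lap_le he hK (by linarith)).trans ?_
    rw [norm_pow]
    have h5 : 0 < ‖x‖⁻¹ / 4 := by positivity
    calc K / ((x⁻¹ * e).re - σ) ^ (N + 1) ≤ |K| / (‖x‖⁻¹ / 4) ^ (N + 1) := by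
          have := le_abs_self K
          gcongr
      _ = |K| * 4 ^ (N + 1) * ‖x‖ ^ (N + 1) := by rw [div_pow, inv_pow]; field_simp
  have hO' : (fun x : ℂ => x ^ (N + 1)) =O[sectorFilter e] (fun x => x ^ N) := by
    have h1 : (fun x : ℂ => x) =O[sectorFilter e] (fun _ => (1 : ℂ)) :=
      ((continuous_id.tendsto (0 : ℂ)).mono_left
        ((sectorFilter_le e).trans nhdsWithin_le_nhds)).isBigO_one ℂ
    simpa [pow_succ] using (isBigO_refl (fun x : ℂ => x ^ N) _).mul h1
  refine (hO.trans hO').congr' ?_ EventuallyEq.rfl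
  filter_upwards [hev] with x ⟨hx0, hx1, hx2⟩
  have hx3 : 0 < ‖x‖ := norm_pos_iff.2 hx0
  have hx4 : 4 * σ < ‖x‖⁻¹ := by
    rwa [lt_inv_comm₀ (by positivity) hx3]
  have hz1 : τ < (x⁻¹ * e).re := by
    have := le_abs_self τ
    simp only [σ] at hx4
    linarith
  have hz0 : 0 < (x⁻¹ * e).re := by linarith
  have i1 := lap_integrableOn (z := x⁻¹) he hc (n := 0) (by simpa using hb) hz1
  have i2 := integrableOn_pow_mul_exp he hz0
  have h6 : lap e (fun ζ => h ζ - ∑ n ∈ Finset.range N, b n * ζ ^ n) x⁻¹ =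
      lap e h x⁻¹ - ∑ n ∈ Finset.range N, b n * lap e (fun ζ => ζ ^ n) x⁻¹ := by
    simp only [← lap_const_mul]
    simp only [lap]
    rw [← integral_finsetSum, ← integral_sub i1]
    · congr 1
      ext r
      rw [sub_mul, sub_mul, Finset.sum_mul, Finset.sum_mul]
    · exact integrable_finsetSum _ fun n _ => by
        simpa only [IntegrableOn, mul_assoc] using (i2 n).const_mul (b n)
    · exact fun n _ => by
        simpa only [IntegrableOn, mul_assoc] using (i2 n).const_mul (b n)
  rw [h6]
  simp only [lap_pow he hz0]
  have h7 : (φ.trunc (N + 1)).eval x =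
      ∑ n ∈ Finset.range (N + 1), PowerSeries.coeff n φ * x ^ n := by
    exact PowerSeries.eval₂_trunc_eq_sum_range x (RingHom.id ℂ) (N + 1) φ
  rw [h7, Finset.sum_range_succ']
  have h8 : ∀ n, b n * (n.factorial / x⁻¹ ^ (n + 1)) =
      PowerSeries.coeff (n + 1) φ * x ^ (n + 1) := by
    intro n
    simp only [b]
    have : (n.factorial : ℂ) ≠ 0 := Nat.cast_ne_zero.2 n.factorial_ne_zero
    rw [inv_pow]
    field_simp
  simp only [h8]
  simp
  ring

end Watson

/-! ### The Borel transform of a composition -/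

/-- `h` is continuous on the open ray of direction `e`, where it grows at most exponentially, and
its Taylor series at `0` is the formal Borel transform of `φ`. -/
structure IsRayBorel (e : ℂ) (φ : PowerSeries ℂ) (h : ℂ → ℂ) (C τ : ℝ) : Prop where
  hasFPowerSeriesAt : HasFPowerSeriesAt h (FormalMultilinearSeries.ofScalars ℂ
    (fun n => PowerSeries.coeff (n + 1) φ / (n.factorial : ℂ))) 0
  continuousOn : ContinuousOn (fun r : ℝ => h (r * e)) (Ioi 0)
  bound : ∀ r : ℝ, 0 < r → ‖h (r * e)‖ ≤ C * Real.exp (τ * r)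

/-- Every Taylor series is the formal Borel transform of a series, with an arbitrary constant
term. -/
theorem exists_borel_preimage {h : ℂ → ℂ} (hh : AnalyticAt ℂ h 0) (a : ℂ) :
    ∃ φ : PowerSeries ℂ, PowerSeries.constantCoeff φ = a ∧
      HasFPowerSeriesAt h (FormalMultilinearSeries.ofScalars ℂ
        (fun n => PowerSeries.coeff (n + 1) φ / (n.factorial : ℂ))) 0 := by
  refine ⟨PowerSeries.mk fun n => Nat.casesOn n a fun m => iteratedDeriv m h 0, ?_, ?_⟩
  · rw [← PowerSeries.coeff_zero_eq_constantCoeff_apply]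
    exact PowerSeries.coeff_mk 0 _
  · simpa only [PowerSeries.coeff_mk] using hh.hasFPowerSeriesAt

/-- The asymptotic expansion of the composition of two Laplace transforms is the formal
composition. With `x = 1 / z` on a ray, `1 / (z + c + φ(z))` leaves the ray but it remains in a
sector around it, where the expansion of the outer function is available as well. -/
theorem hasAsympExp_mul_tail {e : ℂ} (he : ‖e‖ = 1) {f g : TangentDiffeo} {φ ψ : ℂ → ℂ}
    {C τ C' τ' : ℝ} (hf : IsRayBorel e f.tail φ C τ) (hg : IsRayBorel e g.tail ψ C' τ') :
    HasAsympExp (rayFilter e) (fun x =>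
      (PowerSeries.constantCoeff f.tail + lap e φ x⁻¹) + (PowerSeries.constantCoeff g.tail +
        lap e ψ (x⁻¹ + (PowerSeries.constantCoeff f.tail + lap e φ x⁻¹)))) (g * f).tail := by
  have hl : rayFilter e ≤ 𝓝[≠] 0 := (rayFilter_le he).trans (sectorFilter_le e)
  have hl0 : rayFilter e ≤ 𝓝 0 := hl.trans nhdsWithin_le_nhds
  have hF := (hasAsympExp_lap he hf.hasFPowerSeriesAt hf.continuousOn hf.bound).mono
    (rayFilter_le he)
  have hG := hasAsympExp_lap he hg.hasFPowerSeriesAt hg.continuousOn hg.bound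
  set A : ℂ → ℂ := fun x => PowerSeries.constantCoeff f.tail + lap e φ x⁻¹
  have hX : HasAsympExp (rayFilter e) (fun x => x) PowerSeries.X := by
    simpa using HasAsympExp.of_polynomial (l := rayFilter e) Polynomial.X
  have h1 : HasAsympExp (rayFilter e) (fun _ => 1) 1 := by
    simpa using HasAsympExp.of_polynomial (l := rayFilter e) 1
  have hw := h1.add (hX.mul hl0 hF)
  have hu := hX.mul hl0 (hw.inv hl0 (TangentDiffeo.one_add_ne f.tail))
  change HasAsympExp _ _ f.recip at hu
  have hne : ∀ᶠ x in rayFilter e, x ≠ 0 := hl self_mem_nhdsWithin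
  have hA := hF.isBigO_one hl0
  obtain ⟨M, hM, hMA⟩ := hA.exists_pos
  have hinv : ∀ x : ℂ, x ≠ 0 → (x * (1 + x * A x)⁻¹)⁻¹ = x⁻¹ + A x := fun x hx => by
    rw [mul_inv, inv_inv]; field_simp
  have hev : ∀ᶠ x in rayFilter e, ‖x‖ ≠ 0 ∧ (x⁻¹ * e).re = ‖x‖⁻¹ ∧ ‖x‖ < (3 * M)⁻¹ ∧
      ‖A x‖ ≤ M := by
    have h2 : ∀ᶠ x in rayFilter e, (x⁻¹ * e).re = ‖x‖⁻¹ := by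
      rw [rayFilter, eventually_map]
      filter_upwards [self_mem_nhdsWithin] with t (ht : 0 < t)
      have he0 : e ≠ 0 := by rintro rfl; simp at he
      have : ((t : ℂ) * e)⁻¹ * e = ((t⁻¹ : ℝ) : ℂ) := by push_cast; field_simp
      rw [this, ofReal_re, norm_mul, he, mul_one, norm_real, Real.norm_of_nonneg ht.le]
    have h3 : Tendsto (fun x : ℂ => ‖x‖) (𝓝 0) (𝓝 0) := by
      simpa using (continuous_norm (E := ℂ)).tendsto 0
    filter_upwards [hne, h2, hl0 (h3.eventually_lt_const (u := (3 * M)⁻¹) (by positivity)),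
      hMA.bound] with x hx hx2 hx3 hx4
    exact ⟨norm_ne_zero_iff.2 hx, hx2, hx3, by simpa using hx4⟩
  -- as `A` is bounded by `M`, the number `x⁻¹ + A x` has argument close to that of `x⁻¹`
  have ht : Tendsto (fun x => x * (1 + x * A x)⁻¹) (rayFilter e) (sectorFilter e) := by
    have hsec : ∀ᶠ x in rayFilter e, x⁻¹ + A x ≠ 0 ∧
        ‖x⁻¹ + A x‖ / 2 ≤ ((x⁻¹ + A x) * e).re := by
      filter_upwards [hev] with x ⟨hx0, hx1, hx2, hx3⟩
      have hx0' : 0 < ‖x‖ := lt_of_le_of_ne (norm_nonneg _) (Ne.symm hx0)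
      have hx4 : 3 * M < ‖x‖⁻¹ := by rwa [lt_inv_comm₀ (by positivity) hx0']
      have h5 : ‖x⁻¹ + A x‖ ≤ ‖x‖⁻¹ + M := by
        refine (norm_add_le _ _).trans ?_
        rw [norm_inv]
        linarith
      have h6 : ‖x‖⁻¹ - M ≤ ((x⁻¹ + A x) * e).re := by
        rw [add_mul, add_re, hx1]
        have h7 := (abs_le.1 (abs_re_le_norm (A x * e))).1
        rw [norm_mul, he, mul_one] at h7
        linarith
      refine ⟨fun h0 => ?_, by linarith⟩
      rw [h0, zero_mul, zero_re] at h6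
      linarith
    refine tendsto_inf.2 ⟨tendsto_nhdsWithin_iff.2 ⟨?_, ?_⟩, tendsto_principal.2 ?_⟩
    · have hb := (hw.inv hl0 (TangentDiffeo.one_add_ne f.tail)).isBigO_one hl0
      have h8 := (isBigO_refl (fun x : ℂ => x) (rayFilter e)).mul hb
      exact h8.trans_tendsto ((tendsto_id'.2 hl0).congr fun x => (mul_one x).symm)
    · filter_upwards [hsec, hne] with x hx hx0
      intro h0
      rw [mem_singleton_iff] at h0
      have := hinv x hx0
      rw [h0, inv_zero] at this
      exact hx.1 this.symm
    · filter_upwards [hsec, hne] with x hx hx0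
      rw [← norm_inv, hinv x hx0]
      exact hx.2
  have hcomp := hF.add (hG.subst hl0 hu f.constantCoeff_recip ht)
  refine HasAsympExp.congr' hcomp ?_
  filter_upwards [hne] with x hx
  rw [hinv x hx]

section Comp

/-- The factor `e^{-cζ} (-ζ)ᵏ / k! ψ(ζ)`, the Borel transform of the `k`-th term of the Taylor
expansion of `z ↦ ψ(z + c)`. -/
def taylorFactor (c : ℂ) (ψ : ℂ → ℂ) (k : ℕ) (ζ : ℂ) : ℂ :=
  (-ζ) ^ k / k.factorial * (exp (-c * ζ) * ψ ζ)

/-- The Borel transform of the `k`-th term `φ₀ᵏ / k! ∂ᵏψ(z + c)` of the Taylor expansion of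
`ψ(z + c + φ₀)`, in terms of those of `φ₀` and `ψ`. -/
def compTerm (c : ℂ) (φ ψ : ℂ → ℂ) : ℕ → ℂ → ℂ
  | 0 => taylorFactor c ψ 0
  | j + 1 => conv (convPow φ j) (taylorFactor c ψ (j + 1))

/-- The Borel transform of the composition of `z + ψ` with `z + c + φ`, in terms of the Borel
transforms `φ` and `ψ`. -/
def compBorel (c : ℂ) (φ ψ : ℂ → ℂ) (ζ : ℂ) : ℂ := φ ζ + ∑' k, compTerm c φ ψ k ζ

variable {S : Set ℂ} {c : ℂ} {φ ψ : ℂ → ℂ} {F G τ : ℝ}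

theorem norm_exp_mul_le (c ζ : ℂ) : ‖exp (c * ζ)‖ ≤ Real.exp (‖c‖ * ‖ζ‖) := by
  rw [norm_exp, ← norm_mul]
  exact Real.exp_le_exp.2 (re_le_norm _)

theorem norm_taylorFactor_le (hψ : ∀ ζ ∈ S, ‖ψ ζ‖ ≤ G * Real.exp (τ * ‖ζ‖)) (k : ℕ) :
    ∀ ζ ∈ S, ‖taylorFactor c ψ k ζ‖ ≤
      G * (‖ζ‖ ^ k / k.factorial) * Real.exp ((τ + ‖c‖) * ‖ζ‖) := by
  intro ζ hζ
  have h1 := mul_le_mul (norm_exp_mul_le (-c) ζ) (hψ ζ hζ) (norm_nonneg _) (Real.exp_nonneg _)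
  rw [taylorFactor, norm_mul, norm_mul, norm_div, norm_pow, norm_neg, norm_natCast]
  refine (mul_le_mul_of_nonneg_left h1 (by positivity)).trans_eq ?_
  rw [norm_neg, add_mul, Real.exp_add]
  ring

theorem norm_compTerm_le (hS : StarConvex ℝ 0 S) (hF : 0 ≤ F)
    (hφ : ∀ ζ ∈ S, ‖φ ζ‖ ≤ F * Real.exp (τ * ‖ζ‖))
    (hψ : ∀ ζ ∈ S, ‖ψ ζ‖ ≤ G * Real.exp (τ * ‖ζ‖)) (k : ℕ) :
    ∀ ζ ∈ S, ‖compTerm c φ ψ k ζ‖ ≤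
      G * F ^ k * (‖ζ‖ ^ (2 * k) / (2 * k).factorial) * Real.exp ((τ + ‖c‖) * ‖ζ‖) := by
  cases k with
  | zero => simpa [compTerm] using norm_taylorFactor_le (c := c) hψ 0
  | succ j =>
    intro ζ hζ
    have hφ' : ∀ ζ ∈ S, ‖φ ζ‖ ≤ F * Real.exp ((τ + ‖c‖) * ‖ζ‖) := fun ζ hζ => by
      refine (hφ ζ hζ).trans ?_
      have := norm_nonneg c
      gcongr
      linarith
    have h := norm_conv_le hS (by positivity) (norm_convPow_le hS hF hφ' j)
      (norm_taylorFactor_le (c := c) hψ (j + 1)) ζ hζ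
    rw [show j + (j + 1) + 1 = 2 * (j + 1) by ring, mul_comm _ G] at h
    exact h

theorem AnalyticOnNhd.taylorFactor (hψ : AnalyticOnNhd ℂ ψ S) (k : ℕ) :
    AnalyticOnNhd ℂ (taylorFactor c ψ k) S := by
  intro ζ hζ
  have := hψ ζ hζ
  unfold _root_.taylorFactor
  fun_prop (disch := exact Nat.cast_ne_zero.2 (Nat.factorial_ne_zero _))

theorem AnalyticOnNhd.compTerm (hS : StarConvex ℝ 0 S) (hφ : AnalyticOnNhd ℂ φ S)
    (hψ : AnalyticOnNhd ℂ ψ S) (k : ℕ) : AnalyticOnNhd ℂ (compTerm c φ ψ k) S := by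
  cases k with
  | zero => exact hψ.taylorFactor 0
  | succ j => exact (hφ.convPow hS j).conv hS (hψ.taylorFactor (j + 1))

theorem pow_mul_pow_eq_sqrt (hF : 0 ≤ F) (r : ℝ) (k : ℕ) :
    F ^ k * r ^ (2 * k) = (√F * r) ^ (2 * k) := by
  rw [mul_pow, pow_mul (√F), Real.sq_sqrt hF]

/-- On a compact set `φ` and `ψ` are bounded by a constant `M`, and `norm_compTerm_le` applies
with `τ = 0`. -/
theorem AnalyticOnNhd.tsum_compTerm (hS : StarConvex ℝ 0 S) (hφ : AnalyticOnNhd ℂ φ S)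
    (hψ : AnalyticOnNhd ℂ ψ S) : AnalyticOnNhd ℂ (fun ζ => ∑' k, _root_.compTerm c φ ψ k ζ) S := by
  refine analyticOnNhd_tsum_of_starConvex hS hφ hψ
    (fun U hU h1 h2 k => h1.compTerm hU h2 k) fun K hK M hM h1 h2 =>
      ⟨M, 0 + ‖c‖, √M, fun ζ hζ k => ?_⟩
  refine (norm_compTerm_le (c := c) (τ := 0) hK hM (by simpa using h1) (by simpa using h2) k ζ
    hζ).trans_eq ?_
  rw [← pow_mul_pow_eq_sqrt hM]
  ring

theorem AnalyticOnNhd.compBorel (hS : StarConvex ℝ 0 S) (hφ : AnalyticOnNhd ℂ φ S)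
    (hψ : AnalyticOnNhd ℂ ψ S) : AnalyticOnNhd ℂ (compBorel c φ ψ) S :=
  hφ.add (hφ.tsum_compTerm hS hψ)

/-- A series dominated by that of `C E cosh b` has a sum of norm at most `C eᵇ E`. -/
theorem norm_tsum_le_of_cosh {T : ℕ → ℂ} {C b E : ℝ} (hC : 0 ≤ C) (hE : 0 ≤ E)
    (hT : ∀ k, ‖T k‖ ≤ C * (b ^ (2 * k) / (2 * k).factorial) * E) (hb : 0 ≤ b) :
    ‖∑' k, T k‖ ≤ C * Real.exp b * E := by
  have h1 : HasSum (fun k : ℕ => C * (b ^ (2 * k) / (2 * k).factorial) * E)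
      (C * Real.cosh b * E) := ((Real.hasSum_cosh b).mul_left C).mul_right E
  refine (tsum_of_norm_bounded h1 hT).trans ?_
  have h2 : Real.cosh b ≤ Real.exp b := by
    rw [Real.cosh_eq]
    have := Real.exp_le_exp.2 (show -b ≤ b by linarith)
    linarith
  gcongr

theorem norm_tsum_compTerm_le (hS : StarConvex ℝ 0 S) (hF : 0 ≤ F) (hG : 0 ≤ G)
    (hφ : ∀ ζ ∈ S, ‖φ ζ‖ ≤ F * Real.exp (τ * ‖ζ‖))
    (hψ : ∀ ζ ∈ S, ‖ψ ζ‖ ≤ G * Real.exp (τ * ‖ζ‖)) :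
    ∀ ζ ∈ S, ‖∑' k, compTerm c φ ψ k ζ‖ ≤ G * Real.exp ((τ + ‖c‖ + √F) * ‖ζ‖) := by
  intro ζ hζ
  have h := norm_tsum_le_of_cosh (T := fun k => compTerm c φ ψ k ζ) (b := √F * ‖ζ‖) hG
    (Real.exp_nonneg ((τ + ‖c‖) * ‖ζ‖)) (fun k => ?_) (by positivity)
  · refine h.trans_eq ?_
    rw [mul_assoc, ← Real.exp_add]
    ring_nf
  · refine (norm_compTerm_le (c := c) hS hF hφ hψ k ζ hζ).trans_eq ?_
    rw [← pow_mul_pow_eq_sqrt hF]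
    ring

theorem norm_compBorel_le (hS : StarConvex ℝ 0 S) (hF : 0 ≤ F) (hG : 0 ≤ G)
    (hφ : ∀ ζ ∈ S, ‖φ ζ‖ ≤ F * Real.exp (τ * ‖ζ‖))
    (hψ : ∀ ζ ∈ S, ‖ψ ζ‖ ≤ G * Real.exp (τ * ‖ζ‖)) :
    ∀ ζ ∈ S, ‖compBorel c φ ψ ζ‖ ≤ (F + G) * Real.exp ((τ + ‖c‖ + √F) * ‖ζ‖) := by
  intro ζ hζ
  refine (norm_add_le _ _).trans ?_
  rw [add_mul]
  refine add_le_add ((hφ ζ hζ).trans ?_) (norm_tsum_compTerm_le hS hF hG hφ hψ ζ hζ)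
  have := norm_nonneg c
  have := Real.sqrt_nonneg F
  gcongr
  linarith

variable {e z : ℂ}

theorem AnalyticOnNhd.continuousOn_ray {h : ℂ → ℂ} (hh : AnalyticOnNhd ℂ h S)
    (hray : ∀ r : ℝ, 0 ≤ r → (r : ℂ) * e ∈ S) :
    ContinuousOn (fun r : ℝ => h (r * e)) (Ioi 0) :=
  hh.continuousOn.comp (f := fun r : ℝ => (r : ℂ) * e) (by fun_prop) fun r hr =>
    hray r (le_of_lt hr)

theorem norm_le_on_ray {h : ℂ → ℂ} {C a : ℝ} {n : ℕ} (he : ‖e‖ = 1)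
    (hray : ∀ r : ℝ, 0 ≤ r → (r : ℂ) * e ∈ S)
    (hb : ∀ ζ ∈ S, ‖h ζ‖ ≤ C * (‖ζ‖ ^ n / n.factorial) * Real.exp (a * ‖ζ‖)) (r : ℝ) (hr : 0 < r) :
    ‖h (r * e)‖ ≤ C * (r ^ n / n.factorial) * Real.exp (a * r) := by
  have h1 := hb _ (hray r hr.le)
  rwa [norm_mul, he, mul_one, norm_real, Real.norm_of_nonneg hr.le] at h1

theorem lap_convPow (he : ‖e‖ = 1) (hS : StarConvex ℝ 0 S)
    (hray : ∀ r : ℝ, 0 ≤ r → (r : ℂ) * e ∈ S) (hφa : AnalyticOnNhd ℂ φ S) (hF : 0 ≤ F)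
    (hφ : ∀ ζ ∈ S, ‖φ ζ‖ ≤ F * Real.exp (τ * ‖ζ‖)) (hz : τ < (z * e).re) (n : ℕ) :
    lap e (convPow φ n) z = lap e φ z ^ (n + 1) := by
  induction n with
  | zero => simp [convPow]
  | succ n ih =>
    rw [convPow, lap_conv, ih, pow_succ' _ (n + 1)]
    · exact lap_integrableOn he (hφa.continuousOn_ray hray)
        (norm_le_on_ray (n := 0) he hray (by simpa using hφ)) hz
    · exact lap_integrableOn he ((hφa.convPow hS n).continuousOn_ray hray)
        (norm_le_on_ray he hray (norm_convPow_le hS hF hφ n)) hz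

theorem lap_compTerm (he : ‖e‖ = 1) (hS : StarConvex ℝ 0 S)
    (hray : ∀ r : ℝ, 0 ≤ r → (r : ℂ) * e ∈ S) (hφa : AnalyticOnNhd ℂ φ S)
    (hψa : AnalyticOnNhd ℂ ψ S) (hF : 0 ≤ F)
    (hφ : ∀ ζ ∈ S, ‖φ ζ‖ ≤ F * Real.exp (τ * ‖ζ‖))
    (hψ : ∀ ζ ∈ S, ‖ψ ζ‖ ≤ G * Real.exp (τ * ‖ζ‖)) (hz : τ + ‖c‖ < (z * e).re) (k : ℕ) :
    lap e (compTerm c φ ψ k) z = lap e φ z ^ k * lap e (taylorFactor c ψ k) z := by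
  have hz' : τ < (z * e).re := by linarith [norm_nonneg c]
  cases k with
  | zero => simp [compTerm]
  | succ j =>
    rw [compTerm, lap_conv, lap_convPow he hS hray hφa hF hφ hz']
    · exact lap_integrableOn he ((hφa.convPow hS j).continuousOn_ray hray)
        (norm_le_on_ray he hray (norm_convPow_le hS hF hφ j)) hz'
    · exact lap_integrableOn he ((hψa.taylorFactor (j + 1)).continuousOn_ray hray)
        (norm_le_on_ray he hray (norm_taylorFactor_le hψ (j + 1))) hz

/-- Taylor's formula on the side of the Borel transforms: the translation by `c + a` is a
multiplication by `e^{-(c + a)ζ}`, whose factor `e^{-aζ}` is expanded. -/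
theorem tsum_pow_mul_taylorFactor (a c : ℂ) (ψ : ℂ → ℂ) (ζ : ℂ) :
    ∑' k, a ^ k * taylorFactor c ψ k ζ = exp ((-(c + a)) * ζ) * ψ ζ := by
  have h : ∀ k, a ^ k * taylorFactor c ψ k ζ =
      (-a * ζ) ^ k / k.factorial * (exp (-c * ζ) * ψ ζ) := fun k => by
    rw [taylorFactor, show -a * ζ = a * -ζ by ring, mul_pow]; ring
  simp only [h, tsum_mul_right]
  rw [← congrFun NormedSpace.exp_eq_tsum_div, ← Complex.exp_eq_exp_ℂ, ← mul_assoc, ← exp_add]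
  ring_nf

/-- The Laplace transform turns `compBorel` into composition: both sides are the sum of the series
`∑ Φᵏ lap(taylorFactor k)`, where `Φ` is the Laplace transform of `φ`. -/
theorem lap_compBorel (he : ‖e‖ = 1) (hS : StarConvex ℝ 0 S)
    (hray : ∀ r : ℝ, 0 ≤ r → (r : ℂ) * e ∈ S) (hφa : AnalyticOnNhd ℂ φ S)
    (hψa : AnalyticOnNhd ℂ ψ S) (hF : 0 ≤ F) (hG : 0 ≤ G)
    (hφ : ∀ ζ ∈ S, ‖φ ζ‖ ≤ F * Real.exp (τ * ‖ζ‖))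
    (hψ : ∀ ζ ∈ S, ‖ψ ζ‖ ≤ G * Real.exp (τ * ‖ζ‖)) (hz : τ + ‖c‖ + √F < (z * e).re) :
    lap e (compBorel c φ ψ) z = lap e φ z + lap e ψ (z + (c + lap e φ z)) := by
  have hc := norm_nonneg c
  have hsF := Real.sqrt_nonneg F
  have hz1 : τ + ‖c‖ < (z * e).re := by linarith
  have hz0 : τ < (z * e).re := by linarith
  set R := (z * e).re - (τ + ‖c‖)
  have hR : √F < R := by simp only [R]; linarith
  have hR0 : 0 < R := hsF.trans_lt hR
  have hFR : F < R ^ 2 := (Real.sqrt_lt' hR0).1 hR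
  set Φ := lap e φ z
  have hΦ : ‖Φ‖ < R := by
    have h1 := norm_lap_le (n := 0) he (norm_le_on_ray he hray (by simpa using hφ)) hz0
    rw [zero_add, pow_one] at h1
    refine h1.trans_lt ?_
    rw [div_lt_iff₀ (by linarith)]
    have : R ≤ (z * e).re - τ := by simp only [R]; linarith
    nlinarith
  have hφ1 := hφa.continuousOn_ray hray
  have i1 := lap_integrableOn (n := 0) he hφ1 (norm_le_on_ray he hray (by simpa using hφ)) hz0
  have i2 := lap_integrableOn (n := 0) he
    ((AnalyticOnNhd.tsum_compTerm (c := c) hS hφa hψa).continuousOn_ray hray)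
    (norm_le_on_ray he hray (by simpa using norm_tsum_compTerm_le hS hF hG hφ hψ)) hz
  have h1 : lap e (compBorel c φ ψ) z =
      Φ + lap e (fun ζ => ∑' k, compTerm c φ ψ k ζ) z := by
    simp only [Φ, lap]
    rw [← integral_add i1 i2]
    simp only [compBorel, add_mul]
  have hs1 : HasSum (fun k => lap e (compTerm c φ ψ k) z)
      (lap e (fun ζ => ∑' k, compTerm c φ ψ k ζ) z) := by
    refine hasSum_lap he (fun k => (hφa.compTerm hS hψa k).continuousOn_ray hray)
      (fun k => norm_le_on_ray he hray (norm_compTerm_le hS hF hφ hψ k)) hz1 ?_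
    have h2 : Summable fun k : ℕ => G / R * (F / R ^ 2) ^ k :=
      (summable_geometric_of_lt_one (by positivity) ((div_lt_one (by positivity)).2 hFR)).mul_left _
    refine h2.congr fun k => ?_
    change _ = G * F ^ k / R ^ (2 * k + 1)
    rw [div_pow, ← pow_mul, pow_succ]
    field_simp
  have hs2 : HasSum (fun k => lap e (fun ζ => Φ ^ k * taylorFactor c ψ k ζ) z)
      (lap e (fun ζ => ∑' k, Φ ^ k * taylorFactor c ψ k ζ) z) := by
    refine hasSum_lap (C := fun k => ‖Φ‖ ^ k * G) (n := fun k => k) he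
      (fun k => continuousOn_const.mul ((hψa.taylorFactor k).continuousOn_ray hray))
      (fun k r hr => ?_) hz1 ?_
    · rw [norm_mul, norm_pow, mul_assoc, mul_assoc, ← mul_assoc G]
      exact mul_le_mul_of_nonneg_left
        (norm_le_on_ray he hray (norm_taylorFactor_le hψ k) r hr) (by positivity)
    · have h2 : Summable fun k : ℕ => G / R * (‖Φ‖ / R) ^ k :=
        (summable_geometric_of_lt_one (by positivity) ((div_lt_one (by positivity)).2 hΦ)).mul_left
          _
      refine h2.congr fun k => ?_
      change _ = ‖Φ‖ ^ k * G / R ^ (k + 1)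
      rw [div_pow, pow_succ]
      field_simp
  have hterm : ∀ k, lap e (compTerm c φ ψ k) z =
      lap e (fun ζ => Φ ^ k * taylorFactor c ψ k ζ) z := fun k => by
    rw [lap_compTerm he hS hray hφa hψa hF hφ hψ hz1, lap_const_mul]
  rw [h1, hs1.unique (by simpa only [hterm] using hs2)]
  simp only [tsum_pow_mul_taylorFactor]
  rw [lap_exp_mul, sub_neg_eq_add]

end Comp

/-! ### The Borel transform of the inverse -/

/-- The Borel transform of the term `(-1)ʲ⁺¹ / (j + 1)! ∂ʲ(φʲ⁺¹)` of Lagrange's formula for the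
inverse of `z + φ`, in terms of that of `φ`. -/
def invTerm (φ : ℂ → ℂ) (j : ℕ) (ζ : ℂ) : ℂ := -(ζ ^ j / (j + 1).factorial * convPow φ j ζ)

/-- The Borel transform of the inverse of `z + c + φ`, in terms of that of `φ`. This inverse is
the inverse of `z + φ` evaluated at `z - c`, hence the factor `e^{cζ}`. -/
def invBorel (c : ℂ) (φ : ℂ → ℂ) (ζ : ℂ) : ℂ := exp (c * ζ) * ∑' j, invTerm φ j ζ

section Inv

variable {S : Set ℂ} {c e z : ℂ} {φ u v : ℂ → ℂ} {F τ A B : ℝ} {a b : ℕ}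

theorem factorial_two_mul_le (j : ℕ) : (2 * j).factorial ≤ 4 ^ j * (j.factorial * j.factorial) := by
  have h := Nat.choose_mul_factorial_mul_factorial (show j ≤ 2 * j by omega)
  rw [show 2 * j - j = j by omega] at h
  rw [← h, mul_assoc]
  exact Nat.mul_le_mul_right _ (Nat.centralBinom_le_four_pow j)

/-- The bound has the terms of `cosh` since `(2j)! ≤ 4ʲ (j!)²`. -/
theorem norm_invTerm_le (hS : StarConvex ℝ 0 S) (hF : 0 ≤ F)
    (hφ : ∀ ζ ∈ S, ‖φ ζ‖ ≤ F * Real.exp (τ * ‖ζ‖)) (j : ℕ) :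
    ∀ ζ ∈ S, ‖invTerm φ j ζ‖ ≤
      F * ((2 * √F * ‖ζ‖) ^ (2 * j) / (2 * j).factorial) * Real.exp (τ * ‖ζ‖) := by
  intro ζ hζ
  rw [invTerm, norm_neg, norm_mul, norm_div, norm_pow, norm_natCast]
  refine (mul_le_mul_of_nonneg_left (norm_convPow_le hS hF hφ j ζ hζ) (by positivity)).trans ?_
  rw [← mul_assoc]
  refine mul_le_mul_of_nonneg_right ?_ (Real.exp_nonneg _)
  rw [mul_assoc 2, mul_pow 2, ← pow_mul_pow_eq_sqrt hF, pow_mul (2 : ℝ)]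
  have h1 : ((2 * j).factorial : ℝ) ≤ 4 ^ j * (j.factorial * (j + 1).factorial) := by
    refine (Nat.cast_le.2 (factorial_two_mul_le j)).trans ?_
    push_cast
    have : (j.factorial : ℝ) ≤ (j + 1).factorial := Nat.cast_le.2 (Nat.factorial_le j.le_succ)
    gcongr
  calc ‖ζ‖ ^ j / (j + 1).factorial * (F ^ (j + 1) * (‖ζ‖ ^ j / j.factorial))
      = F ^ (j + 1) * ‖ζ‖ ^ (2 * j) * (1 / (j.factorial * (j + 1).factorial)) := by
        field_simp
        ring
    _ ≤ F ^ (j + 1) * ‖ζ‖ ^ (2 * j) * (4 ^ j / (2 * j).factorial) := by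
        refine mul_le_mul_of_nonneg_left ?_ (by positivity)
        rw [div_le_div_iff₀ (by positivity) (by positivity), one_mul]
        exact h1
    _ = F * ((2 ^ 2) ^ j * (F ^ j * ‖ζ‖ ^ (2 * j)) / (2 * j).factorial) := by
        norm_num
        ring

theorem AnalyticOnNhd.invTerm (hS : StarConvex ℝ 0 S) (hφ : AnalyticOnNhd ℂ φ S) (j : ℕ) :
    AnalyticOnNhd ℂ (invTerm φ j) S := by
  intro ζ hζ
  have := hφ.convPow hS j ζ hζ
  unfold _root_.invTerm
  fun_prop (disch := exact Nat.cast_ne_zero.2 (Nat.factorial_ne_zero _))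

theorem AnalyticOnNhd.tsum_invTerm (hS : StarConvex ℝ 0 S) (hφ : AnalyticOnNhd ℂ φ S) :
    AnalyticOnNhd ℂ (fun ζ => ∑' j, _root_.invTerm φ j ζ) S :=
  analyticOnNhd_tsum_of_starConvex hS hφ hφ
    (fun U hU h1 _ k => h1.invTerm hU k) fun K hK M hM h1 _ =>
      ⟨M, 0, 2 * √M, fun ζ hζ k => norm_invTerm_le hK hM (by simpa using h1) k ζ hζ⟩

theorem AnalyticOnNhd.invBorel (hS : StarConvex ℝ 0 S) (hφ : AnalyticOnNhd ℂ φ S) :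
    AnalyticOnNhd ℂ (invBorel c φ) S := by
  intro ζ hζ
  have := hφ.tsum_invTerm hS ζ hζ
  unfold _root_.invBorel
  fun_prop

theorem norm_tsum_invTerm_le (hS : StarConvex ℝ 0 S) (hF : 0 ≤ F)
    (hφ : ∀ ζ ∈ S, ‖φ ζ‖ ≤ F * Real.exp (τ * ‖ζ‖)) :
    ∀ ζ ∈ S, ‖∑' j, invTerm φ j ζ‖ ≤ F * Real.exp ((τ + 2 * √F) * ‖ζ‖) := by
  intro ζ hζ
  refine (norm_tsum_le_of_cosh hF (Real.exp_nonneg _)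
    (fun j => norm_invTerm_le hS hF hφ j ζ hζ) (by positivity)).trans_eq ?_
  rw [mul_assoc, ← Real.exp_add]
  ring_nf

theorem norm_invBorel_le (hS : StarConvex ℝ 0 S) (hF : 0 ≤ F)
    (hφ : ∀ ζ ∈ S, ‖φ ζ‖ ≤ F * Real.exp (τ * ‖ζ‖)) :
    ∀ ζ ∈ S, ‖invBorel c φ ζ‖ ≤ F * Real.exp ((τ + ‖c‖ + 2 * √F) * ‖ζ‖) := by
  intro ζ hζ
  rw [invBorel, norm_mul]
  refine (mul_le_mul (norm_exp_mul_le c ζ) (norm_tsum_invTerm_le hS hF hφ ζ hζ) (norm_nonneg _)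
    (Real.exp_nonneg _)).trans_eq ?_
  rw [mul_left_comm, ← Real.exp_add]
  ring_nf

theorem norm_pow_mul_le_of_le
    (hu : ∀ ζ ∈ S, ‖u ζ‖ ≤ A * (‖ζ‖ ^ a / a.factorial) * Real.exp (τ * ‖ζ‖))
    (n : ℕ) : ∀ ζ ∈ S, ‖ζ ^ n * u ζ‖ ≤ A * ((n + a).factorial / a.factorial) *
      (‖ζ‖ ^ (n + a) / (n + a).factorial) * Real.exp (τ * ‖ζ‖) := by
  intro ζ hζ
  rw [norm_mul, norm_pow]
  refine (mul_le_mul_of_nonneg_left (hu ζ hζ) (by positivity)).trans_eq ?_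
  rw [pow_add]
  field_simp

theorem lap_integrableOn_pow_mul (he : ‖e‖ = 1)
    (hray : ∀ r : ℝ, 0 ≤ r → (r : ℂ) * e ∈ S) (hua : AnalyticOnNhd ℂ u S)
    (hu : ∀ ζ ∈ S, ‖u ζ‖ ≤ A * (‖ζ‖ ^ a / a.factorial) * Real.exp (τ * ‖ζ‖))
    (hz : τ < (z * e).re) (n : ℕ) :
    IntegrableOn (fun r : ℝ => ((r * e) ^ n * u (r * e)) * exp (-z * (r * e)) * e) (Ioi 0) :=
  lap_integrableOn (h := fun ζ => ζ ^ n * u ζ) he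
    (ContinuousOn.mul (by fun_prop) (hua.continuousOn_ray hray))
    (norm_le_on_ray (h := fun ζ => ζ ^ n * u ζ) he hray (norm_pow_mul_le_of_le hu n)) hz

/-- The binomial formula for `ζⁿ = (η + (ζ - η))ⁿ` under the integral. It corresponds to Leibniz's
rule for the derivatives of a product of Laplace transforms. -/
theorem pow_mul_conv (hS : StarConvex ℝ 0 S) (hu : ContinuousOn u S) (hv : ContinuousOn v S)
    (n : ℕ) {ζ : ℂ} (hζ : ζ ∈ S) : ζ ^ n * conv u v ζ = ∑ p ∈ Finset.HasAntidiagonal.antidiagonal n,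
      (n.choose p.1 : ℂ) * conv (fun w => w ^ p.1 * u w) (fun w => w ^ p.2 * v w) ζ := by
  simp only [conv]
  simp only [mul_left_comm _ ζ, ← Finset.mul_sum]
  congr 1
  simp only [← intervalIntegral.integral_const_mul]
  rw [← intervalIntegral.integral_finsetSum]
  · congr 1
    ext t
    have h := Commute.add_pow' (Commute.all ((t : ℂ) * ζ) (((1 - t : ℝ) : ℂ) * ζ)) n
    rw [← add_mul, show (t : ℂ) + ((1 - t : ℝ) : ℂ) = 1 by push_cast; ring, one_mul] at h
    rw [h, Finset.sum_mul]
    refine Finset.sum_congr rfl fun p _ => ?_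
    rw [nsmul_eq_mul]
    ring
  · intro p _
    refine ContinuousOn.intervalIntegrable ?_
    rw [uIcc_of_le zero_le_one]
    exact continuousOn_const.mul (continuousOn_conv_integrand
      (f := fun w => w ^ p.1 * u w) (g := fun w => w ^ p.2 * v w) hS
      (ContinuousOn.mul (by fun_prop) hu) (ContinuousOn.mul (by fun_prop) hv) hζ)

theorem lap_pow_mul_conv (he : ‖e‖ = 1) (hS : StarConvex ℝ 0 S)
    (hray : ∀ r : ℝ, 0 ≤ r → (r : ℂ) * e ∈ S) (hua : AnalyticOnNhd ℂ u S)
    (hva : AnalyticOnNhd ℂ v S) (hA : 0 ≤ A)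
    (hu : ∀ ζ ∈ S, ‖u ζ‖ ≤ A * (‖ζ‖ ^ a / a.factorial) * Real.exp (τ * ‖ζ‖))
    (hv : ∀ ζ ∈ S, ‖v ζ‖ ≤ B * (‖ζ‖ ^ b / b.factorial) * Real.exp (τ * ‖ζ‖))
    (hz : τ < (z * e).re) (n : ℕ) :
    lap e (fun ζ => ζ ^ n * conv u v ζ) z = ∑ p ∈ Finset.HasAntidiagonal.antidiagonal n,
      (n.choose p.1 : ℂ) * lap e (conv (fun w => w ^ p.1 * u w) (fun w => w ^ p.2 * v w)) z := by
  have hmul : ∀ {w : ℂ → ℂ} (k : ℕ), AnalyticOnNhd ℂ w S →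
      AnalyticOnNhd ℂ (fun ζ => ζ ^ k * w ζ) S := fun k hw ζ hζ => by
    have := hw ζ hζ
    fun_prop
  simp only [← lap_const_mul]
  simp only [lap]
  rw [← integral_finsetSum]
  · refine setIntegral_congr_fun measurableSet_Ioi fun r hr => ?_
    rw [pow_mul_conv hS hua.continuousOn hva.continuousOn n (hray r (le_of_lt hr)),
      Finset.sum_mul, Finset.sum_mul]
  · intro p _
    have := lap_integrableOn he (((hmul p.1 hua).conv hS (hmul p.2 hva)).continuousOn_ray hray)
      (norm_le_on_ray he hray (norm_conv_le (f := fun w => w ^ p.1 * u w)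
        (g := fun w => w ^ p.2 * v w) hS (by positivity) (norm_pow_mul_le_of_le hu p.1)
        (norm_pow_mul_le_of_le hv p.2))) hz
    simpa only [IntegrableOn, mul_assoc] using this.const_mul (n.choose p.1 : ℂ)

/-- The Taylor series at `z` of the Laplace transform of `u`: its derivatives are the Laplace
transforms of the functions `(-ζ)ⁿ u(ζ)`. -/
def lapTaylor (e z : ℂ) (u : ℂ → ℂ) : PowerSeries ℂ :=
  PowerSeries.mk fun n => (-1) ^ n / n.factorial * lap e (fun ζ => ζ ^ n * u ζ) z

theorem exp_coeff_mul_exp_coeff (m n : ℕ) (x y : ℂ) :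
    (-1) ^ (m + n) / (m + n).factorial * ((m + n).choose m * (x * y)) =
      (-1) ^ m / m.factorial * x * ((-1) ^ n / n.factorial * y) := by
  have h2 := congrArg (Nat.cast (R := ℂ)) (Nat.add_choose_mul_factorial_mul_factorial m n)
  rw [← Nat.choose_symm_add] at h2
  push_cast at h2
  have h3 : (m.factorial : ℂ) ≠ 0 := Nat.cast_ne_zero.2 (Nat.factorial_ne_zero _)
  have h4 : (n.factorial : ℂ) ≠ 0 := Nat.cast_ne_zero.2 (Nat.factorial_ne_zero _)
  have h5 : (((m + n).choose m : ℕ) : ℂ) ≠ 0 :=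
    Nat.cast_ne_zero.2 (Nat.choose_pos (Nat.le_add_right _ _)).ne'
  rw [← h2, pow_add]
  field_simp

theorem coeff_lapTaylor (e z : ℂ) (u : ℂ → ℂ) (n : ℕ) :
    PowerSeries.coeff n (lapTaylor e z u) =
      (-1) ^ n / n.factorial * lap e (fun ζ => ζ ^ n * u ζ) z :=
  PowerSeries.coeff_mk _ _

/-- `lapTaylor` turns convolutions into products of power series. -/
theorem lapTaylor_conv (he : ‖e‖ = 1) (hS : StarConvex ℝ 0 S)
    (hray : ∀ r : ℝ, 0 ≤ r → (r : ℂ) * e ∈ S) (hua : AnalyticOnNhd ℂ u S)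
    (hva : AnalyticOnNhd ℂ v S) (hA : 0 ≤ A)
    (hu : ∀ ζ ∈ S, ‖u ζ‖ ≤ A * (‖ζ‖ ^ a / a.factorial) * Real.exp (τ * ‖ζ‖))
    (hv : ∀ ζ ∈ S, ‖v ζ‖ ≤ B * (‖ζ‖ ^ b / b.factorial) * Real.exp (τ * ‖ζ‖))
    (hz : τ < (z * e).re) :
    lapTaylor e z (conv u v) = lapTaylor e z u * lapTaylor e z v := by
  ext n
  rw [PowerSeries.coeff_mul, coeff_lapTaylor, lap_pow_mul_conv he hS hray hua hva hA hu hv hz n,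
    Finset.mul_sum]
  refine Finset.sum_congr rfl fun p hp => ?_
  have h1 := exp_coeff_mul_exp_coeff p.1 p.2 (lap e (fun ζ => ζ ^ p.1 * u ζ) z)
    (lap e (fun ζ => ζ ^ p.2 * v ζ) z)
  rw [Finset.HasAntidiagonal.mem_antidiagonal.1 hp] at h1
  rw [coeff_lapTaylor, coeff_lapTaylor, ← h1]
  rw [lap_conv (f := fun w => w ^ p.1 * u w) (g := fun w => w ^ p.2 * v w)
    (lap_integrableOn_pow_mul he hray hua hu hz p.1)
    (lap_integrableOn_pow_mul he hray hva hv hz p.2)]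

theorem lapTaylor_convPow (he : ‖e‖ = 1) (hS : StarConvex ℝ 0 S)
    (hray : ∀ r : ℝ, 0 ≤ r → (r : ℂ) * e ∈ S) (hφa : AnalyticOnNhd ℂ φ S) (hF : 0 ≤ F)
    (hφ : ∀ ζ ∈ S, ‖φ ζ‖ ≤ F * Real.exp (τ * ‖ζ‖)) (hz : τ < (z * e).re) (n : ℕ) :
    lapTaylor e z (convPow φ n) = lapTaylor e z φ ^ (n + 1) := by
  induction n with
  | zero => simp [convPow]
  | succ n ih =>
    rw [convPow, lapTaylor_conv (a := 0) he hS hray hφa (hφa.convPow hS n) hF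
      (by simpa using hφ) (norm_convPow_le hS hF hφ n) hz, ih, pow_succ' _ (n + 1)]

/-- The combinatorial identity behind Lagrange's formula: the coefficient of `Xⁿ` in
`(p(0) - p)ⁿ⁺¹`, which is divisible by `Xⁿ⁺¹`, vanishes. -/
theorem sum_antidiagonal_lagrange (p : PowerSeries ℂ) (n : ℕ) :
    ∑ q ∈ Finset.HasAntidiagonal.antidiagonal n,
      (-1) ^ (q.2 + 1) * PowerSeries.constantCoeff p ^ q.1 *
      ((q.1 + q.2).factorial / (q.1.factorial * (q.2 + 1).factorial)) *
        PowerSeries.coeff n (p ^ (q.2 + 1)) =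
      if n = 0 then -PowerSeries.constantCoeff p else 0 := by
  set c := PowerSeries.constantCoeff p with hc
  have h0 : PowerSeries.coeff n ((PowerSeries.C c + -p) ^ (n + 1)) = 0 := by
    have h1 : (PowerSeries.X : PowerSeries ℂ) ∣ PowerSeries.C c + -p :=
      PowerSeries.X_dvd_iff.2 (by simp [hc])
    exact PowerSeries.X_pow_dvd_iff.1 (pow_dvd_pow_of_dvd h1 (n + 1)) n n.lt_succ_self
  rw [Commute.add_pow' (Commute.all _ _), Finset.Nat.sum_antidiagonal_succ', map_add,
    map_sum] at h0
  have h2 : ∀ q ∈ Finset.HasAntidiagonal.antidiagonal n, (-1) ^ (q.2 + 1) * c ^ q.1 *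
      ((q.1 + q.2).factorial / (q.1.factorial * (q.2 + 1).factorial)) *
        PowerSeries.coeff n (p ^ (q.2 + 1)) = ((n : ℂ) + 1)⁻¹ *
      PowerSeries.coeff n ((n + 1).choose q.1 • (PowerSeries.C c ^ q.1 * (-p) ^ (q.2 + 1))) := by
    intro q hq
    obtain rfl := Finset.HasAntidiagonal.mem_antidiagonal.1 hq
    have h3 := congrArg (Nat.cast (R := ℂ))
      (Nat.add_choose_mul_factorial_mul_factorial q.1 (q.2 + 1))
    rw [← Nat.choose_symm_add, ← add_assoc, Nat.factorial_succ (q.1 + q.2)] at h3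
    push_cast at h3
    have e1 : (q.1.factorial : ℂ) ≠ 0 := Nat.cast_ne_zero.2 (Nat.factorial_ne_zero _)
    have e2 : ((q.2 + 1).factorial : ℂ) ≠ 0 := Nat.cast_ne_zero.2 (Nat.factorial_ne_zero _)
    have e3 : (q.1 : ℂ) + q.2 + 1 ≠ 0 := by exact_mod_cast Nat.succ_ne_zero (q.1 + q.2)
    rw [neg_pow p, ← map_pow PowerSeries.C, map_nsmul, nsmul_eq_mul,
      show (-1 : PowerSeries ℂ) = PowerSeries.C (-1 : ℂ) by simp, ← map_pow PowerSeries.C,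
      PowerSeries.coeff_C_mul, PowerSeries.coeff_C_mul]
    push_cast
    field_simp
    linear_combination -(c ^ q.1 * PowerSeries.coeff (q.1 + q.2) (p ^ (q.2 + 1))) * h3
  rw [Finset.sum_congr rfl h2, ← Finset.mul_sum, eq_neg_of_add_eq_zero_right h0]
  simp only [Nat.choose_self, one_smul, pow_zero, mul_one, ← map_pow, PowerSeries.coeff_C]
  split_ifs with h
  · simp [h]
  · simp

/-- Lagrange's formula for the inverse of `z + φ`: the Laplace transform of `∑ⱼ invTerm φ j`,
evaluated at the image `z + Φ` of `z`, is `-Φ`. The translation by `Φ` is a multiplication by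
`e^{-Φζ}`; the expansion of this exponential gives a double series, and the sum of its terms with
`m + j = n` is computed by `sum_antidiagonal_lagrange` for the Taylor series of the Laplace
transform of `φ` at `z`. The lower bound for `Re(ze)` is not optimal, but it makes the double series
converge absolutely. -/
theorem lap_tsum_invTerm (he : ‖e‖ = 1) (hS : StarConvex ℝ 0 S)
    (hray : ∀ r : ℝ, 0 ≤ r → (r : ℂ) * e ∈ S) (hφa : AnalyticOnNhd ℂ φ S) (hF : 0 ≤ F)
    (hφ : ∀ ζ ∈ S, ‖φ ζ‖ ≤ F * Real.exp (τ * ‖ζ‖)) (hz : τ + (16 * F + 3) < (z * e).re) :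
    lap e (fun ζ => ∑' j, invTerm φ j ζ) (z + lap e φ z) = -lap e φ z := by
  have hz0 : τ < (z * e).re := by linarith
  set R := (z * e).re - τ
  have hR : 16 * F + 3 < R := by simp only [R]; linarith
  have hR0 : 0 < R := by linarith
  set Φ := lap e φ z
  have hΦ : ‖Φ‖ ≤ 1 := by
    have h1 := norm_lap_le (n := 0) he (norm_le_on_ray he hray (by simpa using hφ)) hz0
    rw [zero_add, pow_one] at h1
    refine h1.trans ((div_le_one hR0).2 ?_)
    linarith
  set T : ℕ × ℕ → ℂ → ℂ := fun q ζ => (-Φ * ζ) ^ q.1 / q.1.factorial * invTerm φ q.2 ζ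
  have hpt : ∀ ζ ∈ S, exp (-Φ * ζ) * ∑' j, invTerm φ j ζ = ∑' q, T q ζ := by
    intro ζ hζ
    have hs1 : Summable fun m : ℕ => ‖(-Φ * ζ) ^ m / (m.factorial : ℂ)‖ :=
      NormedSpace.norm_expSeries_div_summable (-Φ * ζ)
    have hs2 : Summable fun j => ‖invTerm φ j ζ‖ :=
      .of_nonneg_of_le (fun _ => norm_nonneg _) (fun j => norm_invTerm_le hS hF hφ j ζ hζ)
        (((Real.hasSum_cosh _).summable.mul_left F).mul_right _)
    rw [Complex.exp_eq_exp_ℂ, NormedSpace.exp_eq_tsum_div]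
    exact tsum_mul_tsum_of_summable_norm hs1 hs2
  -- `(m + 2j)! ≤ 2^{m + 2j} m! (2j)!` and `(2j)! ≤ 4ʲ (j!)²` give the factor `2ᵐ 16ʲ`
  have hTb : ∀ q : ℕ × ℕ, ∀ ζ ∈ S, ‖T q ζ‖ ≤ F ^ (q.2 + 1) * 2 ^ q.1 * 16 ^ q.2 *
      (‖ζ‖ ^ (q.1 + 2 * q.2) / (q.1 + 2 * q.2).factorial) * Real.exp (τ * ‖ζ‖) := by
    rintro ⟨m, j⟩ ζ hζ
    simp only [T, invTerm]
    rw [norm_mul, norm_div, norm_pow, norm_mul, norm_neg, norm_neg, norm_mul, norm_div, norm_pow,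
      norm_natCast, norm_natCast]
    have h1 := norm_convPow_le hS hF hφ j ζ hζ
    have h2 : (((m + 2 * j).factorial : ℕ) : ℝ) ≤
        2 ^ m * 16 ^ j * (m.factorial * (j.factorial * (j + 1).factorial)) := by
      have h3 := Nat.add_choose_mul_factorial_mul_factorial m (2 * j)
      rw [← Nat.choose_symm_add] at h3
      have h4 : (m + 2 * j).choose m ≤ 2 ^ (m + 2 * j) := Nat.choose_le_two_pow _ _
      have h5 := factorial_two_mul_le j
      have h6 : (m + 2 * j).factorial ≤
          2 ^ m * 16 ^ j * (m.factorial * (j.factorial * (j + 1).factorial)) := by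
        rw [← h3]
        calc (m + 2 * j).choose m * m.factorial * (2 * j).factorial
            ≤ 2 ^ (m + 2 * j) * m.factorial * (4 ^ j * (j.factorial * (j + 1).factorial)) := by
              refine Nat.mul_le_mul (Nat.mul_le_mul_right _ h4) (h5.trans ?_)
              have := Nat.factorial_le j.le_succ
              gcongr
          _ = 2 ^ m * 16 ^ j * (m.factorial * (j.factorial * (j + 1).factorial)) := by
              rw [pow_add, pow_mul, show (16 : ℕ) = 2 ^ 2 * 4 by norm_num, mul_pow (2 ^ 2)]
              ring
      exact_mod_cast h6
    calc (‖Φ‖ * ‖ζ‖) ^ m / m.factorial * (‖ζ‖ ^ j / (j + 1).factorial * ‖convPow φ j ζ‖)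
        ≤ (1 * ‖ζ‖) ^ m / m.factorial * (‖ζ‖ ^ j / (j + 1).factorial *
          (F ^ (j + 1) * (‖ζ‖ ^ j / j.factorial) * Real.exp (τ * ‖ζ‖))) := by gcongr
      _ = F ^ (j + 1) * ‖ζ‖ ^ (m + 2 * j) *
          (1 / (m.factorial * (j.factorial * (j + 1).factorial))) * Real.exp (τ * ‖ζ‖) := by
        rw [pow_add, two_mul, pow_add, one_mul]
        field_simp
        ring
      _ ≤ F ^ (j + 1) * ‖ζ‖ ^ (m + 2 * j) *
          (2 ^ m * 16 ^ j / (m + 2 * j).factorial) * Real.exp (τ * ‖ζ‖) := by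
        refine mul_le_mul_of_nonneg_right (mul_le_mul_of_nonneg_left ?_ (by positivity))
          (Real.exp_nonneg _)
        rw [div_le_div_iff₀ (by positivity) (by positivity), one_mul]
        exact h2
      _ = _ := by ring
  have hTa : ∀ q, AnalyticOnNhd ℂ (T q) S := fun q ζ hζ => by
    have := hφa.invTerm hS q.2 ζ hζ
    fun_prop (disch := exact Nat.cast_ne_zero.2 (Nat.factorial_ne_zero _))
  have hsum : HasSum (fun q => lap e (T q) z) (lap e (fun ζ => ∑' q, T q ζ) z) := by
    refine hasSum_lap he (fun q => (hTa q).continuousOn_ray hray)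
      (fun q => norm_le_on_ray he hray (hTb q)) hz0 ?_
    have h1 : Summable fun m : ℕ => (2 / R) ^ m :=
      summable_geometric_of_lt_one (by positivity) ((div_lt_one hR0).2 (by linarith))
    have h2 : Summable fun j : ℕ => (16 * F / R ^ 2) ^ j :=
      summable_geometric_of_lt_one (by positivity) ((div_lt_one (by positivity)).2 (by nlinarith))
    have h3 := (h1.mul_of_nonneg h2 (fun _ => by positivity) (fun _ => by positivity)).mul_left
      (F / R)
    refine h3.congr fun q => ?_
    change _ = F ^ (q.2 + 1) * 2 ^ q.1 * 16 ^ q.2 / R ^ (q.1 + 2 * q.2 + 1)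
    rw [div_pow, div_pow, mul_pow, ← pow_mul, pow_succ F, pow_succ R, pow_add]
    field_simp
  have hval : ∀ q : ℕ × ℕ, lap e (T q) z = (-1) ^ (q.2 + 1) * Φ ^ q.1 *
      ((q.1 + q.2).factorial / (q.1.factorial * (q.2 + 1).factorial)) *
        PowerSeries.coeff (q.1 + q.2) (lapTaylor e z φ ^ (q.2 + 1)) := by
    rintro ⟨m, j⟩
    have h1 : T (m, j) = fun ζ => (-1) ^ (m + 1) * Φ ^ m / (m.factorial * (j + 1).factorial) *
        (ζ ^ (m + j) * convPow φ j ζ) := by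
      ext ζ
      simp only [T, invTerm, mul_pow, neg_pow Φ, pow_add]
      have e1 : (m.factorial : ℂ) ≠ 0 := Nat.cast_ne_zero.2 (Nat.factorial_ne_zero _)
      have e2 : ((j + 1).factorial : ℂ) ≠ 0 := Nat.cast_ne_zero.2 (Nat.factorial_ne_zero _)
      field_simp
    rw [h1, lap_const_mul, ← lapTaylor_convPow he hS hray hφa hF hφ hz0, coeff_lapTaylor]
    have e1 : (m.factorial : ℂ) ≠ 0 := Nat.cast_ne_zero.2 (Nat.factorial_ne_zero _)
    have e2 : ((j + 1).factorial : ℂ) ≠ 0 := Nat.cast_ne_zero.2 (Nat.factorial_ne_zero _)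
    have e3 : ((m + j).factorial : ℂ) ≠ 0 := Nat.cast_ne_zero.2 (Nat.factorial_ne_zero _)
    have e4 : ((-1 : ℂ) ^ j) * (-1) ^ j = 1 := by rw [← mul_pow]; simp
    simp only
    field_simp
    rw [pow_add, pow_add, pow_add]
    linear_combination (Φ ^ m * lap e (fun ζ => ζ ^ (m + j) * convPow φ j ζ) z * (-1) ^ m) * e4
  have hΦp : PowerSeries.constantCoeff (lapTaylor e z φ) = Φ := by
    rw [← PowerSeries.coeff_zero_eq_constantCoeff_apply, coeff_lapTaylor]
    simp [Φ]
  have h1 : lap e (fun ζ => ∑' j, invTerm φ j ζ) (z + Φ) = lap e (fun ζ => ∑' q, T q ζ) z := by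
    rw [← sub_neg_eq_add, ← lap_exp_mul]
    refine setIntegral_congr_fun measurableSet_Ioi fun r hr => ?_
    simp only [hpt _ (hray r (le_of_lt hr))]
  rw [h1]
  -- summation of the double series over the antidiagonals
  have h2 := (Finset.HasAntidiagonal.sigmaAntidiagonalEquivProd (A := ℕ)).hasSum_iff.2 hsum
  have h3 := h2.sigma (g := fun n => ∑ q : Finset.HasAntidiagonal.antidiagonal n,
    ((fun q => lap e (T q) z) ∘ Finset.HasAntidiagonal.sigmaAntidiagonalEquivProd) ⟨n, q⟩)
    fun n => hasSum_fintype _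
  have h4 : (fun n => ∑ q : Finset.HasAntidiagonal.antidiagonal n,
      ((fun q => lap e (T q) z) ∘ Finset.HasAntidiagonal.sigmaAntidiagonalEquivProd) ⟨n, q⟩) =
      fun n => if n = 0 then -Φ else 0 := by
    ext n
    have h5 := sum_antidiagonal_lagrange (lapTaylor e z φ) n
    rw [hΦp] at h5
    rw [← h5]
    refine (Finset.sum_coe_sort (Finset.HasAntidiagonal.antidiagonal n)
      (fun q => lap e (T q) z)).trans (Finset.sum_congr rfl fun q hq => ?_)
    rw [hval, Finset.HasAntidiagonal.mem_antidiagonal.1 hq]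
  rw [h4] at h3
  exact h3.unique (hasSum_ite_eq 0 (-Φ))

end Inv

/-! ### Borel extensions to the union of a disc and a sector -/

section SectorDisc

variable {A : Set ℝ} {ρ τ τ' F G θ : ℝ} {P : PowerSeries ℂ} {φ ψ : ℂ → ℂ} {f g : TangentDiffeo}

theorem starConvex_sectorDisc (A : Set ℝ) (hρ : 0 < ρ) : StarConvex ℝ 0 (sectorDisc A ρ) := by
  rw [starConvex_zero_iff]
  intro ζ hζ a ha ha'
  rcases hζ with hζ | ⟨r, θ, hr, hθ, rfl⟩
  · left
    rw [mem_ball_zero_iff] at hζ ⊢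
    rw [norm_smul, Real.norm_of_nonneg ha]
    exact (mul_le_of_le_one_left (norm_nonneg _) ha').trans_lt hζ
  · rcases ha.eq_or_lt with rfl | ha0
    · left; simpa using hρ
    · right
      refine ⟨a * r, θ, by positivity, hθ, ?_⟩
      rw [real_smul]; push_cast; ring

theorem zero_mem_sectorDisc (hρ : 0 < ρ) : (0 : ℂ) ∈ sectorDisc A ρ := Or.inl (by simpa using hρ)

theorem ray_mem_sectorDisc (hρ : 0 < ρ) (hθ : θ ∈ A) (r : ℝ) (hr : 0 ≤ r) :
    (r : ℂ) * exp (θ * I) ∈ sectorDisc A ρ := by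
  rcases hr.eq_or_lt with rfl | hr0
  · simpa using zero_mem_sectorDisc hρ
  · exact Or.inr ⟨r, θ, hr0, hθ, rfl⟩

theorem sectorDisc_mono {ρ' : ℝ} (h : ρ' ≤ ρ) : sectorDisc A ρ' ⊆ sectorDisc A ρ :=
  union_subset_union_left _ (Metric.ball_subset_ball h)

theorem IsBorelExtension.mono {ρ' : ℝ} (h : IsBorelExtension A ρ P φ) (hρ : ρ' ≤ ρ) :
    IsBorelExtension A ρ' P φ := ⟨h.1, h.2.mono (sectorDisc_mono hρ)⟩

/-- The analytic extensions of a Borel transform agree, as `S(ρ, 𝒜)` is connected. -/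
theorem IsBorelExtension.eqOn (hρ : 0 < ρ) (hφ : IsBorelExtension A ρ P φ)
    (hψ : IsBorelExtension A ρ P ψ) : EqOn φ ψ (sectorDisc A ρ) := by
  refine hφ.2.eqOn_of_preconnected_of_eventuallyEq hψ.2
    ((starConvex_sectorDisc A hρ).isPathConnected
      (zero_mem_sectorDisc hρ)).isConnected.isPreconnected (zero_mem_sectorDisc hρ) ?_
  filter_upwards [hφ.1.eventually_hasSum, hψ.1.eventually_hasSum] with y h1 h2
  simpa using h1.unique h2

/-- `borelTransform` is defined by a choice of a radius and of an extension; on the rays it agrees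
with any other extension. -/
theorem borelTransform_apply (hρ : 0 < ρ) (hφ : IsBorelExtension A ρ P φ) (hθ : θ ∈ A) {r : ℝ}
    (hr : 0 ≤ r) : borelTransform A P (r * exp (θ * I)) = φ (r * exp (θ * I)) := by
  have H : ∃ h : ℂ → ℂ, ∃ ρ > 0, IsBorelExtension A ρ P h := ⟨φ, ρ, hρ, hφ⟩
  rw [borelTransform, dif_pos H]
  obtain ⟨ρ', hρ', h⟩ := H.choose_spec
  have hm : 0 < min ρ ρ' := lt_min hρ hρ'
  exact (h.mono (min_le_right ρ ρ')).eqOn hm (hφ.mono (min_le_left ρ ρ'))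
    (ray_mem_sectorDisc hm hθ r hr)

theorem laplaceSum_eq (hρ : 0 < ρ) (hφ : IsBorelExtension A ρ P φ) (hθ : θ ∈ A) (z : ℂ) :
    laplaceSum A P z θ = PowerSeries.constantCoeff P + lap (exp (θ * I)) φ z := by
  rw [laplaceSum, lap]
  congr 1
  refine setIntegral_congr_fun measurableSet_Ioi fun r hr => ?_
  simp only [borelTransform_apply hρ hφ hθ (le_of_lt hr)]

theorem ofReal_exp_neg_mul_le_iff {x C : ℝ} {r : ℝ} (hC : 0 ≤ C) :
    ENNReal.ofReal (Real.exp (-τ * r) * x) ≤ ENNReal.ofReal C ↔ x ≤ C * Real.exp (τ * r) := by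
  rw [ENNReal.ofReal_le_ofReal_iff hC, neg_mul, Real.exp_neg, inv_mul_le_iff₀ (Real.exp_pos _),
    mul_comm]

theorem borelNorm_le (hφ : IsBorelExtension A ρ P φ) (hF : 0 ≤ F)
    (hb : ∀ ζ ∈ sectorDisc A ρ, ‖φ ζ‖ ≤ F * Real.exp (τ * ‖ζ‖)) :
    borelNorm A ρ τ P ≤ ENNReal.ofReal (‖PowerSeries.constantCoeff P‖ + F) := by
  rw [borelNorm, ENNReal.ofReal_add (norm_nonneg _) hF]
  gcongr
  refine iInf₂_le_of_le φ hφ (iSup₂_le fun ζ hζ => ?_)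
  exact (ofReal_exp_neg_mul_le_iff hF).2 (hb ζ hζ)

/-- If the norm is finite, then it is attained by every analytic extension. -/
theorem exists_isBorelExtension (hρ : 0 < ρ) (h : borelNorm A ρ τ P < ⊤) :
    ∃ (φ : ℂ → ℂ) (F : ℝ), 0 ≤ F ∧ IsBorelExtension A ρ P φ ∧
      (∀ ζ ∈ sectorDisc A ρ, ‖φ ζ‖ ≤ F * Real.exp (τ * ‖ζ‖)) ∧
      borelNorm A ρ τ P = ENNReal.ofReal (‖PowerSeries.constantCoeff P‖ + F) := by
  have h1 := lt_top_iff_ne_top.1 (lt_of_le_of_lt le_add_self h)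
  have h2 : ∃ φ : ℂ → ℂ, IsBorelExtension A ρ P φ := by
    by_contra hne
    push Not at hne
    refine h1 ?_
    simp [hne]
  obtain ⟨φ, hφ⟩ := h2
  set N := ⨆ ζ ∈ sectorDisc A ρ, ENNReal.ofReal (Real.exp (-τ * ‖ζ‖) * ‖φ ζ‖)
  have h3 : (⨅ (h : ℂ → ℂ) (_ : IsBorelExtension A ρ P h),
      ⨆ ζ ∈ sectorDisc A ρ, ENNReal.ofReal (Real.exp (-τ * ‖ζ‖) * ‖h ζ‖)) = N := by
    refine le_antisymm (iInf₂_le φ hφ) (le_iInf₂ fun ψ hψ => iSup₂_mono fun ζ hζ => ?_)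
    rw [hφ.eqOn hρ hψ hζ]
  rw [h3] at h1
  refine ⟨φ, N.toReal, ENNReal.toReal_nonneg, hφ, fun ζ hζ => ?_, ?_⟩
  · rw [← ofReal_exp_neg_mul_le_iff ENNReal.toReal_nonneg, ENNReal.ofReal_toReal h1]
    exact le_iSup₂ (f := fun ζ (_ : ζ ∈ sectorDisc A ρ) =>
      ENNReal.ofReal (Real.exp (-τ * ‖ζ‖) * ‖φ ζ‖)) ζ hζ
  · rw [borelNorm, h3, ENNReal.ofReal_add (norm_nonneg _) ENNReal.toReal_nonneg,
      ENNReal.ofReal_toReal h1]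

theorem mul_exp_mono (hτ : τ ≤ τ') (hF : 0 ≤ F)
    (hb : ∀ ζ ∈ sectorDisc A ρ, ‖φ ζ‖ ≤ F * Real.exp (τ * ‖ζ‖)) :
    ∀ ζ ∈ sectorDisc A ρ, ‖φ ζ‖ ≤ F * Real.exp (τ' * ‖ζ‖) := fun ζ hζ =>
  (hb ζ hζ).trans (by gcongr)

theorem borelNorm_mono (hρ : 0 < ρ) (hτ : τ ≤ τ') (h : borelNorm A ρ τ P < ⊤) :
    borelNorm A ρ τ' P < ⊤ := by
  obtain ⟨φ, F, hF, hφ, hb, -⟩ := exists_isBorelExtension hρ h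
  exact (borelNorm_le hφ hF (mul_exp_mono hτ hF hb)).trans_lt ENNReal.ofReal_lt_top

theorem IsBorelExtension.isRayBorel (hρ : 0 < ρ) (hθ : θ ∈ A) (hφ : IsBorelExtension A ρ P φ)
    (hb : ∀ ζ ∈ sectorDisc A ρ, ‖φ ζ‖ ≤ F * Real.exp (τ * ‖ζ‖)) :
    IsRayBorel (exp (θ * I)) P φ F τ where
  hasFPowerSeriesAt := hφ.1
  continuousOn := hφ.2.continuousOn_ray (ray_mem_sectorDisc hρ hθ)
  bound r hr := by
    simpa using norm_le_on_ray (n := 0) (norm_exp_ofReal_mul_I θ) (ray_mem_sectorDisc hρ hθ)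
      (by simpa using hb) r hr

theorem eventually_rayFilter {e : ℂ} (he : ‖e‖ = 1) (M : ℝ) :
    ∀ᶠ x in rayFilter e, M < (x⁻¹ * e).re := by
  rw [rayFilter, eventually_map]
  have he0 : e ≠ 0 := by rintro rfl; simp at he
  filter_upwards [tendsto_inv_nhdsGT_zero.eventually_gt_atTop M, self_mem_nhdsWithin]
    with t ht (ht0 : 0 < t)
  have : ((t : ℂ) * e)⁻¹ * e = ((t⁻¹ : ℝ) : ℂ) := by push_cast; field_simp
  rwa [this, ofReal_re]

/-- The Borel transform of a composition. The function `compBorel` is analytic, hence the Borel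
transform of some series `χ`; its Laplace transform in one direction has the expansions `χ` and
`g ∘ f`, so that these agree. -/
theorem isBorelExtension_mul (hA : A.Nonempty) (hρ : 0 < ρ) (hF : 0 ≤ F) (hG : 0 ≤ G)
    (hφ : IsBorelExtension A ρ f.tail φ) (hψ : IsBorelExtension A ρ g.tail ψ)
    (hφb : ∀ ζ ∈ sectorDisc A ρ, ‖φ ζ‖ ≤ F * Real.exp (τ * ‖ζ‖))
    (hψb : ∀ ζ ∈ sectorDisc A ρ, ‖ψ ζ‖ ≤ G * Real.exp (τ * ‖ζ‖)) :
    IsBorelExtension A ρ (g * f).tail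
        (compBorel (PowerSeries.constantCoeff f.tail) φ ψ) ∧
      PowerSeries.constantCoeff (g * f).tail =
        PowerSeries.constantCoeff f.tail + PowerSeries.constantCoeff g.tail := by
  obtain ⟨θ, hθ⟩ := hA
  have hS := starConvex_sectorDisc A hρ
  have hray := ray_mem_sectorDisc (A := A) hρ hθ
  set e := exp (θ * I)
  have he : ‖e‖ = 1 := norm_exp_ofReal_mul_I θ
  set c := PowerSeries.constantCoeff f.tail
  have ha := hφ.2.compBorel (c := c) hS hψ.2
  obtain ⟨χ, hχ0, hχ⟩ := exists_borel_preimage (ha 0 (zero_mem_sectorDisc hρ))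
    (c + PowerSeries.constantCoeff g.tail)
  have hχB : IsBorelExtension A ρ χ (compBorel c φ ψ) := ⟨hχ, ha⟩
  have hr := hχB.isRayBorel hρ hθ (norm_compBorel_le hS hF hG hφb hψb)
  have h1 := (hasAsympExp_lap he hr.hasFPowerSeriesAt hr.continuousOn hr.bound).mono
    (rayFilter_le he)
  have h2 := hasAsympExp_mul_tail he (hφ.isRayBorel hρ hθ hφb) (hψ.isRayBorel hρ hθ hψb)
  have h3 : χ = (g * f).tail := by
    refine (h1.congr' ?_).unique ((rayFilter_le he).trans (sectorFilter_le e)) h2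
    filter_upwards [eventually_rayFilter he (τ + ‖c‖ + √F)] with x hx
    rw [lap_compBorel he hS hray hφ.2 hψ.2 hF hG hφb hψb hx, hχ0]
    ring
  rw [← h3]
  exact ⟨hχB, hχ0⟩

/-- The Borel transform of the inverse. The function `invBorel` is the Borel transform of some
series `χ`; the composition of `z + χ` with `f` has the same expansion as the identity in one
direction, so that `z + χ` is a left inverse of `f`. -/
theorem isBorelExtension_inv (hA : A.Nonempty) (hρ : 0 < ρ) (hF : 0 ≤ F)
    (hφ : IsBorelExtension A ρ f.tail φ)
    (hφb : ∀ ζ ∈ sectorDisc A ρ, ‖φ ζ‖ ≤ F * Real.exp (τ * ‖ζ‖)) :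
    IsBorelExtension A ρ (f⁻¹).tail (invBorel (PowerSeries.constantCoeff f.tail) φ) ∧
      PowerSeries.constantCoeff (f⁻¹).tail = -PowerSeries.constantCoeff f.tail := by
  obtain ⟨θ, hθ⟩ := hA
  have hS := starConvex_sectorDisc A hρ
  have hray := ray_mem_sectorDisc (A := A) hρ hθ
  set e := exp (θ * I)
  have he : ‖e‖ = 1 := norm_exp_ofReal_mul_I θ
  set c := PowerSeries.constantCoeff f.tail
  have ha := hφ.2.invBorel (c := c) hS
  obtain ⟨χ, hχ0, hχ⟩ := exists_borel_preimage (ha 0 (zero_mem_sectorDisc hρ)) (-c)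
  have hχB : IsBorelExtension A ρ χ (invBorel c φ) := ⟨hχ, ha⟩
  have hr := hχB.isRayBorel hρ hθ (norm_invBorel_le hS hF hφb)
  have h2 := hasAsympExp_mul_tail (g := ⟨χ⟩) he (hφ.isRayBorel hρ hθ hφb) hr
  have h0 : HasAsympExp (rayFilter e) (fun _ => 0) 0 := by
    simpa using HasAsympExp.of_polynomial (l := rayFilter e) 0
  have h3 : (⟨χ⟩ * f : TangentDiffeo).tail = 0 := by
    refine (h2.congr' ?_).unique ((rayFilter_le he).trans (sectorFilter_le e)) h0
    filter_upwards [eventually_rayFilter he (τ + (16 * F + 3))] with x hx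
    rw [show invBorel c φ = fun ζ => exp (c * ζ) * ∑' j, invTerm φ j ζ from rfl, lap_exp_mul]
    have h4 := lap_tsum_invTerm he hS hray hφ.2 hF hφb hx
    rw [show x⁻¹ + (c + lap e φ x⁻¹) - c = x⁻¹ + lap e φ x⁻¹ by ring, h4, hχ0]
    ring
  have h4 : (⟨χ⟩ : TangentDiffeo) = f⁻¹ := eq_inv_of_mul_eq_one_left (TangentDiffeo.ext h3)
  rw [← h4]
  exact ⟨hχB, hχ0⟩

theorem two_mul_sqrt_le_add_one (hF : 0 ≤ F) : 2 * √F ≤ F + 1 := by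
  nlinarith [Real.sq_sqrt hF, sq_nonneg (√F - 1)]

theorem borelNorm_mul_le (hA : A.Nonempty) (hρ : 0 < ρ) (hf : borelNorm A ρ τ f.tail < ⊤)
    (hg : borelNorm A ρ τ g.tail < ⊤) :
    borelNorm A ρ (τ + 1 + (borelNorm A ρ τ f.tail).toReal) (g * f).tail ≤
      borelNorm A ρ τ f.tail + borelNorm A ρ τ g.tail := by
  obtain ⟨φ, F, hF, hφ, hφb, hfe⟩ := exists_isBorelExtension hρ hf
  obtain ⟨ψ, G, hG, hψ, hψb, hge⟩ := exists_isBorelExtension hρ hg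
  obtain ⟨h1, h2⟩ := isBorelExtension_mul hA hρ hF hG hφ hψ hφb hψb
  have h3 := norm_nonneg (PowerSeries.constantCoeff f.tail)
  rw [hfe, hge, ENNReal.toReal_ofReal (by positivity), ← ENNReal.ofReal_add (by positivity)
    (by positivity)]
  refine (borelNorm_le h1 (add_nonneg hF hG) (mul_exp_mono ?_ (add_nonneg hF hG)
    (norm_compBorel_le (starConvex_sectorDisc A hρ) hF hG hφb hψb))).trans
    (ENNReal.ofReal_le_ofReal ?_)
  · have := two_mul_sqrt_le_add_one hF
    have := Real.sqrt_nonneg F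
    linarith
  · rw [h2]
    have := norm_add_le (PowerSeries.constantCoeff f.tail) (PowerSeries.constantCoeff g.tail)
    linarith

theorem borelNorm_inv_le (hA : A.Nonempty) (hρ : 0 < ρ) (hf : borelNorm A ρ τ f.tail < ⊤) :
    borelNorm A ρ (τ + 1 + (borelNorm A ρ τ f.tail).toReal) (f⁻¹).tail ≤
      borelNorm A ρ τ f.tail := by
  obtain ⟨φ, F, hF, hφ, hφb, hfe⟩ := exists_isBorelExtension hρ hf
  obtain ⟨h1, h2⟩ := isBorelExtension_inv hA hρ hF hφ hφb
  have h3 := norm_nonneg (PowerSeries.constantCoeff f.tail)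
  rw [hfe, ENNReal.toReal_ofReal (by positivity)]
  refine (borelNorm_le h1 hF (mul_exp_mono ?_ hF
    (norm_invBorel_le (starConvex_sectorDisc A hρ) hF hφb))).trans
    (ENNReal.ofReal_le_ofReal ?_)
  · have := two_mul_sqrt_le_add_one hF
    linarith
  · rw [h2, norm_neg]

end SectorDisc

/-! ### Independence of the direction -/

section Direction

variable {e z : ℂ} {h : ℂ → ℂ} {C τ : ℝ}

theorem differentiableAt_lap (he : ‖e‖ = 1) (hc : ContinuousOn (fun r : ℝ => h (r * e)) (Ioi 0))
    (hb : ∀ r : ℝ, 0 < r → ‖h (r * e)‖ ≤ C * Real.exp (τ * r)) (hz : τ < (z * e).re) :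
    DifferentiableAt ℂ (lap e h) z := by
  set δ := ((z * e).re - τ) / 2
  have hδ : 0 < δ := by simp only [δ]; linarith
  have hball : ∀ w ∈ Metric.ball z δ, τ + δ < (w * e).re := by
    intro w hw
    have h1 := (abs_le.1 (abs_re_le_norm ((w - z) * e))).1
    rw [norm_mul, he, mul_one, sub_mul, sub_re] at h1
    rw [mem_ball_iff_norm] at hw
    simp only [δ] at hw ⊢
    linarith
  have hmeas : ∀ w : ℂ, ∀ n : ℕ, AEStronglyMeasurable
      (fun r : ℝ => h (r * e) * exp (-w * (r * e)) * e * (-(r * e)) ^ n)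
      (volume.restrict (Ioi 0)) := fun w n =>
    (((hc.mul (by fun_prop)).mul (by fun_prop)).mul (by fun_prop)).aestronglyMeasurable
      measurableSet_Ioi
  refine (hasDerivAt_integral_of_dominated_loc_of_deriv_le (μ := volume.restrict (Ioi (0 : ℝ)))
    (F := fun (w : ℂ) (r : ℝ) => h (r * e) * exp (-w * (r * e)) * e)
    (F' := fun (w : ℂ) (r : ℝ) => h (r * e) * exp (-w * (r * e)) * e * (-(r * e)))
    (bound := fun r => |C| * (r ^ 1 * Real.exp (-(δ * r))))
    (Metric.ball_mem_nhds z hδ) ?_ ?_ ?_ ?_ ?_ ?_).2.differentiableAt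
  · exact .of_forall fun w => by simpa using hmeas w 0
  · exact lap_integrableOn (n := 0) he hc (by simpa using hb) hz
  · simpa using hmeas z 1
  · refine (ae_restrict_iff' measurableSet_Ioi).2 (.of_forall fun r (hr : 0 < r) w hw => ?_)
    have h1 := norm_lap_integrand_le (z := w) (n := 0) (τ := τ) (C := C) he
      (by simpa using hb r hr)
    have h2 := hball w hw
    have h4 : ‖(r : ℂ) * e‖ = r := by
      rw [norm_mul, he, mul_one, norm_real, Real.norm_of_nonneg hr.le]
    rw [norm_mul, norm_neg, h4, pow_one, mul_comm r (Real.exp _), ← mul_assoc |C|]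
    refine mul_le_mul_of_nonneg_right (h1.trans ?_) hr.le
    simp only [Nat.factorial_zero, Nat.cast_one, div_one, pow_zero, one_mul]
    have h3 := le_abs_self C
    gcongr
    linarith
  · exact (integrableOn_pow_mul_exp_neg 1 hδ).const_mul _
  · refine .of_forall fun r w _ => ?_
    have h1 : HasDerivAt (fun w : ℂ => -w * (r * e)) (-(r * e)) w := by
      simpa using (hasDerivAt_id w).neg.mul_const ((r : ℂ) * e)
    have h2 := (h1.cexp.const_mul (h (r * e))).mul_const e
    exact h2.congr_deriv (by ring)

theorem isOpen_halfPlane (e : ℂ) (τ : ℝ) : IsOpen {z : ℂ | τ < (z * e).re} :=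
  isOpen_lt continuous_const (by fun_prop)

theorem convex_halfPlane (e : ℂ) (τ : ℝ) : Convex ℝ {z : ℂ | τ < (z * e).re} :=
  convex_halfSpace_gt (𝕜 := ℝ) (f := fun z : ℂ => (z * e).re)
    ⟨fun x y => by rw [add_mul, add_re], fun c x => by
      rw [real_smul, mul_assoc, re_ofReal_mul, smul_eq_mul]⟩ τ

/-- An analytic function on a star-shaped set has a primitive. -/
theorem exists_primitive {S : Set ℂ} (hS : StarConvex ℝ 0 S) (hh : AnalyticOnNhd ℂ h S) :
    ∃ P : ℂ → ℂ, ∀ ζ ∈ S, HasDerivAt P (h ζ) ζ := by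
  obtain ⟨U, hU, hUs, hSU, hd, -⟩ := hh.exists_open_starConvex hS hh
  refine ⟨fun ζ => ∫ t in (0 : ℝ)..1, ζ * h (t * ζ), fun ζ hζ => ?_⟩
  have hd' := hd.deriv hU
  have key := hasDerivAt_integral_of_continuousOn hU
    (G := fun w t => w * h (t * w))
    (G' := fun w t => 1 * h (t * w) + w * (deriv h (t * w) * t))
    ((by fun_prop : ContinuousOn (fun p : ℂ × ℝ => p.1) _).mul
      (continuousOn_comp_ofReal_mul hUs hd.continuousOn))
    ((continuousOn_const.mul (continuousOn_comp_ofReal_mul hUs hd.continuousOn)).add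
      ((by fun_prop : ContinuousOn (fun p : ℂ × ℝ => p.1) _).mul
        ((continuousOn_comp_ofReal_mul hUs hd'.continuousOn).mul (by fun_prop)))) ?_ (hSU hζ)
  · convert key using 1
    have h1 : ∀ t ∈ uIcc (0 : ℝ) 1, HasDerivAt (fun t : ℝ => (t : ℂ) * h (t * ζ))
        (1 * h (t * ζ) + t * (deriv h (t * ζ) * ζ)) t := by
      intro t ht
      rw [uIcc_of_le zero_le_one] at ht
      have h2 := (hd.differentiableAt
        (hU.mem_nhds (hUs.ofReal_mul_mem (hSU hζ) ht))).hasDerivAt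
      have h3 : HasDerivAt (fun t : ℝ => (t : ℂ)) 1 t := ofRealCLM.hasDerivAt
      have h4 : HasDerivAt (fun t : ℝ => (t : ℂ) * ζ) ζ t := by
        simpa using h3.mul_const ζ
      exact h3.mul (h2.comp t h4)
    have h5 := intervalIntegral.integral_eq_sub_of_hasDerivAt h1 (by
      refine ContinuousOn.intervalIntegrable ?_
      rw [uIcc_of_le zero_le_one]
      have c1 := (continuousOn_comp_ofReal_mul hUs hd.continuousOn).comp
        (f := fun t : ℝ => (ζ, t)) (s := Icc 0 1) (by fun_prop) fun _ ht => ⟨hSU hζ, ht⟩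
      have c2 := (continuousOn_comp_ofReal_mul hUs hd'.continuousOn).comp
        (f := fun t : ℝ => (ζ, t)) (s := Icc 0 1) (by fun_prop) fun _ ht => ⟨hSU hζ, ht⟩
      exact (continuousOn_const.mul c1).add ((by fun_prop : ContinuousOn _ _).mul
        (c2.mul continuousOn_const)))
    simp only [ofReal_one, one_mul, ofReal_zero, zero_mul, sub_zero] at h5
    rw [← h5]
    congr 1
    ext t
    ring
  · intro w hw t ht
    have h2 := (hd.differentiableAt (hU.mem_nhds (hUs.ofReal_mul_mem hw ht))).hasDerivAt
    have h3 : HasDerivAt (fun w : ℂ => (t : ℂ) * w) t w := by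
      simpa using (hasDerivAt_id w).const_mul (t : ℂ)
    exact (hasDerivAt_id w).mul (h2.comp w h3)

variable {A : Set ℝ} {ρ θ₁ θ₂ : ℝ}

/-- The contour of integration can be rotated, far away in a common half-plane: on the arc from
`R e^{iθ₁}` to `R e^{iθ₂}` the integrand is at most `|C| e^{-R}`. -/
theorem lap_eq_of_forall_le (hA : A.OrdConnected) (hρ : 0 < ρ)
    (hh : AnalyticOnNhd ℂ h (sectorDisc A ρ))
    (hb : ∀ ζ ∈ sectorDisc A ρ, ‖h ζ‖ ≤ C * Real.exp (τ * ‖ζ‖)) (h1 : θ₁ ∈ A) (h2 : θ₂ ∈ A)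
    (h12 : θ₁ ≤ θ₂) (hz : ∀ θ ∈ Icc θ₁ θ₂, τ + 1 ≤ (z * exp (θ * I)).re) :
    lap (exp (θ₁ * I)) h z = lap (exp (θ₂ * I)) h z := by
  have hS := starConvex_sectorDisc A hρ
  obtain ⟨P, hP⟩ := exists_primitive (h := fun ζ => h ζ * exp (-z * ζ)) hS
    fun ζ hζ => by have := hh ζ hζ; fun_prop
  have hlim : ∀ θ ∈ Icc θ₁ θ₂, Tendsto (fun R : ℝ => P (R * exp (θ * I)) - P 0) atTop
      (𝓝 (lap (exp (θ * I)) h z)) := by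
    intro θ hθ
    have hθA := hA.out h1 h2 hθ
    have hray := ray_mem_sectorDisc hρ hθA
    have hint := lap_integrableOn (z := z) (n := 0) (norm_exp_ofReal_mul_I θ)
      (hh.continuousOn_ray hray)
      (norm_le_on_ray (norm_exp_ofReal_mul_I θ) hray (by simpa using hb))
      (by linarith [hz θ hθ] : τ < _)
    refine (intervalIntegral_tendsto_integral_Ioi 0 hint tendsto_id).congr' ?_
    filter_upwards [eventually_ge_atTop 0] with R hR
    have hd : ∀ t ∈ uIcc (0 : ℝ) R, HasDerivAt (fun t : ℝ => P (t * exp (θ * I)))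
        (h (t * exp (θ * I)) * exp (-z * (t * exp (θ * I))) * exp (θ * I)) t := by
      intro t ht
      rw [uIcc_of_le hR] at ht
      have h3 : HasDerivAt (fun t : ℝ => (t : ℂ)) 1 t := ofRealCLM.hasDerivAt
      have h4 : HasDerivAt (fun t : ℝ => (t : ℂ) * exp (θ * I)) (exp (θ * I)) t := by
        simpa using h3.mul_const (exp (θ * I))
      exact (hP _ (hray t ht.1)).comp t h4
    have := intervalIntegral.integral_eq_sub_of_hasDerivAt hd (by
      rw [intervalIntegrable_iff_integrableOn_Ioc_of_le hR]
      exact hint.mono_set Ioc_subset_Ioi_self)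
    simpa using this
  have hdiff : Tendsto (fun R : ℝ => (P (R * exp (θ₂ * I)) - P 0) - (P (R * exp (θ₁ * I)) - P 0))
      atTop (𝓝 0) := by
    have hlim0 : Tendsto (fun R : ℝ => |C| * (R ^ 1 * Real.exp (-R)) * ‖θ₂ - θ₁‖) atTop (𝓝 0) := by
      simpa using ((Real.tendsto_pow_mul_exp_neg_atTop_nhds_zero 1).const_mul |C|).mul_const
        ‖θ₂ - θ₁‖
    refine squeeze_zero_norm' ?_ hlim0
    filter_upwards [eventually_ge_atTop 0] with R hR
    rw [sub_sub_sub_cancel_right]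
    refine Convex.norm_image_sub_le_of_norm_hasDerivWithin_le
      (f := fun θ : ℝ => P (R * exp (θ * I))) (s := Icc θ₁ θ₂)
      (f' := fun θ => h (R * exp (θ * I)) * exp (-z * (R * exp (θ * I))) *
        (R * (exp (θ * I) * I))) (fun θ hθ => ?_) (fun θ hθ => ?_) (convex_Icc _ _)
      (left_mem_Icc.2 h12) (right_mem_Icc.2 h12)
    · have hray := ray_mem_sectorDisc hρ (hA.out h1 h2 hθ)
      have h3 : HasDerivAt (fun t : ℝ => (t : ℂ)) 1 θ := ofRealCLM.hasDerivAt
      have h4 : HasDerivAt (fun t : ℝ => (R : ℂ) * exp (t * I)) (R * (exp (θ * I) * I)) θ := by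
        simpa using ((h3.mul_const I).cexp).const_mul (R : ℂ)
      exact ((hP _ (hray R hR)).comp θ h4).hasDerivWithinAt
    · have hray := ray_mem_sectorDisc hρ (hA.out h1 h2 hθ)
      have hnorm := norm_exp_ofReal_mul_I θ
      have h5 := norm_lap_integrand_le (z := z) (n := 0) (τ := τ) (C := C) (r := R) hnorm
        (by simpa [hnorm, abs_of_nonneg hR] using hb _ (hray R hR))
      rw [norm_mul _ (exp (θ * I)), hnorm, mul_one] at h5
      rw [norm_mul, norm_mul (R : ℂ), norm_mul _ I, hnorm, norm_I, norm_real,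
        Real.norm_of_nonneg hR, one_mul, mul_one, pow_one, mul_comm R (Real.exp _),
        ← mul_assoc |C|]
      refine mul_le_mul_of_nonneg_right (h5.trans ?_) hR
      simp only [Nat.factorial_zero, Nat.cast_one, div_one, pow_zero, one_mul]
      have h6 := le_abs_self C
      have h7 := hz θ hθ
      have h8 : 1 * R ≤ ((z * exp (θ * I)).re - τ) * R := by gcongr; linarith
      gcongr
      linarith
  have h3 := (hlim θ₂ (right_mem_Icc.2 h12)).sub (hlim θ₁ (left_mem_Icc.2 h12))
  exact (sub_eq_zero.1 (tendsto_nhds_unique h3 hdiff)).symm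

/-- Laplace transforms in directions at an angle less than `π` agree on the intersection of the
two half-planes, by analytic continuation. -/
theorem lap_eq_of_lt_pi (hA : A.OrdConnected) (hρ : 0 < ρ)
    (hh : AnalyticOnNhd ℂ h (sectorDisc A ρ))
    (hb : ∀ ζ ∈ sectorDisc A ρ, ‖h ζ‖ ≤ C * Real.exp (τ * ‖ζ‖)) (h1 : θ₁ ∈ A) (h2 : θ₂ ∈ A)
    (h12 : θ₁ ≤ θ₂) (hpi : θ₂ - θ₁ < Real.pi) :
    EqOn (lap (exp (θ₁ * I)) h) (lap (exp (θ₂ * I)) h)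
      ({z | τ < (z * exp (θ₁ * I)).re} ∩ {z | τ < (z * exp (θ₂ * I)).re}) := by
  have hdiff : ∀ θ ∈ A, DifferentiableOn ℂ (lap (exp (θ * I)) h)
      {z | τ < (z * exp (θ * I)).re} := fun θ hθ w hw =>
    (differentiableAt_lap (norm_exp_ofReal_mul_I θ) (hh.continuousOn_ray (ray_mem_sectorDisc hρ hθ))
      (fun r hr => by
        simpa using norm_le_on_ray (n := 0) (norm_exp_ofReal_mul_I θ) (ray_mem_sectorDisc hρ hθ)
          (by simpa using hb) r hr) hw).differentiableWithinAt
  set μ := (θ₁ + θ₂) / 2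
  set d := (θ₂ - θ₁) / 2
  have hd0 : 0 ≤ d := by simp only [d]; linarith
  have hcos : 0 < Real.cos d := Real.cos_pos_of_mem_Ioo
    ⟨by have := Real.pi_pos; linarith, by simp only [d]; linarith⟩
  -- all directions between `θ₁` and `θ₂` are at an angle at most `d < π / 2` from the bisector `μ`,
  -- so that `Re(z₀ e^{iθ}) ≥ s cos d = |τ| + 2` at the point `z₀ = s e^{-iμ}`
  set s := (|τ| + 2) / Real.cos d
  have hs : 0 < s := by positivity
  set z₀ : ℂ := s * exp (-(μ * I))
  have hfar : ∀ z ∈ Metric.ball z₀ 1, ∀ θ ∈ Icc θ₁ θ₂, τ + 1 ≤ (z * exp (θ * I)).re := by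
    intro z hz θ hθ
    have h3 := (abs_le.1 (abs_re_le_norm ((z - z₀) * exp (θ * I)))).1
    rw [norm_mul, norm_exp_ofReal_mul_I, mul_one, sub_mul, sub_re] at h3
    rw [mem_ball_iff_norm] at hz
    have h4 : (z₀ * exp (θ * I)).re = s * Real.cos (θ - μ) := by
      simp only [z₀]
      rw [mul_assoc, ← exp_add, show -((μ : ℂ) * I) + θ * I = ((θ - μ : ℝ) : ℂ) * I by
        push_cast; ring, re_ofReal_mul, exp_ofReal_mul_I_re]
    have h5 : Real.cos d ≤ Real.cos (θ - μ) := by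
      rw [← Real.cos_abs (θ - μ)]
      refine Real.cos_le_cos_of_nonneg_of_le_pi (abs_nonneg _) ?_ ?_
      · simp only [d]; linarith [Real.pi_pos]
      · rw [abs_le]
        simp only [d, μ]
        constructor <;> linarith [hθ.1, hθ.2]
    have h6 : |τ| + 2 ≤ s * Real.cos (θ - μ) := by
      rw [← div_mul_cancel₀ (|τ| + 2) hcos.ne']
      gcongr
    have := le_abs_self τ
    linarith
  have hz₀ := hfar z₀ (Metric.mem_ball_self one_pos)
  have hm1 := hz₀ θ₁ (left_mem_Icc.2 h12)
  have hm2 := hz₀ θ₂ (right_mem_Icc.2 h12)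
  have a1 := ((hdiff θ₁ h1).analyticOnNhd (isOpen_halfPlane _ τ)).mono
    (inter_subset_left (t := {z | τ < (z * exp (θ₂ * I)).re}))
  have a2 := ((hdiff θ₂ h2).analyticOnNhd (isOpen_halfPlane _ τ)).mono
    (inter_subset_right (s := {z | τ < (z * exp (θ₁ * I)).re}))
  refine a1.eqOn_of_preconnected_of_eventuallyEq a2
    ((convex_halfPlane _ τ).inter (convex_halfPlane _ τ)).isPreconnected
    (z₀ := z₀) ⟨by simp only [mem_ofPred_eq]; linarith, by simp only [mem_ofPred_eq]; linarith⟩ ?_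
  filter_upwards [Metric.ball_mem_nhds z₀ one_pos] with z hz
  exact lap_eq_of_forall_le hA hρ hh hb h1 h2 h12 (hfar z hz)

/-- If the half-planes of two opposite directions overlap, then the Laplace transforms in these
directions glue to a bounded entire function, and so they vanish. -/
theorem lap_eq_zero (hA : A.OrdConnected) (hρ : 0 < ρ) (hh : AnalyticOnNhd ℂ h (sectorDisc A ρ))
    (hb : ∀ ζ ∈ sectorDisc A ρ, ‖h ζ‖ ≤ C * Real.exp (τ * ‖ζ‖)) (h1 : θ₁ ∈ A) (h2 : θ₂ ∈ A)
    (h12 : θ₂ = θ₁ + Real.pi) (hτ : τ < 0) :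
    (∀ z, τ < (z * exp (θ₁ * I)).re → lap (exp (θ₁ * I)) h z = 0) ∧
      ∀ z, τ < (z * exp (θ₂ * I)).re → lap (exp (θ₂ * I)) h z = 0 := by
  have hpi := Real.pi_pos
  set m := θ₁ + Real.pi / 2
  have hm : m ∈ A := hA.out h1 h2 ⟨by simp only [m]; linarith, by simp only [m]; linarith⟩
  have hneg : ∀ z : ℂ, (z * exp (θ₂ * I)).re = -(z * exp (θ₁ * I)).re := fun z => by
    rw [h12, ofReal_add, add_mul, exp_add, exp_pi_mul_I]
    simp
  have hdiff : ∀ θ ∈ A, ∀ w : ℂ, τ < (w * exp (θ * I)).re →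
      DifferentiableAt ℂ (lap (exp (θ * I)) h) w := fun θ hθ w hw =>
    differentiableAt_lap (norm_exp_ofReal_mul_I θ) (hh.continuousOn_ray (ray_mem_sectorDisc hρ hθ))
      (fun r hr => by
        simpa using norm_le_on_ray (n := 0) (norm_exp_ofReal_mul_I θ) (ray_mem_sectorDisc hρ hθ)
          (by simpa using hb) r hr) hw
  have hbound : ∀ θ ∈ A, ∀ w : ℂ, τ < (w * exp (θ * I)).re →
      ‖lap (exp (θ * I)) h w‖ ≤ C / ((w * exp (θ * I)).re - τ) := fun θ hθ w hw => by
    simpa using norm_lap_le (n := 0) (norm_exp_ofReal_mul_I θ)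
      (norm_le_on_ray (norm_exp_ofReal_mul_I θ) (ray_mem_sectorDisc hρ hθ) (by simpa using hb)) hw
  set e₁ := exp (θ₁ * I)
  set e₂ := exp (θ₂ * I)
  have he₁ : e₁ ≠ 0 := exp_ne_zero _
  -- the two transforms agree near `0` with that in the intermediate direction
  have hstrip : EqOn (lap e₁ h) (lap e₂ h) ({z | τ < (z * e₁).re} ∩ {z | τ < (z * e₂).re}) := by
    have a1 : AnalyticOnNhd ℂ (lap e₁ h) {z | τ < (z * e₁).re} :=
      DifferentiableOn.analyticOnNhd
        (fun w hw => (hdiff θ₁ h1 w hw).differentiableWithinAt) (isOpen_halfPlane _ τ)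
    have a2 : AnalyticOnNhd ℂ (lap e₂ h) {z | τ < (z * e₂).re} :=
      DifferentiableOn.analyticOnNhd
        (fun w hw => (hdiff θ₂ h2 w hw).differentiableWithinAt) (isOpen_halfPlane _ τ)
    have h0 : ∀ e : ℂ, (0 : ℂ) ∈ {z : ℂ | τ < (z * e).re} := fun e => by simpa using hτ
    refine (a1.mono inter_subset_left).eqOn_of_preconnected_of_eventuallyEq
      (a2.mono inter_subset_right) ((convex_halfPlane _ τ).inter
        (convex_halfPlane _ τ)).isPreconnected (z₀ := 0) ⟨h0 _, h0 _⟩ ?_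
    filter_upwards [(isOpen_halfPlane e₁ τ).mem_nhds (h0 _),
      (isOpen_halfPlane e₂ τ).mem_nhds (h0 _),
      (isOpen_halfPlane (exp (m * I)) τ).mem_nhds (h0 _)] with w hw1 hw2 hwm
    exact (lap_eq_of_lt_pi hA hρ hh hb h1 hm (by simp only [m]; linarith)
      (by simp only [m]; linarith) ⟨hw1, hwm⟩).trans
      (lap_eq_of_lt_pi hA hρ hh hb hm h2 (by simp only [m]; linarith)
      (by simp only [m]; linarith) ⟨hwm, hw2⟩)
  -- the boundary `τ / 2` keeps away from both lines where the bounds `hbound` degenerate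
  set E : ℂ → ℂ := fun z => if τ / 2 < (z * e₁).re then lap e₁ h z else lap e₂ h z
  have hE1 : ∀ z, τ < (z * e₁).re → E z = lap e₁ h z := by
    intro z hz
    by_cases hz' : τ / 2 < (z * e₁).re
    · exact if_pos hz'
    · exact (if_neg hz').trans (hstrip ⟨hz, by simp only [mem_ofPred_eq, hneg]; linarith⟩).symm
  have hE2 : ∀ z, τ < (z * e₂).re → E z = lap e₂ h z := by
    intro z hz
    by_cases hz' : τ / 2 < (z * e₁).re
    · exact (if_pos hz').trans (hstrip ⟨by simp only [mem_ofPred_eq]; linarith, hz⟩)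
    · exact if_neg hz'
  have hcases : ∀ z, τ < (z * e₁).re ∨ τ < (z * e₂).re := fun z => by
    rw [hneg]
    by_contra! hcon
    linarith [hcon.1, hcon.2]
  have hEd : Differentiable ℂ E := by
    intro z
    rcases hcases z with hz | hz
    · refine (hdiff θ₁ h1 z hz).congr_of_eventuallyEq ?_
      filter_upwards [(isOpen_halfPlane e₁ τ).mem_nhds hz] with w hw using hE1 w hw
    · refine (hdiff θ₂ h2 z hz).congr_of_eventuallyEq ?_
      filter_upwards [(isOpen_halfPlane e₂ τ).mem_nhds hz] with w hw using hE2 w hw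
  have hEb : ∀ z, ‖E z‖ ≤ |C| / (-τ / 2) := by
    intro z
    have hle : ∀ x : ℝ, -τ / 2 ≤ x → C / x ≤ |C| / (-τ / 2) := fun x hx => by
      have := le_abs_self C
      have : 0 < -τ / 2 := by linarith
      gcongr
    by_cases hz' : τ / 2 < (z * e₁).re
    · simp only [E, if_pos hz']
      exact (hbound θ₁ h1 z (by linarith)).trans (hle _ (by linarith))
    · simp only [E, if_neg hz']
      exact (hbound θ₂ h2 z (by rw [hneg]; linarith)).trans (hle _ (by rw [hneg]; linarith))
  have hconst : ∀ z w, E z = E w := hEd.apply_eq_apply_of_bounded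
    (isBounded_iff_forall_norm_le.2 ⟨_, by rintro _ ⟨z, rfl⟩; exact hEb z⟩)
  have hzero : E 0 = 0 := by
    by_contra hne
    have hpos : 0 < ‖E 0‖ := norm_pos_iff.2 hne
    -- the bound `|E z| ≤ C / (t - τ)` with `t = Re(z e₁) = |C| / |E 0|` contradicts `τ < 0`
    set t := |C| / ‖E 0‖
    have ht : 0 ≤ t := by positivity
    have ht' : ((t : ℂ) * e₁⁻¹ * e₁).re = t := by rw [mul_assoc, inv_mul_cancel₀ he₁]; simp
    have h3 := hbound θ₁ h1 (t * e₁⁻¹) (by rw [ht']; linarith)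
    rw [← hE1 _ (by rw [ht']; linarith), hconst _ 0, ht', le_div_iff₀ (by linarith)] at h3
    have h4 : ‖E 0‖ * t = |C| := by simp only [t]; field_simp
    nlinarith [le_abs_self C]
  exact ⟨fun z hz => by rw [← hE1 z hz, hconst z 0, hzero],
    fun z hz => by rw [← hE2 z hz, hconst z 0, hzero]⟩

/-- The Laplace transform does not depend on the direction: in the case `τ < 0` directions at an
angle of at least `π` are allowed as well, and then both transforms vanish. -/
theorem lap_eq_lap (hA : A.OrdConnected) (hρ : 0 < ρ) (hh : AnalyticOnNhd ℂ h (sectorDisc A ρ))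
    (hb : ∀ ζ ∈ sectorDisc A ρ, ‖h ζ‖ ≤ C * Real.exp (τ * ‖ζ‖)) (h1 : θ₁ ∈ A) (h2 : θ₂ ∈ A)
    (hz1 : τ < (z * exp (θ₁ * I)).re) (hz2 : τ < (z * exp (θ₂ * I)).re)
    (hlog : 0 ≤ τ → |θ₁ - θ₂| < Real.pi) :
    lap (exp (θ₁ * I)) h z = lap (exp (θ₂ * I)) h z := by
  wlog h12 : θ₁ ≤ θ₂ generalizing θ₁ θ₂
  · exact (this h2 h1 hz2 hz1 (fun h => by rw [abs_sub_comm]; exact hlog h) (le_of_not_ge h12)).symm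
  by_cases hpi : θ₂ - θ₁ < Real.pi
  · exact lap_eq_of_lt_pi hA hρ hh hb h1 h2 h12 hpi ⟨hz1, hz2⟩
  have hτ : τ < 0 := by
    by_contra! hτ
    have := (abs_lt.1 (hlog hτ)).1
    linarith
  have hpi0 := Real.pi_pos
  have h3 : θ₁ + Real.pi ∈ A := hA.out h1 h2 ⟨by linarith, by linarith⟩
  have h4 : θ₂ - Real.pi ∈ A := hA.out h1 h2 ⟨by linarith, by linarith⟩
  rw [(lap_eq_zero hA hρ hh hb h1 h3 rfl hτ).1 z hz1,
    (lap_eq_zero hA hρ hh hb h4 h2 (by ring) hτ).2 z hz2]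

end Direction

/-! ### Points of the domain of a Borel sum -/

section Domain

variable {A : Set ℝ} {ρ τ τ' : ℝ} {f g : TangentDiffeo}

theorem HalfPlanePoint.exp_logCoord (p : HalfPlanePoint A τ) (hτ : 0 ≤ τ) :
    exp p.logCoord = p.z := by
  have h1 : p.z * exp (p.θ * I) ≠ 0 := fun h0 => by
    have := p.lt
    rw [h0, zero_re] at this
    linarith
  rw [logCoord, exp_sub, exp_log h1, mul_div_cancel_right₀ _ (exp_ne_zero _)]

theorem HalfPlanePoint.abs_logCoord_im_add_lt (p : HalfPlanePoint A τ) (hτ : 0 ≤ τ) :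
    |p.logCoord.im + p.θ| < Real.pi / 2 := by
  have h1 : p.logCoord.im + p.θ = arg (p.z * exp (p.θ * I)) := by simp [logCoord, log_im]
  rw [h1, abs_arg_lt_pi_div_two_iff]
  exact Or.inl (hτ.trans_lt p.lt)

/-- Two pairs represent the same point if and only if the underlying complex numbers agree and, in
the case `τ ≥ 0`, the directions make an angle less than `π`. -/
theorem SumDomain.mk_eq_mk_iff {p q : HalfPlanePoint A τ} :
    mk p = mk q ↔ p.z = q.z ∧ (0 ≤ τ → |p.θ - q.θ| < Real.pi) := by
  refine Quotient.eq.trans (and_congr_right fun hz => imp_congr_right fun hτ => ?_)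
  have hp := abs_lt.1 (p.abs_logCoord_im_add_lt hτ)
  have hq := abs_lt.1 (q.abs_logCoord_im_add_lt hτ)
  constructor
  · intro h
    rw [h] at hp
    rw [abs_lt]
    constructor <;> linarith [hp.1, hp.2, hq.1, hq.2]
  · intro h
    have h1 : exp p.logCoord = exp q.logCoord := by
      rw [p.exp_logCoord hτ, q.exp_logCoord hτ, hz]
    obtain ⟨n, hn⟩ := exp_eq_exp_iff_exists_int.1 h1
    have h2 : p.logCoord.im = q.logCoord.im + n * (2 * Real.pi) := by
      rw [hn]; simp
    have h3 := abs_lt.1 h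
    have hpi := Real.pi_pos
    have h4 : (n : ℝ) < 1 := by
      by_contra! hcon
      nlinarith [hp.1, hp.2, hq.1, hq.2]
    have h5 : (-1 : ℝ) < n := by
      by_contra! hcon
      nlinarith [hp.1, hp.2, hq.1, hq.2]
    have h6 : n = 0 := by
      have h4' : n < 1 := by exact_mod_cast h4
      have h5' : -1 < n := by exact_mod_cast h5
      omega
    rw [hn, h6]
    simp

theorem SumDomain.mk_rep (P : SumDomain A τ) : mk P.rep = P := Quotient.out_eq P

theorem borelSum_mk (hA : A.OrdConnected) (hρ : 0 < ρ) {φ : PowerSeries ℂ}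
    (h : borelNorm A ρ τ φ < ⊤) (p : HalfPlanePoint A τ) :
    borelSum A φ (SumDomain.mk p) = laplaceSum A φ p.z p.θ := by
  obtain ⟨u, F, hF, hu, hb, -⟩ := exists_isBorelExtension hρ h
  obtain ⟨h1, h2⟩ := SumDomain.mk_eq_mk_iff.1 (SumDomain.mk p).mk_rep
  rw [borelSum, laplaceSum_eq hρ hu (SumDomain.mk p).rep.mem, laplaceSum_eq hρ hu p.mem, ← h1]
  congr 1
  refine lap_eq_lap hA hρ hu.2 hb (SumDomain.mk p).rep.mem p.mem (SumDomain.mk p).rep.lt ?_ h2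
  rw [h1]
  exact p.lt

theorem sumDiffeo_mk (hA : A.OrdConnected) (hρ : 0 < ρ) (h : borelNorm A ρ τ f.tail < ⊤)
    (p : HalfPlanePoint A τ) :
    sumDiffeo A f (SumDomain.mk p) = p.z + laplaceSum A f.tail p.z p.θ := by
  rw [sumDiffeo, borelSum_mk hA hρ h]
  rfl

/-- `Sum f` maps `Σ^𝒜_{τ'}` into `Σ^𝒜_τ`, the direction being preserved: if
`Re(ze^{iθ}) - τ > 1 + F`, where `F` bounds `e^{-τ|ζ|} |φ(ζ)|` for the Borel transform `φ` of `f`,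
then the Laplace transform of `φ` is at most `1` in absolute value. -/
theorem lt_re_sumDiffeo_mul_exp (hA : A.OrdConnected) (hρ : 0 < ρ)
    (h : borelNorm A ρ τ f.tail < ⊤) (hτ' : τ + 1 + (borelNorm A ρ τ f.tail).toReal ≤ τ')
    (p : HalfPlanePoint A τ') :
    τ < (sumDiffeo A f (SumDomain.mk p) * exp (p.θ * I)).re := by
  have hmono : τ ≤ τ' := by
    have := ENNReal.toReal_nonneg (a := borelNorm A ρ τ f.tail)
    linarith
  rw [sumDiffeo_mk hA hρ (borelNorm_mono hρ hmono h)]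
  obtain ⟨u, F, hF, hu, hb, he⟩ := exists_isBorelExtension hρ h
  rw [laplaceSum_eq hρ hu p.mem]
  set c := PowerSeries.constantCoeff f.tail
  have hc := norm_nonneg c
  rw [he, ENNReal.toReal_ofReal (by positivity)] at hτ'
  have hp := p.lt
  have hn := norm_exp_ofReal_mul_I p.θ
  have h1 := norm_lap_le (n := 0) (z := p.z) hn
    (norm_le_on_ray hn (ray_mem_sectorDisc hρ p.mem) (by simpa using hb)) (by linarith : τ < _)
  have h2 : ‖lap (exp (p.θ * I)) u p.z‖ ≤ 1 := by
    refine h1.trans ?_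
    rw [zero_add, pow_one, div_le_one (by linarith)]
    linarith
  have h3 := (abs_le.1 (abs_re_le_norm ((c + lap (exp (p.θ * I)) u p.z) * exp (p.θ * I)))).1
  rw [norm_mul, hn, mul_one] at h3
  have h4 := norm_add_le c (lap (exp (p.θ * I)) u p.z)
  rw [add_mul, add_re]
  linarith

/-- The Borel sum of `f` as a map between the domains `Σ^𝒜`. -/
theorem exists_isSumMap (hA : A.OrdConnected) (hρ : 0 < ρ) (h : borelNorm A ρ τ f.tail < ⊤)
    (hτ' : τ + 1 + (borelNorm A ρ τ f.tail).toReal ≤ τ') :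
    ∃ F : SumDomain A τ' → SumDomain A τ, IsSumMap A f F := by
  have hmono : τ ≤ τ' := by
    have := ENNReal.toReal_nonneg (a := borelNorm A ρ τ f.tail)
    linarith
  refine ⟨fun P => SumDomain.mk ⟨sumDiffeo A f P, P.rep.θ, P.rep.mem, ?_⟩, fun p =>
    ⟨⟨sumDiffeo A f (SumDomain.mk p), p.θ, p.mem, lt_re_sumDiffeo_mul_exp hA hρ h hτ' p⟩, rfl, rfl,
      SumDomain.mk_eq_mk_iff.2 ⟨rfl, fun h0 => ?_⟩⟩⟩
  · have h1 := lt_re_sumDiffeo_mul_exp hA hρ h hτ' P.rep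
    rwa [P.mk_rep] at h1
  · exact (SumDomain.mk_eq_mk_iff.1 (SumDomain.mk p).mk_rep).2 (h0.trans hmono)

/-- The Borel sum of a composition is the composition of the Borel sums. -/
theorem sumDiffeo_comp (hA : A.OrdConnected) (hρ : 0 < ρ) (hf : borelNorm A ρ τ f.tail < ⊤)
    (hg : borelNorm A ρ τ g.tail < ⊤) (hτ' : τ + 1 + (borelNorm A ρ τ f.tail).toReal ≤ τ')
    {F : SumDomain A τ' → SumDomain A τ} (hF : IsSumMap A f F) (P : SumDomain A τ') :
    sumDiffeo A g (F P) = sumDiffeo A (g * f) P := by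
  rw [← P.mk_rep]
  set p := P.rep
  have hne : A.Nonempty := ⟨p.θ, p.mem⟩
  have hmono : τ ≤ τ' := by
    have := ENNReal.toReal_nonneg (a := borelNorm A ρ τ f.tail)
    linarith
  have hgf : borelNorm A ρ τ' (g * f).tail < ⊤ :=
    borelNorm_mono hρ hτ' ((borelNorm_mul_le hne hρ hf hg).trans_lt (ENNReal.add_lt_top.2 ⟨hf, hg⟩))
  obtain ⟨q, hqθ, hqz, hq⟩ := hF p
  rw [hq, sumDiffeo_mk hA hρ hg, sumDiffeo_mk hA hρ hgf, hqθ, hqz,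
    sumDiffeo_mk hA hρ (borelNorm_mono hρ hmono hf)]
  obtain ⟨φ, C, hC, hφ, hφb, hfe⟩ := exists_isBorelExtension hρ hf
  obtain ⟨ψ, D, hD, hψ, hψb, hge⟩ := exists_isBorelExtension hρ hg
  obtain ⟨h1, h2⟩ := isBorelExtension_mul hne hρ hC hD hφ hψ hφb hψb
  rw [laplaceSum_eq hρ hφ p.mem, laplaceSum_eq hρ hψ p.mem, laplaceSum_eq hρ h1 p.mem, h2]
  rw [hfe, ENNReal.toReal_ofReal (by positivity)] at hτ'
  rw [lap_compBorel (norm_exp_ofReal_mul_I p.θ) (starConvex_sectorDisc A hρ)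
    (ray_mem_sectorDisc hρ p.mem) hφ.2 hψ.2 hC hD hφb hψb]
  · ring
  · have := two_mul_sqrt_le_add_one hC
    have := Real.sqrt_nonneg C
    have := p.lt
    linarith

theorem isBorelExtension_zero : IsBorelExtension A ρ 0 0 := by
  refine ⟨?_, fun _ _ => analyticAt_const⟩
  have h : AnalyticAt ℂ (0 : ℂ → ℂ) 0 := analyticAt_const
  simpa using h.hasFPowerSeriesAt

theorem sumDiffeo_one (P : SumDomain A τ) :
    sumDiffeo A 1 P = P.proj := by
  rw [sumDiffeo, borelSum, show (1 : TangentDiffeo).tail = 0 from rfl,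
    laplaceSum_eq one_pos isBorelExtension_zero P.rep.mem]
  simp [lap]

/-- A map which represents the Borel sum of `f` is injective, with left inverse given by the Borel
sum of `f⁻¹`. The left inverse shows that points with the same image have the same projection to
`ℂ`; for `τ ≥ 0` their directions make an angle less than `π`, since those of the images do, so that
they also agree on the Riemann surface of the logarithm. -/
theorem sumDiffeo_inv (hA : A.OrdConnected) (hρ : 0 < ρ) (hτ : 0 ≤ τ)
    (hf : borelNorm A ρ τ f.tail < ⊤) (hg : borelNorm A ρ τ (f⁻¹).tail < ⊤)
    (hτ' : τ + 1 + (borelNorm A ρ τ f.tail).toReal ≤ τ')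
    {F : SumDomain A τ' → SumDomain A τ} (hF : IsSumMap A f F) :
    Function.Injective F ∧ ∀ P : SumDomain A τ', sumDiffeo A f⁻¹ (F P) = P.proj := by
  have h1 : ∀ P : SumDomain A τ', sumDiffeo A f⁻¹ (F P) = P.proj := fun P => by
    rw [sumDiffeo_comp hA hρ hf hg hτ' hF, inv_mul_cancel, sumDiffeo_one]
  refine ⟨fun P Q hPQ => ?_, h1⟩
  have hz : P.proj = Q.proj := by rw [← h1, ← h1, hPQ]
  rw [← P.mk_rep, ← Q.mk_rep] at hPQ hz ⊢
  obtain ⟨q, hqθ, -, hq⟩ := hF P.rep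
  obtain ⟨q', hqθ', -, hq'⟩ := hF Q.rep
  rw [hq, hq'] at hPQ
  refine SumDomain.mk_eq_mk_iff.2 ⟨hz, fun _ => ?_⟩
  rw [← hqθ, ← hqθ']
  exact (SumDomain.mk_eq_mk_iff.1 hPQ).2 hτ

end Domain

/-! ### The subgroup of summable diffeomorphisms -/

section Subgroup

variable {A : Set ℝ} {ρ τ : ℝ} {φ : PowerSeries ℂ}

theorem oneSummable_iff : OneSummable A φ ↔ ∃ ρ > 0, ∃ τ : ℝ, borelNorm A ρ τ φ < ⊤ := by
  constructor
  · rintro ⟨ρ, hρ, h, hh, τ, C, hC, hb⟩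
    exact ⟨ρ, hρ, τ, (borelNorm_le hh hC.le hb).trans_lt ENNReal.ofReal_lt_top⟩
  · rintro ⟨ρ, hρ, τ, h⟩
    obtain ⟨u, F, hF, hu, hb, -⟩ := exists_isBorelExtension hρ h
    exact ⟨ρ, hρ, u, hu, τ, F + 1, by linarith, fun ζ hζ => (hb ζ hζ).trans (by gcongr; linarith)⟩

theorem borelNorm_anti_radius {ρ' : ℝ} (hρ : 0 < ρ) (hρ' : ρ' ≤ ρ) (h : borelNorm A ρ τ φ < ⊤) :
    borelNorm A ρ' τ φ < ⊤ := by
  obtain ⟨u, F, hF, hu, hb, -⟩ := exists_isBorelExtension hρ h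
  exact (borelNorm_le (hu.mono hρ') hF fun ζ hζ => hb ζ (sectorDisc_mono hρ' hζ)).trans_lt
    ENNReal.ofReal_lt_top

/-- The Borel transform of a convergent series is an entire function of exponential growth. -/
theorem IsConvergent.oneSummable (hφ : IsConvergent φ) : OneSummable A φ := by
  obtain ⟨r, hr0, hr⟩ := ENNReal.lt_iff_exists_nnreal_btwn.1 hφ
  obtain ⟨C, hC, hCb⟩ := FormalMultilinearSeries.norm_mul_pow_le_of_lt_radius _ hr
  have hr0' : (0 : ℝ) < r := by exact_mod_cast hr0
  set R : ℝ := (r : ℝ)⁻¹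
  have hR : 0 < R := inv_pos.2 hr0'
  set q := FormalMultilinearSeries.ofScalars ℂ
    (fun n => PowerSeries.coeff (n + 1) φ / (n.factorial : ℂ))
  have hq : ∀ n (x : ℝ), 0 ≤ x → ‖q n‖ * x ^ n ≤ C * R * ((R * x) ^ n / n.factorial) := by
    intro n x hx
    have h1 := hCb (n + 1)
    rw [FormalMultilinearSeries.ofScalars_norm] at h1
    simp only [q]
    rw [FormalMultilinearSeries.ofScalars_norm, norm_div, norm_natCast, mul_pow]
    have h2 : ‖PowerSeries.coeff (n + 1) φ‖ ≤ C * R ^ (n + 1) := by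
      simp only [R]
      rw [inv_pow, ← div_eq_mul_inv, le_div_iff₀ (by positivity)]
      exact h1
    calc ‖PowerSeries.coeff (n + 1) φ‖ / n.factorial * x ^ n
        ≤ C * R ^ (n + 1) / n.factorial * x ^ n := by gcongr
      _ = C * R * (R ^ n * x ^ n / n.factorial) := by ring
  have hsum : ∀ x : ℝ, Summable fun n : ℕ => C * R * ((R * x) ^ n / n.factorial) := fun x =>
    (Real.summable_pow_div_factorial (R * x)).mul_left _
  have hrad : q.radius = ⊤ := FormalMultilinearSeries.radius_eq_top_of_summable_norm q fun x =>
    .of_nonneg_of_le (fun n => by positivity) (fun n => hq n x x.2) (hsum x)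
  have hball := q.hasFPowerSeriesOnBall (by rw [hrad]; exact ENNReal.zero_lt_top)
  rw [hrad] at hball
  refine ⟨1, one_pos, q.sum,
    ⟨hball.hasFPowerSeriesAt, fun ζ _ => hball.analyticAt_of_mem (by simp)⟩,
    R, C * R, by positivity, fun ζ _ => ?_⟩
  have h1 : HasSum (fun n : ℕ => C * R * ((R * ‖ζ‖) ^ n / n.factorial))
      (C * R * Real.exp (R * ‖ζ‖)) := by
    rw [Real.exp_eq_exp_ℝ]
    exact (NormedSpace.expSeries_div_hasSum_exp (R * ‖ζ‖)).mul_left _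
  refine tsum_of_norm_bounded h1 fun n => ?_
  refine ((q n).le_opNorm _).trans ?_
  simpa using hq n ‖ζ‖ (norm_nonneg _)

/-- The group of `1`-summable tangent-to-identity diffeomorphisms. -/
def oneSummableSubgroup (A : Set ℝ) (hA : A.Nonempty) : Subgroup TangentDiffeo where
  carrier := {f | OneSummable A f.tail}
  one_mem' := oneSummable_iff.2 ⟨1, one_pos, 0,
    (borelNorm_le (P := 0) isBorelExtension_zero le_rfl (by simp)).trans_lt ENNReal.ofReal_lt_top⟩
  mul_mem' {g f} hg hf := by
    obtain ⟨ρ₁, hρ₁, τ₁, h1⟩ := oneSummable_iff.1 hg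
    obtain ⟨ρ₂, hρ₂, τ₂, h2⟩ := oneSummable_iff.1 hf
    have hρ : 0 < min ρ₁ ρ₂ := lt_min hρ₁ hρ₂
    have h1' := borelNorm_mono hρ (le_max_left τ₁ τ₂)
      (borelNorm_anti_radius hρ₁ (min_le_left ρ₁ ρ₂) h1)
    have h2' := borelNorm_mono hρ (le_max_right τ₁ τ₂)
      (borelNorm_anti_radius hρ₂ (min_le_right ρ₁ ρ₂) h2)
    exact oneSummable_iff.2 ⟨_, hρ, _,
      (borelNorm_mul_le hA hρ h2' h1').trans_lt (ENNReal.add_lt_top.2 ⟨h2', h1'⟩)⟩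
  inv_mem' {f} hf := by
    obtain ⟨ρ, hρ, τ, h⟩ := oneSummable_iff.1 hf
    exact oneSummable_iff.2 ⟨ρ, hρ, _, (borelNorm_inv_le hA hρ h).trans_lt h⟩

end Subgroup

end

theorem theorem5 (A : Set ℝ) (hA : A.OrdConnected) (hA' : A.Nontrivial) :
    -- the `1`-summable diffeomorphisms are a subgroup which contains the convergent ones
    (∃ G : Subgroup TangentDiffeo,
      (∀ f : TangentDiffeo, f ∈ G ↔ OneSummable A f.tail) ∧
      ∀ f : TangentDiffeo, IsConvergent f.tail → f ∈ G) ∧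
    -- the Borel sum does not depend on the direction that is used to compute it
    (∀ (ρ τ : ℝ) (φ : PowerSeries ℂ), 0 < ρ → borelNorm A ρ τ φ < ⊤ →
      ∀ p : HalfPlanePoint A τ, borelSum A φ (SumDomain.mk p) = laplaceSum A φ p.z p.θ) ∧
    -- composition: norm estimate and Borel sum
    (∀ (ρ τ τ' : ℝ) (f g : TangentDiffeo), 0 < ρ →
      borelNorm A ρ τ f.tail < ⊤ → borelNorm A ρ τ g.tail < ⊤ →
      τ' = τ + 1 + (borelNorm A ρ τ f.tail).toReal →
      borelNorm A ρ τ' (g * f).tail ≤ borelNorm A ρ τ f.tail + borelNorm A ρ τ g.tail ∧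
      ∃ F : SumDomain A τ' → SumDomain A τ, IsSumMap A f F ∧
        ∀ P : SumDomain A τ', sumDiffeo A g (F P) = sumDiffeo A (g * f) P) ∧
    -- inversion: norm estimate, injectivity and Borel sum
    (∀ (ρ τ τ' : ℝ) (f : TangentDiffeo), 0 < ρ → borelNorm A ρ τ f.tail < ⊤ →
      τ' = τ + 1 + (borelNorm A ρ τ f.tail).toReal →
      borelNorm A ρ τ' (f⁻¹).tail ≤ borelNorm A ρ τ f.tail ∧
      ∃ σ T : ℝ, 0 ≤ σ ∧ borelNorm A ρ σ (f⁻¹).tail < ⊤ ∧ τ ≤ T ∧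
        ∀ τ'' ≥ T, ∃ F : SumDomain A τ'' → SumDomain A σ,
          IsSumMap A f F ∧ Function.Injective F ∧
          ∀ P : SumDomain A τ'', sumDiffeo A f⁻¹ (F P) = P.proj) := by
  have hne := hA'.nonempty
  refine ⟨⟨oneSummableSubgroup A hne, fun _ => Iff.rfl, fun _ => IsConvergent.oneSummable⟩,
    fun ρ τ φ hρ h p => borelSum_mk hA hρ h p, ?_, ?_⟩
  · rintro ρ τ τ' f g hρ hf hg rfl
    obtain ⟨F, hF⟩ := exists_isSumMap hA hρ hf le_rfl
    exact ⟨borelNorm_mul_le hne hρ hf hg, F, hF, sumDiffeo_comp hA hρ hf hg le_rfl hF⟩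
  · rintro ρ τ τ' f hρ hf rfl
    have hinv := borelNorm_inv_le hne hρ hf
    set τ' := τ + 1 + (borelNorm A ρ τ f.tail).toReal
    have hτ : τ ≤ τ' := by
      have := ENNReal.toReal_nonneg (a := borelNorm A ρ τ f.tail)
      linarith
    have hf' : borelNorm A ρ (max 0 τ') f.tail < ⊤ :=
      borelNorm_mono hρ (hτ.trans (le_max_right _ _)) hf
    have hg' : borelNorm A ρ (max 0 τ') (f⁻¹).tail < ⊤ :=
      borelNorm_mono hρ (le_max_right _ _) (hinv.trans_lt hf)
    refine ⟨hinv, max 0 τ', max 0 τ' + 1 + (borelNorm A ρ (max 0 τ') f.tail).toReal,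
      le_max_left _ _, hg', ?_, fun τ'' hτ'' => ?_⟩
    · have := ENNReal.toReal_nonneg (a := borelNorm A ρ (max 0 τ') f.tail)
      linarith [le_max_right 0 τ']
    · obtain ⟨F, hF⟩ := exists_isSumMap hA hρ hf' hτ''
      obtain ⟨h1, h2⟩ := sumDiffeo_inv hA hρ (le_max_left _ _) hf' hg' hτ'' hF
      exact ⟨F, hF, h1, h2⟩
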